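/- **Proposition (Stokes' theorem for generalized forms).** Let $M$ be a (Hausdorff) smooth $n$-manifold, $k\ge 0$, and let $\pi: J^k_0(M)\to M$ be the bundle of $k$-jets at $0$ of curves in $M$, with its natural coordinates $(x,y)\in\mathbb R^n\times\mathbb R^{nk}$. Let a connection on $\pi$ be given, i.e. a smooth projection $\Phi$ of $TJ^k_0(M)$ onto the vertical bundle $\ker\pi_*$; put $h=\mathrm{Id}-\Phi$, and denote by ${}^hX$ the horizontal lift of $X$. Let $dvol_V$ be a vertical volume form, i.e. a smooth nowhere vanishing $nk$-form on $J^k_0(M)$ which is zero as soon as one of its arguments is horizontal, and suppose that it is closed, $d_J(dvol_V)=0$. A generalized $p$-form $\bar\alpha$ assigns smoothly to each $u\in J^k_0(M)$ an alternating $p$-form $\bar\alpha_u$ on $T_{\pi(u)}M$. Let $\hat\alpha_u=\bar\alpha_u(\pi_*\cdot,\dots,\pi_*\cdot)$ be the corresponding horizontal form on $J^k_0(M)$ (smoothness of $\bar\alpha$ means smoothness of $\hat\alpha$), and define $$ (d_4\bar\alpha)_u(X_1,\dots,X_{p+1})=(d_J\hat\alpha)_u({}^hX_1,\dots,{}^hX_{p+1}),\qquad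 \langle\hat\alpha\rangle_x(X_1,\dots,X_p)=\int_{\pi^{-1}(x)}\bar\alpha_u(X_1,\dots,X_p)\,dvol_V(u), $$ where the fibres are oriented by $dvol_V$. For an oriented $p$-dimensional manifold $S$, possibly with boundary, and a smooth map $\iota:S\to M$ (for instance the inclusion of a submanifold), put $\int_{S}\bar\alpha:=\int_{S}\iota^*\langle\hat\alpha\rangle$. Let $p\ge 1$, let $M_p$ be an oriented $p$-dimensional (Hausdorff, $\sigma$-compact) smooth manifold with (possibly empty) boundary $\partial M_p$, which carries the boundary orientation, and let $\iota:M_p\to M$ be a smooth map, for instance the inclusion of a submanifold. Let $\bar\alpha$ be a smooth generalized $(p-1)$-form with compact vertical support, i.e. for each compact $K\subset M$ the part over $K$ of the closure of $\{u:\bar\alpha_u\neq0\}$ is compact. Suppose that $\bar\alpha$ has compact support along $M_p$, i.e. there is a compact $K\subset M_p$ such that $\bar\alpha_u=0$ whenever $\pi(u)=\iota(q)$ with $q\in M_p\setminus K$ (this is automatic if $M_p$ is compact). Then $$\int_{M_p} d_4\bar\alpha=\int_{\partial M_p}\bar\alpha .$$ -/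

import Mathlib

open Set Filter Topology Manifold ContDiff MeasureTheory

noncomputable section

/-- Euclidean space `ℝⁿ`, the model of the base manifold. -/
abbrev Euc (n : ℕ) : Type := EuclideanSpace ℝ (Fin n)

/-- Natural coordinates `(x, y)` on the bundle of `k`-jets of curves in an `n`-manifold. -/
abbrev JetModel (n k : ℕ) : Type := Euc n × (Fin k → Euc n)

section Calculus

theorem contDiffOn_multilinear_eval {X F G : Type*} [NormedAddCommGroup X] [NormedSpace ℝ X]
    [NormedAddCommGroup F] [NormedSpace ℝ F] [NormedAddCommGroup G] [NormedSpace ℝ G]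
    {s : Set X} : ∀ (l : ℕ) (f : X → F [×l]→L[ℝ] G) (v : X → Fin l → F),
    ContDiffOn ℝ ∞ f s → (∀ j, ContDiffOn ℝ ∞ (fun x => v x j) s) →
    ContDiffOn ℝ ∞ (fun x => f x (v x)) s
  | 0, f, v, hf, _ => by
      have : (fun x => f x (v x)) = fun x => continuousMultilinearCurryFin0 ℝ F G (f x) := by
        funext x
        simp only [continuousMultilinearCurryFin0_apply]
        congr 1
        exact Subsingleton.elim _ _
      rw [this]
      exact (continuousMultilinearCurryFin0 ℝ F G).contDiff.comp_contDiffOn hf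
  | l + 1, f, v, hf, hv => by
      let L : (F [×(l + 1)]→L[ℝ] G) ≃ₗᵢ[ℝ] (F →L[ℝ] F [×l]→L[ℝ] G) :=
        continuousMultilinearCurryLeftEquiv ℝ (fun _ : Fin (l + 1) => F) G
      have hL : ContDiff ℝ ∞ L := LinearIsometryEquiv.contDiff (𝕜 := ℝ) (E := F [×(l + 1)]→L[ℝ] G)
        (F := F →L[ℝ] F [×l]→L[ℝ] G) (n := ∞) L
      have hLf : ContDiffOn ℝ ∞ (fun x => L (f x)) s := hL.comp_contDiffOn hf
      have h1 : ContDiffOn ℝ ∞ (fun x => (L (f x)) (v x 0)) s := hLf.clm_apply (hv 0)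
      have h2 := contDiffOn_multilinear_eval l _ (fun x => Fin.tail (v x)) h1
        (fun j => hv j.succ)
      refine h2.congr fun x _ => ?_
      simp [L]

/-- The derivatives at `0` of `h ∘ f` only depend on the derivatives of `f` at `0`. -/
theorem iteratedDeriv_comp_congr {F G : Type*} [NormedAddCommGroup F] [NormedSpace ℝ F]
    [NormedAddCommGroup G] [NormedSpace ℝ G] {k : ℕ} {f g : ℝ → F} {h : F → G}
    (hf : ContDiffAt ℝ k f 0) (hg : ContDiffAt ℝ k g 0) (hh : ContDiffAt ℝ k h (f 0))
    (hfg : ∀ i ≤ k, iteratedDeriv i f 0 = iteratedDeriv i g 0) {i : ℕ} (hi : i ≤ k) :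
    iteratedDeriv i (h ∘ f) 0 = iteratedDeriv i (h ∘ g) 0 := by
  have h0 : f 0 = g 0 := by simpa using hfg 0 (Nat.zero_le _)
  rw [iteratedDeriv_vcomp_eq_sum_orderedFinpartition hh hf (by exact_mod_cast hi),
    iteratedDeriv_vcomp_eq_sum_orderedFinpartition (h0 ▸ hh) hg (by exact_mod_cast hi), h0]
  refine Finset.sum_congr rfl fun c _ => ?_
  congr 1
  funext j
  exact hfg _ ((c.partSize_le j).trans hi)

/-- The polynomial curve `t ↦ x + ∑ tⁱ / i! • yᵢ` with prescribed derivatives at `0`. -/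
def polyCurve {n k : ℕ} (z : JetModel n k) (t : ℝ) : Euc n :=
  z.1 + ∑ i : Fin k, (t ^ ((i : ℕ) + 1) / (((i : ℕ) + 1).factorial : ℝ)) • z.2 i

/-- The `i`-th derivative, `0 ≤ i ≤ k`, recorded by jet coordinates. -/
def jetCoord {n k : ℕ} (z : JetModel n k) : ℕ → Euc n
  | 0 => z.1
  | i + 1 => if h : i < k then z.2 ⟨i, h⟩ else 0

theorem contDiff_polyCurve {n k : ℕ} (z : JetModel n k) {r : ℕ∞ω} :
    ContDiff ℝ r (polyCurve z) := by
  unfold polyCurve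
  fun_prop

theorem polyCurve_zero {n k : ℕ} (z : JetModel n k) : polyCurve z 0 = z.1 := by
  simp [polyCurve]

theorem iteratedDeriv_polyCurve {n k : ℕ} (z : JetModel n k) (i : ℕ) (hi : i ≤ k) :
    iteratedDeriv i (polyCurve z) 0 = jetCoord z i := by
  rcases i with _ | i
  · simp [polyCurve_zero, jetCoord]
  have hlt : i < k := hi
  have hterm : ∀ j : Fin k, iteratedDeriv (i + 1)
      (fun t : ℝ => (t ^ ((j : ℕ) + 1) / (((j : ℕ) + 1).factorial : ℝ)) • z.2 j) 0 =
      if (⟨i, hlt⟩ : Fin k) = j then z.2 j else 0 := by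
    intro j
    rw [iteratedDeriv_smul_const (by fun_prop), iteratedDeriv_div_const,
      iteratedDeriv_fun_pow_zero]
    by_cases h : (⟨i, hlt⟩ : Fin k) = j
    · subst h
      simp [Nat.factorial_ne_zero]
    · have h' : ¬ (i + 1 = (j : ℕ) + 1) := fun hc => h (Fin.ext (by simpa using hc))
      simp only [if_neg h', if_neg h]
      simp
  have : polyCurve z = fun t => z.1 + (∑ j : Fin k,
      (t ^ ((j : ℕ) + 1) / (((j : ℕ) + 1).factorial : ℝ)) • z.2 j) := rfl
  rw [this, iteratedDeriv_const_add (by omega), iteratedDeriv_fun_sum (fun j _ => by fun_prop)]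
  simp only [hterm]
  simp [jetCoord, hlt]

/-- Transformation of jet coordinates under a map `h` between coordinate domains. -/
def jetTransform {n k : ℕ} (h : Euc n → Euc n) (z : JetModel n k) : JetModel n k :=
  (h z.1, fun i => iteratedDeriv ((i : ℕ) + 1) (h ∘ polyCurve z) 0)

theorem contDiffOn_jetTransform {n k : ℕ} {h : Euc n → Euc n} {s : Set (Euc n)} (hs : IsOpen s)
    (hh : ContDiffOn ℝ ∞ h s) :
    ContDiffOn ℝ ∞ (jetTransform h : JetModel n k → JetModel n k) (s ×ˢ univ) := by
  refine ContDiffOn.prodMk (hh.comp contDiffOn_fst fun z hz => hz.1) ?_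
  refine contDiffOn_pi.2 fun i => ?_
  have key : ContDiffOn ℝ ∞ (fun z : JetModel n k => ∑ c : OrderedFinpartition ((i : ℕ) + 1),
      iteratedFDeriv ℝ c.length h z.1 fun j => jetCoord z (c.partSize j)) (s ×ˢ univ) := by
    refine ContDiffOn.sum fun c _ => contDiffOn_multilinear_eval _ _ _ ?_ fun j => ?_
    · have h1 : ContDiffOn ℝ ∞ (iteratedFDeriv ℝ c.length h) s := by
        intro x hx
        exact ((hh.contDiffAt (hs.mem_nhds hx)).iteratedFDeriv_right
          (m := ∞) (by exact_mod_cast le_top)).contDiffWithinAt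
      exact h1.comp contDiffOn_fst fun z hz => hz.1
    · have hp := c.partSize_pos j
      obtain ⟨l, hl⟩ : ∃ l, c.partSize j = l + 1 := ⟨c.partSize j - 1, by omega⟩
      have hlk : l < k := by
        have := c.partSize_le j
        have := i.2
        omega
      simp only [hl, jetCoord, hlk, dif_pos]
      fun_prop
  refine key.congr fun z hz => ?_
  have hx : ContDiffAt ℝ ∞ h (polyCurve z 0) := by
    rw [polyCurve_zero]
    exact hh.contDiffAt (hs.mem_nhds hz.1)
  rw [iteratedDeriv_vcomp_eq_sum_orderedFinpartition hx
    ((contDiff_polyCurve z).contDiffAt) (by exact_mod_cast le_top)]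
  refine Finset.sum_congr rfl fun c _ => ?_
  rw [polyCurve_zero]
  congr 1
  funext j
  refine iteratedDeriv_polyCurve z _ ?_
  have := c.partSize_le j
  have := i.2
  omega

end Calculus

section Jets

/-- Curves in `M`, defined near `0` and of class `C^k` there. -/
def CurveAt (n k : ℕ) (M : Type*) [TopologicalSpace M] [ChartedSpace (Euc n) M] : Type _ :=
  {γ : ℝ → M // ContMDiffAt 𝓘(ℝ, ℝ) (𝓡 n) k γ 0}

variable {n k : ℕ} {M : Type*} [TopologicalSpace M] [ChartedSpace (Euc n) M]

/-- Two curves have the same `k`-jet at `0` if they start at the same point and have there, in all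
coordinate systems, the same derivatives of order `≤ k`. -/
def curveSetoid (n k : ℕ) (M : Type*) [TopologicalSpace M] [ChartedSpace (Euc n) M] :
    Setoid (CurveAt n k M) where
  r γ₁ γ₂ := γ₁.1 0 = γ₂.1 0 ∧ ∀ e ∈ atlas (Euc n) M, γ₁.1 0 ∈ e.source → ∀ i ≤ k,
    iteratedDeriv i (e ∘ γ₁.1) 0 = iteratedDeriv i (e ∘ γ₂.1) 0
  iseqv :=
    { refl := fun _ => ⟨rfl, fun _ _ _ _ _ => rfl⟩
      symm := fun h => ⟨h.1.symm, fun e he hs i hi => (h.2 e he (h.1 ▸ hs) i hi).symm⟩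
      trans := fun h h' => ⟨h.1.trans h'.1, fun e he hs i hi =>
        (h.2 e he hs i hi).trans (h'.2 e he (h.1 ▸ hs) i hi)⟩ }

/-- The bundle `J^k_0(M)` of `k`-jets at `0` of curves in the `n`-manifold `M`. -/
def CurveJet (n k : ℕ) (M : Type*) [TopologicalSpace M] [ChartedSpace (Euc n) M] : Type _ :=
  Quotient (curveSetoid n k M)

namespace CurveJet

/-- The bundle projection `J^k_0(M) → M`. -/
def proj (u : CurveJet n k M) : M :=
  Quotient.lift (fun γ : CurveAt n k M => γ.1 0) 
    (fun _ _ (h : (curveSetoid n k M).r _ _) => h.1) u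

/-- The `k`-jet of a curve. -/
def mk (γ : CurveAt n k M) : CurveJet n k M := Quotient.mk (curveSetoid n k M) γ

/-- A curve representing a jet. -/
def rep (u : CurveJet n k M) : CurveAt n k M := Quotient.out u

theorem mk_rep (u : CurveJet n k M) : mk u.rep = u := Quotient.out_eq u

theorem proj_mk (γ : CurveAt n k M) : (mk γ).proj = γ.1 0 := rfl

theorem rep_zero (u : CurveJet n k M) : u.rep.1 0 = u.proj := by
  conv_rhs => rw [← mk_rep u, proj_mk]

/-- Natural coordinates of a jet in a chart `e` of `M`: the base point and the derivatives of
orders `1, …, k` of a representing curve, all read in `e`. -/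
def coords (e : OpenPartialHomeomorph M (Euc n)) (u : CurveJet n k M) : JetModel n k :=
  (e u.proj, fun i => iteratedDeriv ((i : ℕ) + 1) (e ∘ u.rep.1) 0)

theorem contDiffAt_chart_comp [IsManifold (𝓡 n) ∞ M] {e : OpenPartialHomeomorph M (Euc n)}
    (he : e ∈ atlas (Euc n) M) (γ : CurveAt n k M) (h : γ.1 0 ∈ e.source) :
    ContDiffAt ℝ k (e ∘ γ.1) 0 := by
  have h1 : ContMDiffAt (𝓡 n) 𝓘(ℝ, Euc n) ∞ e (γ.1 0) :=
    contMDiffAt_of_mem_maximalAtlas (IsManifold.subset_maximalAtlas he) h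
  have h2 : ContMDiffAt (𝓡 n) 𝓘(ℝ, Euc n) k e (γ.1 0) := h1.of_le (by exact_mod_cast le_top)
  exact contMDiffAt_iff_contDiffAt.1 (ContMDiffAt.comp (0 : ℝ) h2 γ.2)

theorem coords_mk {e : OpenPartialHomeomorph M (Euc n)} (he : e ∈ atlas (Euc n) M)
    (γ : CurveAt n k M) (h : γ.1 0 ∈ e.source) :
    coords e (mk γ) = (e (γ.1 0), fun i : Fin k => iteratedDeriv ((i : ℕ) + 1) (e ∘ γ.1) 0) := by
  have hr : (curveSetoid n k M).r (mk γ).rep γ := Quotient.exact (mk_rep (mk γ))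
  refine Prod.ext rfl (funext fun i => ?_)
  exact hr.2 e he (hr.1 ▸ h) _ i.2

/-- The curve whose expression in the chart `e` is a given polynomial. -/
def curveOfCoords [IsManifold (𝓡 n) ∞ M] (e : OpenPartialHomeomorph M (Euc n))
    (he : e ∈ atlas (Euc n) M) (z : JetModel n k) (hz : z.1 ∈ e.target) : CurveAt n k M :=
  ⟨fun t => e.symm (polyCurve z t), by
    have h1 : ContMDiffAt 𝓘(ℝ, Euc n) (𝓡 n) ∞ e.symm (polyCurve z 0) :=
      contMDiffAt_symm_of_mem_maximalAtlas (IsManifold.subset_maximalAtlas he)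
        (by rw [polyCurve_zero]; exact hz)
    have h2 : ContMDiffAt 𝓘(ℝ, Euc n) (𝓡 n) k e.symm (polyCurve z 0) :=
      h1.of_le (by exact_mod_cast le_top)
    exact ContMDiffAt.comp (0 : ℝ) h2 (contDiff_polyCurve z).contMDiff.contMDiffAt⟩

open Classical in
/-- The jet with natural coordinates `z` in the chart `e` (with a junk value if the base point of
`z` is not in the target of `e`). -/
def ofCoords [IsManifold (𝓡 n) ∞ M] (e : OpenPartialHomeomorph M (Euc n))
    (he : e ∈ atlas (Euc n) M) (z : JetModel n k) : CurveJet n k M :=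
  if hz : z.1 ∈ e.target then mk (curveOfCoords e he z hz)
  else mk ⟨fun _ => e.symm z.1, contMDiffAt_const⟩

theorem proj_ofCoords [IsManifold (𝓡 n) ∞ M] (e : OpenPartialHomeomorph M (Euc n))
    (he : e ∈ atlas (Euc n) M) (z : JetModel n k) : (ofCoords e he z).proj = e.symm z.1 := by
  unfold ofCoords
  split_ifs with hz
  · rw [proj_mk]
    simp [curveOfCoords, polyCurve_zero]
  · rfl

/-- In a chart `e'`, the jet with coordinates `z` in the chart `e` has the transformed
coordinates. -/
theorem coords_ofCoords [IsManifold (𝓡 n) ∞ M] {e e' : OpenPartialHomeomorph M (Euc n)}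
    (he : e ∈ atlas (Euc n) M) (he' : e' ∈ atlas (Euc n) M) {z : JetModel n k}
    (hz : z.1 ∈ e.target) (hz' : e.symm z.1 ∈ e'.source) :
    coords e' (ofCoords e he z) = jetTransform (e' ∘ e.symm) z := by
  have h0 : (curveOfCoords e he z hz).1 0 = e.symm z.1 := by simp [curveOfCoords, polyCurve_zero]
  unfold ofCoords
  rw [dif_pos hz, coords_mk he' _ (h0 ▸ hz'), h0]
  rfl

theorem jetTransform_of_eventuallyEq_id {h : Euc n → Euc n} {z : JetModel n k}
    (hh : ∀ᶠ x in 𝓝 z.1, h x = x) : jetTransform h z = z := by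
  refine Prod.ext hh.self_of_nhds (funext fun i => ?_)
  have hc : Tendsto (polyCurve z) (𝓝 0) (𝓝 z.1) := by
    have := (contDiff_polyCurve z (r := 0)).continuous.tendsto 0
    rwa [polyCurve_zero] at this
  have : h ∘ polyCurve z =ᶠ[𝓝 0] polyCurve z := hc.eventually hh
  change iteratedDeriv ((i : ℕ) + 1) (h ∘ polyCurve z) 0 = _
  rw [(this.iteratedDeriv_eq _), iteratedDeriv_polyCurve z _ i.2]
  simp [jetCoord]

/-- A jet is determined by its coordinates in any chart. -/
theorem ext_coords [IsManifold (𝓡 n) ∞ M] {e : OpenPartialHomeomorph M (Euc n)}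
    (he : e ∈ atlas (Euc n) M) {u v : CurveJet n k M} (hu : u.proj ∈ e.source)
    (hv : v.proj ∈ e.source) (h : coords e u = coords e v) : u = v := by
  rw [← mk_rep u, ← mk_rep v]
  rw [← rep_zero] at hu hv
  have h0 : e (u.rep.1 0) = e (v.rep.1 0) := by
    rw [rep_zero, rep_zero]
    exact congrArg Prod.fst h
  have hbase : u.rep.1 0 = v.rep.1 0 := e.injOn hu hv h0
  have hder : ∀ i ≤ k, iteratedDeriv i (e ∘ u.rep.1) 0 = iteratedDeriv i (e ∘ v.rep.1) 0 := by
    intro i hi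
    rcases i with _ | i
    · simpa using h0
    · exact congrFun (congrArg Prod.snd h) ⟨i, hi⟩
  refine Quotient.sound (s := curveSetoid n k M) ⟨hbase, fun e' he' hs i hi => ?_⟩
  have htr : ContDiffAt ℝ k (e' ∘ e.symm) ((e ∘ u.rep.1) 0) := by
    have h1 : ContMDiffAt 𝓘(ℝ, Euc n) (𝓡 n) ∞ e.symm (e (u.rep.1 0)) :=
      contMDiffAt_symm_of_mem_maximalAtlas (IsManifold.subset_maximalAtlas he) (e.map_source hu)
    have h2 : ContMDiffAt (𝓡 n) 𝓘(ℝ, Euc n) ∞ e' (e.symm (e (u.rep.1 0))) :=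
      contMDiffAt_of_mem_maximalAtlas (IsManifold.subset_maximalAtlas he')
        (by rwa [e.left_inv hu])
    exact (contMDiffAt_iff_contDiffAt.1 (h2.comp _ h1)).of_le (by exact_mod_cast le_top)
  have hev : ∀ w : CurveAt n k M, w.1 0 ∈ e.source →
      e' ∘ w.1 =ᶠ[𝓝 0] (e' ∘ e.symm) ∘ (e ∘ w.1) := by
    intro w hw
    filter_upwards [w.2.continuousAt.preimage_mem_nhds (e.open_source.mem_nhds hw)] with t ht
    simp [e.left_inv ht]
  rw [(hev _ hu).iteratedDeriv_eq, (hev _ hv).iteratedDeriv_eq]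
  exact iteratedDeriv_comp_congr (contDiffAt_chart_comp he _ hu) (contDiffAt_chart_comp he _ hv)
    htr hder hi

/-- The natural chart of `J^k_0(M)` induced by a chart of `M`. -/
def natChart [IsManifold (𝓡 n) ∞ M] (e : OpenPartialHomeomorph M (Euc n))
    (he : e ∈ atlas (Euc n) M) : PartialEquiv (CurveJet n k M) (JetModel n k) where
  toFun := coords e
  invFun := ofCoords e he
  source := proj ⁻¹' e.source
  target := e.target ×ˢ univ
  map_source' u hu := ⟨e.map_source hu, mem_univ _⟩
  map_target' z hz := by
    rw [mem_preimage, proj_ofCoords]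
    exact e.map_target hz.1
  left_inv' u hu := by
    have hz : (coords e u).1 ∈ e.target := e.map_source hu
    have hs : e.symm (coords e u).1 ∈ e.source := e.map_target hz
    refine ext_coords he (by rwa [proj_ofCoords]) hu ?_
    rw [coords_ofCoords he he hz hs]
    exact jetTransform_of_eventuallyEq_id
      (Filter.mem_of_superset (e.open_target.mem_nhds hz) fun x hx => e.right_inv hx)
  right_inv' z hz := by
    rw [coords_ofCoords he he hz.1 (e.map_target hz.1)]
    exact jetTransform_of_eventuallyEq_id
      (Filter.mem_of_superset (e.open_target.mem_nhds hz.1) fun x hx => e.right_inv hx)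

theorem natChart_transition_source [IsManifold (𝓡 n) ∞ M] {e e' : OpenPartialHomeomorph M (Euc n)}
    (he : e ∈ atlas (Euc n) M) (he' : e' ∈ atlas (Euc n) M) :
    ((natChart (k := k) e he).symm.trans (natChart e' he')).source =
      (e.symm ≫ₕ e').source ×ˢ univ := by
  ext z
  simp only [PartialEquiv.trans_source, PartialEquiv.symm_source, mem_inter_iff, mem_preimage,
    OpenPartialHomeomorph.trans_source, OpenPartialHomeomorph.symm_source, mem_prod, mem_univ,
    and_true]
  refine and_congr (by simp [natChart]) ?_
  change (ofCoords e he z).proj ∈ e'.source ↔ _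
  rw [proj_ofCoords]

theorem contDiffOn_natChart_transition [IsManifold (𝓡 n) ∞ M]
    {e e' : OpenPartialHomeomorph M (Euc n)}
    (he : e ∈ atlas (Euc n) M) (he' : e' ∈ atlas (Euc n) M) :
    ContDiffOn ℝ ∞ ((natChart (k := k) e he).symm.trans (natChart e' he'))
      ((natChart (k := k) e he).symm.trans (natChart e' he')).source := by
  rw [natChart_transition_source]
  have h1 : ContDiffOn ℝ ∞ (e' ∘ e.symm) (e.symm ≫ₕ e').source := by
    intro x hx
    have hx' := hx
    rw [OpenPartialHomeomorph.trans_source] at hx'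
    have h1 : ContMDiffAt 𝓘(ℝ, Euc n) (𝓡 n) ∞ e.symm x :=
      contMDiffAt_symm_of_mem_maximalAtlas (IsManifold.subset_maximalAtlas he) hx'.1
    have h2 : ContMDiffAt (𝓡 n) 𝓘(ℝ, Euc n) ∞ e' (e.symm x) :=
      contMDiffAt_of_mem_maximalAtlas (IsManifold.subset_maximalAtlas he') hx'.2
    exact (contMDiffAt_iff_contDiffAt.1 (h2.comp _ h1)).contDiffWithinAt
  refine (contDiffOn_jetTransform (e.symm ≫ₕ e').open_source h1).congr fun z hz => ?_
  have hz' := hz.1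
  rw [OpenPartialHomeomorph.trans_source] at hz'
  exact coords_ofCoords he he' hz'.1 hz'.2

/-- The atlas of natural charts. -/
def core (n k : ℕ) (M : Type*) [TopologicalSpace M] [ChartedSpace (Euc n) M]
    [IsManifold (𝓡 n) ∞ M] : ChartedSpaceCore (JetModel n k) (CurveJet n k M) where
  atlas := {c | ∃ (e : OpenPartialHomeomorph M (Euc n)) (he : e ∈ atlas (Euc n) M),
    c = natChart e he}
  chartAt u := natChart (chartAt (Euc n) u.proj) (chart_mem_atlas _ _)
  mem_chart_source u := mem_chart_source (Euc n) u.proj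
  chart_mem_atlas u := ⟨_, _, rfl⟩
  open_source := by
    rintro _ _ ⟨e, he, rfl⟩ ⟨e', he', rfl⟩
    rw [natChart_transition_source]
    exact (e.symm ≫ₕ e').open_source.prod isOpen_univ
  continuousOn_toFun := by
    rintro _ _ ⟨e, he, rfl⟩ ⟨e', he', rfl⟩
    exact (contDiffOn_natChart_transition he he').continuousOn

instance [IsManifold (𝓡 n) ∞ M] : TopologicalSpace (CurveJet n k M) :=
  (core n k M).toTopologicalSpace

instance [IsManifold (𝓡 n) ∞ M] : ChartedSpace (JetModel n k) (CurveJet n k M) :=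
  (core n k M).toChartedSpace

instance [IsManifold (𝓡 n) ∞ M] : IsManifold 𝓘(ℝ, JetModel n k) ∞ (CurveJet n k M) := by
  refine isManifold_of_contDiffOn _ _ _ fun c c' hc hc' => ?_
  have hc1 : ∃ p, ∃ hp : p ∈ (core n k M).atlas, c = (core n k M).openPartialHomeomorph p hp := by
    simpa [atlas, ChartedSpace.atlas, ChartedSpaceCore.toChartedSpace] using hc
  have hc2 : ∃ p, ∃ hp : p ∈ (core n k M).atlas, c' = (core n k M).openPartialHomeomorph p hp := by
    simpa [atlas, ChartedSpace.atlas, ChartedSpaceCore.toChartedSpace] using hc'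
  obtain ⟨_, ⟨e, he, rfl⟩, rfl⟩ := hc1
  obtain ⟨_, ⟨e', he', rfl⟩, rfl⟩ := hc2
  refine (contDiffOn_natChart_transition (k := k) he he').mono fun z hz => hz.1

/-- In the preferred charts, the bundle projection is `(x, y) ↦ x`. -/
theorem hasMFDerivAt_proj [IsManifold (𝓡 n) ∞ M] (u : CurveJet n k M) :
    HasMFDerivAt 𝓘(ℝ, JetModel n k) (𝓡 n) (proj : CurveJet n k M → M) u
      (ContinuousLinearMap.fst ℝ (Euc n) (Fin k → Euc n)) := by
  have hcont : Continuous (proj : CurveJet n k M → M) := by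
    refine continuous_iff_continuousAt.2 fun v => ?_
    set e := chartAt (Euc n) v.proj with he
    have hs : (chartAt (JetModel n k) v).source = proj ⁻¹' e.source := rfl
    have h1 : ContinuousOn (fun w => e.symm ((chartAt (JetModel n k) v) w).1)
        (chartAt (JetModel n k) v).source :=
      e.continuousOn_symm.comp
        (continuous_fst.comp_continuousOn (chartAt (JetModel n k) v).continuousOn)
        fun w hw => e.map_source hw
    have h2 := h1.continuousAt
      ((chartAt (JetModel n k) v).open_source.mem_nhds (mem_chart_source _ v))
    refine h2.congr (Filter.mem_of_superset
      ((chartAt (JetModel n k) v).open_source.mem_nhds (mem_chart_source _ v)) fun w hw => ?_)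
    exact e.left_inv hw
  refine ⟨hcont.continuousAt, ?_⟩
  have hu : extChartAt 𝓘(ℝ, JetModel n k) u u ∈ (chartAt (JetModel n k) u).target :=
    (chartAt (JetModel n k) u).map_source (mem_chart_source _ u)
  refine HasFDerivAt.hasFDerivWithinAt ?_
  refine (ContinuousLinearMap.hasFDerivAt (ContinuousLinearMap.fst ℝ (Euc n)
    (Fin k → Euc n))).congr_of_eventuallyEq ?_
  refine Filter.mem_of_superset
    ((chartAt (JetModel n k) u).open_target.mem_nhds hu) fun z hz => ?_
  have hz' : z.1 ∈ (chartAt (Euc n) u.proj).target := hz.1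
  change (chartAt (Euc n) u.proj) (ofCoords _ _ z).proj = z.1
  rw [proj_ofCoords]
  exact (chartAt (Euc n) u.proj).right_inv hz'

end CurveJet
end Jets

section Forms

variable {E H : Type*} [NormedAddCommGroup E] [NormedSpace ℝ E] [TopologicalSpace H]

/-- Differential `p`-forms, not necessarily smooth, on a manifold `X` modelled on `I`. -/
abbrev DiffForm (I : ModelWithCorners ℝ E H) (X : Type*) [TopologicalSpace X] [ChartedSpace H X]
    (p : ℕ) : Type _ :=
  ∀ x : X, TangentSpace I x [⋀^Fin p]→L[ℝ] ℝ

namespace DiffForm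

variable {I : ModelWithCorners ℝ E H} {X : Type*} [TopologicalSpace X] [ChartedSpace H X] {p : ℕ}

/-- The expression of a form in the preferred chart around `c`, i.e. its pullback by the inverse
of this chart. -/
def inChart (τ : DiffForm I X p) (c : X) (y : E) : E [⋀^Fin p]→L[ℝ] ℝ :=
  (τ ((extChartAt I c).symm y)).compContinuousLinearMap
    (mfderivWithin 𝓘(ℝ, E) I (extChartAt I c).symm (range I) y)

/-- A form is smooth if its expressions in the charts are smooth. -/
def IsSmooth (τ : DiffForm I X p) : Prop :=
  ∀ c : X, ContDiffOn ℝ ∞ (τ.inChart c) (extChartAt I c).target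

/-- The exterior derivative of a form, computed at each point in the preferred chart there. -/
def extD (τ : DiffForm I X p) : DiffForm I X (p + 1) := fun x =>
  (extDerivWithin (τ.inChart x) (range I) (extChartAt I x x)).compContinuousLinearMap
    (mfderiv I 𝓘(ℝ, E) (extChartAt I x) x)

/-- The pullback of a form by a map `f : Y → X`. -/
def pullback {E' H' : Type*} [NormedAddCommGroup E'] [NormedSpace ℝ E'] [TopologicalSpace H']
    {I' : ModelWithCorners ℝ E' H'} {Y : Type*} [TopologicalSpace Y] [ChartedSpace H' Y]
    (f : Y → X) (τ : DiffForm I X p) : DiffForm I' Y p := fun y =>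
  (τ (f y)).compContinuousLinearMap (mfderiv I' I f y)

end DiffForm

end Forms

section Integration

variable {d : ℕ} {H : Type*} [TopologicalSpace H]

/-- The coordinate frame `∂₀, …, ∂_{d-1}` of the preferred chart around `c`, at the point with
coordinates `y`. -/
def coordFrame (I : ModelWithCorners ℝ (Euc d) H) {N : Type*} [TopologicalSpace N]
    [ChartedSpace H N] (c : N) (y : Euc d) (i : Fin d) :
    TangentSpace I ((extChartAt I c).symm y) :=
  mfderivWithin 𝓘(ℝ, Euc d) I (extChartAt I c).symm (range I) y (EuclideanSpace.single i (1 : ℝ))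

/-- The sign (`1`, `-1`, or `0` for a linearly dependent family) of a family of vectors with
respect to an orientation. -/
def frameSign {V : Type*} [AddCommGroup V] [Module ℝ V] (o : Orientation ℝ V (Fin d))
    (v : Fin d → V) : SignType :=
  SignType.sign (o.someVector v)

/-- An orientation of a `d`-dimensional manifold, possibly with boundary: an orientation of each
tangent space, such that the coordinate frames have a locally constant sign. -/
structure ManifoldOrientation (I : ModelWithCorners ℝ (Euc d) H) (N : Type*) [TopologicalSpace N]
    [ChartedSpace H N] where
  /-- the orientation of each tangent space -/
  orient : ∀ q : N, Orientation ℝ (TangentSpace I q) (Fin d)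
  continuousOn_sign : ∀ c : N, ContinuousOn
    (fun y => frameSign (orient ((extChartAt I c).symm y)) (coordFrame I c y))
    (extChartAt I c).target

/-- A smooth partition of unity subordinate to the domains of the preferred charts. -/
def chartPartition (I : ModelWithCorners ℝ (Euc d) H) (N : Type*) [TopologicalSpace N]
    [ChartedSpace H N] [IsManifold I ∞ N] [T2Space N] [SigmaCompactSpace N] :
    SmoothPartitionOfUnity N I N univ :=
  (SmoothPartitionOfUnity.exists_isSubordinate_chartAt_source I N).choose

/-- The integral of a `d`-form with compact support over an oriented `d`-dimensional manifold,
possibly with boundary: `∑_c ∫ ρ_c τ(∂₀, …, ∂_{d-1}) dy`, where the sign of a coordinate frame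
which is not positively oriented is corrected. -/
def ManifoldOrientation.integral {I : ModelWithCorners ℝ (Euc d) H} {N : Type*}
    [TopologicalSpace N] [ChartedSpace H N] [IsManifold I ∞ N] [T2Space N] [SigmaCompactSpace N]
    (o : ManifoldOrientation I N) (τ : DiffForm I N d) : ℝ :=
  ∑ᶠ c : N, ∫ y in (extChartAt I c).target,
    chartPartition I N c ((extChartAt I c).symm y) *
      (frameSign (o.orient ((extChartAt I c).symm y)) (coordFrame I c y) : ℝ) *
      τ ((extChartAt I c).symm y) (coordFrame I c y)

/-- The boundary point `(0, z)` of the half space. -/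
def halfSpaceBoundary {m : ℕ} (z : Euc m) : Euc (m + 1) :=
  WithLp.toLp 2 (Fin.cons 0 z.ofLp)

/-- The integral of an `m`-form with compact support over the boundary of an oriented
`(m+1)`-dimensional manifold `N` with boundary. The charts of `N` are valued in the half space
`{y₀ ≥ 0}`; their restrictions to `∂N` have the coordinate frame `∂₁, …, ∂_m`, and `-∂₀` points
outwards. The boundary is oriented by the rule "outward vector first". -/
def ManifoldOrientation.boundaryIntegral {m : ℕ} {N : Type*} [TopologicalSpace N]
    [ChartedSpace (EuclideanHalfSpace (m + 1)) N] [IsManifold (𝓡∂ (m + 1)) ∞ N] [T2Space N]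
    [SigmaCompactSpace N] (o : ManifoldOrientation (𝓡∂ (m + 1)) N)
    (τ : DiffForm (𝓡∂ (m + 1)) N m) : ℝ :=
  ∑ᶠ c : N, ∫ z in {z : Euc m | halfSpaceBoundary z ∈ (extChartAt (𝓡∂ (m + 1)) c).target},
    chartPartition (𝓡∂ (m + 1)) N c ((extChartAt (𝓡∂ (m + 1)) c).symm (halfSpaceBoundary z)) *
      (frameSign (o.orient ((extChartAt (𝓡∂ (m + 1)) c).symm (halfSpaceBoundary z)))
        (Fin.cons (-coordFrame (𝓡∂ (m + 1)) c (halfSpaceBoundary z) 0)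
          (Fin.tail (coordFrame (𝓡∂ (m + 1)) c (halfSpaceBoundary z)))) : ℝ) *
      τ ((extChartAt (𝓡∂ (m + 1)) c).symm (halfSpaceBoundary z))
        (Fin.tail (coordFrame (𝓡∂ (m + 1)) c (halfSpaceBoundary z)))

end Integration

section Generalized

variable {n k : ℕ} {M : Type*} [TopologicalSpace M] [ChartedSpace (Euc n) M]
  [IsManifold (𝓡 n) ∞ M]

/-- A connection on `J^k_0(M) → M`: a smooth vector-valued `1`-form `Φ` on `J^k_0(M)` which is, at
each point, a projection onto the vertical space `ker π_*`. Its kernel is the horizontal space. -/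
structure JetConnection (n k : ℕ) (M : Type*) [TopologicalSpace M] [ChartedSpace (Euc n) M]
    [IsManifold (𝓡 n) ∞ M] where
  /-- the projection onto the vertical space -/
  Φ : ∀ u : CurveJet n k M,
    TangentSpace 𝓘(ℝ, JetModel n k) u →L[ℝ] TangentSpace 𝓘(ℝ, JetModel n k) u
  idem : ∀ u, (Φ u).comp (Φ u) = Φ u
  range_eq : ∀ u, (Φ u).range =
    (mfderiv 𝓘(ℝ, JetModel n k) (𝓡 n) (CurveJet.proj : CurveJet n k M → M) u).ker
  smooth : ContMDiff 𝓘(ℝ, JetModel n k)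
    (𝓘(ℝ, JetModel n k).prod 𝓘(ℝ, JetModel n k →L[ℝ] JetModel n k)) ∞
    (fun u => Bundle.TotalSpace.mk' (JetModel n k →L[ℝ] JetModel n k) u (Φ u))

namespace JetConnection

/-- The projection `h = Id - Φ` onto the horizontal space. -/
def hproj (H : JetConnection n k M) (u : CurveJet n k M) :
    TangentSpace 𝓘(ℝ, JetModel n k) u →L[ℝ] TangentSpace 𝓘(ℝ, JetModel n k) u :=
  ContinuousLinearMap.id ℝ _ - H.Φ u

/-- The lift `X ↦ (X, 0)`, in natural coordinates, from `T_{π(u)}M` to `T_u J^k_0(M)`. -/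
def natLift (u : CurveJet n k M) :
    TangentSpace (𝓡 n) u.proj →L[ℝ] TangentSpace 𝓘(ℝ, JetModel n k) u :=
  ContinuousLinearMap.inl ℝ (Euc n) (Fin k → Euc n)

/-- The horizontal lift `T_{π(u)}M → T_u J^k_0(M)`: the horizontal part of any lift. -/
def hlift (H : JetConnection n k M) (u : CurveJet n k M) :
    TangentSpace (𝓡 n) u.proj →L[ℝ] TangentSpace 𝓘(ℝ, JetModel n k) u :=
  (H.hproj u).comp (natLift u)

theorem Φ_hlift (H : JetConnection n k M) (u : CurveJet n k M) (X : TangentSpace (𝓡 n) u.proj) :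
    H.Φ u (H.hlift u X) = 0 := by
  have h : ∀ w, H.Φ u (H.Φ u w) = H.Φ u w := fun w => congrArg (fun L => L w) (H.idem u)
  have h' : H.hlift u X = natLift u X - H.Φ u (natLift u X) := rfl
  rw [h', map_sub, h, sub_self]

theorem mfderiv_proj_hlift (H : JetConnection n k M) (u : CurveJet n k M)
    (X : TangentSpace (𝓡 n) u.proj) :
    mfderiv 𝓘(ℝ, JetModel n k) (𝓡 n) (CurveJet.proj : CurveJet n k M → M) u (H.hlift u X) = X := by
  set D := mfderiv 𝓘(ℝ, JetModel n k) (𝓡 n) (CurveJet.proj : CurveJet n k M → M) u with hD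
  have h1 : ∀ w, D (H.Φ u w) = 0 := fun w => by
    have : H.Φ u w ∈ (H.Φ u).range := ⟨w, rfl⟩
    rw [H.range_eq u] at this
    exact this
  have h2 : D = ContinuousLinearMap.fst ℝ (Euc n) (Fin k → Euc n) :=
    (CurveJet.hasMFDerivAt_proj u).mfderiv
  have h3 : H.hlift u X = natLift u X - H.Φ u (natLift u X) := rfl
  rw [h3, map_sub, h1, sub_zero, h2]
  rfl

end JetConnection

/-- Generalized `p`-forms, i.e. `p`-forms on `M` with values in the functions on `J^k_0(M)`: at each
jet `u`, an alternating form on the tangent space of `M` at the base point of `u`. -/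
abbrev GenForm (n k : ℕ) (M : Type*) [TopologicalSpace M] [ChartedSpace (Euc n) M]
    [IsManifold (𝓡 n) ∞ M] (p : ℕ) : Type _ :=
  ∀ u : CurveJet n k M, TangentSpace (𝓡 n) u.proj [⋀^Fin p]→L[ℝ] ℝ

namespace GenForm

variable {p : ℕ}

/-- The horizontal form `ζ(α)` on `J^k_0(M)` associated with a generalized form. -/
def zeta (α : GenForm n k M p) : DiffForm 𝓘(ℝ, JetModel n k) (CurveJet n k M) p := fun u =>
  (α u).compContinuousLinearMap
    (mfderiv 𝓘(ℝ, JetModel n k) (𝓡 n) (CurveJet.proj : CurveJet n k M → M) u)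

/-- A generalized form `α` is smooth if the form `ζ(α)` is smooth. -/
def IsSmooth (α : GenForm n k M p) : Prop := DiffForm.IsSmooth α.zeta

/-- Compact vertical support: over each compact subset of `M`, the support is compact. -/
def HasCompactVerticalSupport (α : GenForm n k M p) : Prop :=
  ∀ K : Set M, IsCompact K → IsCompact (CurveJet.proj ⁻¹' K ∩ closure {u | α u ≠ 0})

end GenForm

namespace JetConnection

variable {p : ℕ}

/-- The horizontal component `τ(h ·, …, h ·)` of a form `τ` on `J^k_0(M)`. -/
def hform (H : JetConnection n k M) (τ : DiffForm 𝓘(ℝ, JetModel n k) (CurveJet n k M) p) :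
    DiffForm 𝓘(ℝ, JetModel n k) (CurveJet n k M) p := fun u =>
  (τ u).compContinuousLinearMap (H.hproj u)

/-- The inverse `ζ⁻¹` of the isomorphism between generalized forms and horizontal forms, given by
evaluation on horizontal lifts. -/
def zetaInv (H : JetConnection n k M) (τ : DiffForm 𝓘(ℝ, JetModel n k) (CurveJet n k M) p) :
    GenForm n k M p := fun u =>
  (τ u).compContinuousLinearMap (H.hlift u)

/-- The exterior derivative `d₄ α = ζ⁻¹(h(d_J ζ(α)))` of generalized forms. -/
def d4 (H : JetConnection n k M) (α : GenForm n k M p) : GenForm n k M (p + 1) :=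
  H.zetaInv (H.hform (DiffForm.extD α.zeta))

end JetConnection

/-- A vertical volume form for a connection `H`: a smooth, nowhere vanishing form of degree `k n`
on `J^k_0(M)` which is zero as soon as one of its arguments is horizontal. -/
structure VerticalVolumeForm (H : JetConnection n k M) where
  /-- the underlying form -/
  form : DiffForm 𝓘(ℝ, JetModel n k) (CurveJet n k M) (k * n)
  smooth : form.IsSmooth
  vertical : ∀ (u : CurveJet n k M) (v : Fin (k * n) → TangentSpace 𝓘(ℝ, JetModel n k) u)
    (i : Fin (k * n)), H.Φ u (v i) = 0 → form u v = 0
  ne_zero : ∀ u, form u ≠ 0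

/-- The jet over `x` with natural fibre coordinates `y`, in the preferred chart around `x`. The map
`fibrePoint x` is a global parametrization of the fibre over `x`. -/
def fibrePoint (x : M) (y : Fin k → Euc n) : CurveJet n k M :=
  CurveJet.ofCoords (chartAt (Euc n) x) (chart_mem_atlas (Euc n) x) (chartAt (Euc n) x x, y)

theorem proj_fibrePoint (x : M) (y : Fin k → Euc n) : (fibrePoint x y).proj = x := by
  rw [fibrePoint, CurveJet.proj_ofCoords]
  exact (chartAt (Euc n) x).left_inv (mem_chart_source _ x)

/-- The standard basis of the space of fibre coordinates. -/
def fibreBasis (n k : ℕ) (A : Fin (k * n)) : Fin k → Euc n :=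
  Pi.single (finProdFinEquiv.symm A).1 (EuclideanSpace.single (finProdFinEquiv.symm A).2 1)

namespace VerticalVolumeForm

variable {H : JetConnection n k M} {p : ℕ}

/-- The density, in fibre coordinates, of the restriction of the vertical volume form to the fibre
over `x`, when the fibre is oriented by this volume form. -/
def density (vol : VerticalVolumeForm H) (x : M) (y : Fin k → Euc n) : ℝ :=
  |vol.form (fibrePoint x y) fun A =>
    mfderiv 𝓘(ℝ, Fin k → Euc n) 𝓘(ℝ, JetModel n k) (fibrePoint x : _ → CurveJet n k M) y
      (fibreBasis n k A)|

/-- The fibre average `⟨α⟩_x(X₁, …, X_p) = ∫_{π⁻¹(x)} α_u(X₁, …, X_p) dvol_V(u)`. The tangent spaces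
of `M` at `x` and at the base point of `fibrePoint x y`, which is `x`, are identified. -/
def average (vol : VerticalVolumeForm H) (α : GenForm n k M p) : DiffForm (𝓡 n) M p := fun x =>
  (∫ y : Fin k → Euc n, vol.density x y • (α (fibrePoint x y) : Euc n [⋀^Fin p]→L[ℝ] ℝ) :
    Euc n [⋀^Fin p]→L[ℝ] ℝ)

end VerticalVolumeForm

end Generalized
end

/-! Averaging over the fibres turns `d4` into the exterior derivative of `M`: ⟨d₄α⟩ = d⟨α⟩. Given
this, the theorem is the classical Stokes theorem on `N` for the pullback of ⟨α⟩, which is of class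
C¹ and vanishes outside a compact set.

The commutation is local. In natural coordinates (x, y) write a(x, y) for `α`, whose arguments are
vectors of the base only, and let X ↦ (X, AX) be the horizontal lift. Then d₄α is the
alternatization of X ↦ Da(X, AX) (`JetConnection.inNatChart_d4`). Let f be the coefficient of the
volume form on the vertical coordinate frame e₁, …, e_{kn}, and b_j(X) its value on this frame with
e_j replaced by (X, 0). Two facts link these functions. Verticality gives b_j(X) = -(AX)_j f
(`VerticalVolumeForm.mixedCoeff_eq`), so that f Da(X, AX) = f ∂_X a - ∑ b_j(X) ∂_j a. Closedness,
evaluated on (X, 0), e₁, …, e_{kn}, gives ∂_X f = ∑ ∂_j b_j(X)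
(`VerticalVolumeForm.fderiv_coeff_eq_sum`). Integration by parts along the fibre, where a has
compact support, then yields ∫ f Da(X, AX) dy = ∫ ∂_X(f a) dy = ∂_X ∫ f a dy
(`integral_fderiv_smul_eq`, `hasFDerivAt_integral_fibre`). The average is defined with |f|, but f
has no zeros, so |f| = ± f with a constant sign over a ball of base points. The result is
`VerticalVolumeForm.average_extDeriv`.

Stokes' theorem for C¹ forms comes from the divergence theorem on a box of the half space
(`integral_extDerivWithin_halfSpace`). It passes to one chart by means of the locally constant
orientation sign (`ManifoldOrientation.chartIntegral_extD`), and to `N` by a partition of unity,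
since the integral of a form supported in two charts is the same in both
(`ManifoldOrientation.chartIntegral_eq_of_support`). -/

noncomputable section

/-! ### Coordinate expressions of pullbacks and of exterior derivatives. -/

section FormsInCharts

variable {E H E' H' : Type*} [NormedAddCommGroup E] [NormedSpace ℝ E] [TopologicalSpace H]
  [NormedAddCommGroup E'] [NormedSpace ℝ E'] [TopologicalSpace H']
  {I : ModelWithCorners ℝ E H} {X : Type*} [TopologicalSpace X] [ChartedSpace H X]
  {I' : ModelWithCorners ℝ E' H'} {Y : Type*} [TopologicalSpace Y] [ChartedSpace H' Y]
  {p : ℕ}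

/-- The derivative of the coordinate expression of a smooth map. -/
theorem fderivWithin_writtenInCharts [IsManifold I ∞ X] [IsManifold I' ∞ Y] {f : Y → X}
    {b : Y} {c : X} {y : E'}
    (hy : y ∈ (extChartAt I' b).target) (hf : MDifferentiableAt I' I f ((extChartAt I' b).symm y))
    (hc : f ((extChartAt I' b).symm y) ∈ (extChartAt I c).source) :
    fderivWithin ℝ (fun z => extChartAt I c (f ((extChartAt I' b).symm z))) (range I') y =
      (mfderiv I 𝓘(ℝ, E) (extChartAt I c) (f ((extChartAt I' b).symm y))).comp
        ((mfderiv I' I f ((extChartAt I' b).symm y)).comp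
          (mfderivWithin 𝓘(ℝ, E') I' (extChartAt I' b).symm (range I') y)) := by
  have : IsManifold I 1 X := IsManifold.of_le (n := ∞) (by exact_mod_cast le_top)
  have : IsManifold I' 1 Y := IsManifold.of_le (n := ∞) (by exact_mod_cast le_top)
  have hc' : f ((extChartAt I' b).symm y) ∈ (chartAt H c).source := by
    rwa [extChartAt_source] at hc
  have h1 := (mdifferentiableWithinAt_extChartAt_symm hy).hasMFDerivWithinAt
  have h2 := HasMFDerivAt.comp_hasMFDerivWithinAt y hf.hasMFDerivAt h1
  have h3 := HasMFDerivAt.comp_hasMFDerivWithinAt y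
    (mdifferentiableAt_extChartAt (I := I) hc').hasMFDerivAt h2
  have key : ∀ L : E' →L[ℝ] E, HasMFDerivWithinAt 𝓘(ℝ, E') 𝓘(ℝ, E)
      (fun z => extChartAt I c (f ((extChartAt I' b).symm z))) (range I') y L →
      fderivWithin ℝ (fun z => extChartAt I c (f ((extChartAt I' b).symm z))) (range I') y = L :=
    fun L hL => by
      have hL' : HasFDerivWithinAt (fun z => extChartAt I c (f ((extChartAt I' b).symm z))) L
        (range I') y := hasMFDerivWithinAt_iff_hasFDerivWithinAt.1 hL
      exact hL'.fderivWithin (I'.uniqueDiffOn y (extChartAt_target_subset_range b hy))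
  exact key _ h3

/-- The coordinate expression of a smooth map is smooth. -/
theorem contDiffWithinAt_writtenInCharts [IsManifold I ∞ X] [IsManifold I' ∞ Y] {f : Y → X}
    (hf : ContMDiff I' I ∞ f) {b : Y} {c : X} {y : E'} (hy : y ∈ (extChartAt I' b).target)
    (hc : f ((extChartAt I' b).symm y) ∈ (extChartAt I c).source) :
    ContDiffWithinAt ℝ ∞ (fun z => extChartAt I c (f ((extChartAt I' b).symm z)))
      (range I') y := by
  have hc' : f ((extChartAt I' b).symm y) ∈ (chartAt H c).source := by
    rwa [extChartAt_source] at hc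
  have h1 := contMDiffWithinAt_extChartAt_symm_range (I := I') (n := ∞) b hy
  have h2 := hf.contMDiffAt.comp_contMDiffWithinAt y h1
  have h3 := (contMDiffAt_extChartAt' (I := I) (n := ∞) hc').comp_contMDiffWithinAt y h2
  exact h3.contDiffWithinAt

namespace DiffForm

/-- In coordinates, the pullback of a form is given by the coordinate expression of the map. -/
theorem inChart_pullback [IsManifold I ∞ X] [IsManifold I' ∞ Y] (τ : DiffForm I X p) {f : Y → X}
    {b : Y} {c : X} {y : E'}
    (hy : y ∈ (extChartAt I' b).target) (hf : MDifferentiableAt I' I f ((extChartAt I' b).symm y))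
    (hc : f ((extChartAt I' b).symm y) ∈ (extChartAt I c).source) :
    (τ.pullback (I' := I') f).inChart b y =
      (τ.inChart c (extChartAt I c (f ((extChartAt I' b).symm y)))).compContinuousLinearMap
        (fderivWithin ℝ (fun z => extChartAt I c (f ((extChartAt I' b).symm z)))
          (range I') y) := by
  have : IsManifold I 1 X := IsManifold.of_le (n := ∞) (by exact_mod_cast le_top)
  rw [fderivWithin_writtenInCharts hy hf hc]
  set q := (extChartAt I' b).symm y
  have hinv := mfderivWithin_extChartAt_symm_comp_mfderiv_extChartAt' hc
  have hq : (extChartAt I c).symm (extChartAt I c (f q)) = f q := (extChartAt I c).left_inv hc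
  -- All tangent spaces are the model space `E` by definition, so the equality of base points can be
  -- transported inside one fixed type of forms.
  have hτ : (τ ((extChartAt I c).symm (extChartAt I c (f q))) : E [⋀^Fin p]→L[ℝ] ℝ) = τ (f q) :=
    congrArg (β := E [⋀^Fin p]→L[ℝ] ℝ) (fun x => τ x) hq
  ext v
  change τ (f q) (fun i => _) =
    (τ ((extChartAt I c).symm (extChartAt I c (f q))) : E [⋀^Fin p]→L[ℝ] ℝ) (fun i => _)
  rw [hτ]
  congr 1
  funext i
  exact (congrArg (fun L : E →L[ℝ] E => L (mfderiv I' I f q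
    (mfderivWithin 𝓘(ℝ, E') I' (extChartAt I' b).symm (range I') y (v i)))) hinv).symm

/-- Points near `y` in the range of the model have the properties needed for
`DiffForm.inChart_pullback`. -/
theorem eventually_mem_source_writtenInCharts {f : Y → X} (hf : Continuous f) {b : Y} {c : X}
    {y : E'} (hy : y ∈ (extChartAt I' b).target)
    (hc : f ((extChartAt I' b).symm y) ∈ (extChartAt I c).source) :
    ∀ᶠ z in 𝓝[range I'] y, z ∈ (extChartAt I' b).target ∧
      f ((extChartAt I' b).symm z) ∈ (extChartAt I c).source := by
  have h1 := extChartAt_target_mem_nhdsWithin_of_mem hy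
  have h2 : ContinuousWithinAt (extChartAt I' b).symm (range I') y :=
    ((continuousOn_extChartAt_symm b).continuousWithinAt hy).mono_of_mem_nhdsWithin h1
  have h3 : ContinuousWithinAt (fun z => f ((extChartAt I' b).symm z)) (range I') y :=
    hf.continuousAt.comp_continuousWithinAt h2
  exact (Filter.eventually_of_mem h1 fun _ h => h).and
    (h3.eventually ((isOpen_extChartAt_source c).mem_nhds hc))

theorem inChart_pullback_eventuallyEq [IsManifold I ∞ X] [IsManifold I' ∞ Y] (τ : DiffForm I X p)
    {f : Y → X} (hf : ContMDiff I' I ∞ f) {b : Y} {c : X} {y : E'}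
    (hy : y ∈ (extChartAt I' b).target)
    (hc : f ((extChartAt I' b).symm y) ∈ (extChartAt I c).source) :
    (τ.pullback (I' := I') f).inChart b =ᶠ[𝓝[range I'] y] fun z =>
      (τ.inChart c (extChartAt I c (f ((extChartAt I' b).symm z)))).compContinuousLinearMap
        (fderivWithin ℝ (fun z => extChartAt I c (f ((extChartAt I' b).symm z)))
          (range I') z) := by
  filter_upwards [eventually_mem_source_writtenInCharts hf.continuous hy hc] with z hz
  exact inChart_pullback τ hz.1 (hf.mdifferentiable (by simp) _) hz.2

/-- The exterior derivative commutes with pullbacks, in coordinates. -/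
theorem extDerivWithin_inChart_pullback [IsManifold I ∞ X] [IsManifold I' ∞ Y]
    (τ : DiffForm I X p)
    {f : Y → X} (hf : ContMDiff I' I ∞ f) {b : Y} {c : X} {y : E'}
    (hy : y ∈ (extChartAt I' b).target)
    (hc : f ((extChartAt I' b).symm y) ∈ (extChartAt I c).source)
    (hτ : DifferentiableWithinAt ℝ (τ.inChart c) (range I)
      (extChartAt I c (f ((extChartAt I' b).symm y)))) :
    extDerivWithin ((τ.pullback (I' := I') f).inChart b) (range I') y =
      (extDerivWithin (τ.inChart c) (range I)
        (extChartAt I c (f ((extChartAt I' b).symm y)))).compContinuousLinearMap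
        (fderivWithin ℝ (fun z => extChartAt I c (f ((extChartAt I' b).symm z)))
          (range I') y) := by
  have hyr : y ∈ range I' := extChartAt_target_subset_range b hy
  rw [(inChart_pullback_eventuallyEq τ hf hy hc).extDerivWithin_eq_of_mem hyr]
  -- The second derivative of the coordinate map cancels by its symmetry; at a boundary point this
  -- symmetry holds because the point is in the closure of the interior.
  exact extDerivWithin_pullback (r := ∞) hτ (contDiffWithinAt_writtenInCharts hf hy hc)
    (by rw [minSmoothness_of_isRCLikeNormedField]; exact WithTop.coe_le_coe.2 le_top) I'.uniqueDiffOn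
    (I'.range_subset_closure_interior hyr) hyr (fun z _ => by
      rw [extChartAt_coe]; exact mem_range_self _)

theorem pullback_id (τ : DiffForm I X p) : τ.pullback (I' := I) id = τ := by
  funext x
  ext v
  simp [pullback, mfderiv_id]

/-- The exterior derivative may be computed in any chart. -/
theorem inChart_extD [IsManifold I ∞ X] (τ : DiffForm I X p) {b : X} {y : E}
    (hy : y ∈ (extChartAt I b).target)
    (hτ : ∀ c, DifferentiableWithinAt ℝ (τ.inChart c) (range I) (extChartAt I c c)) :
    τ.extD.inChart b y = extDerivWithin (τ.inChart b) (range I) y := by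
  set x := (extChartAt I b).symm y with hx
  -- `extD` at `x` is computed in the chart around `x`. The identity map, read from the chart around
  -- `b` to the one around `x`, is the change of charts, so naturality under pullback gives
  -- independence of the chart.
  have h1 := extDerivWithin_inChart_pullback (I' := I) τ contMDiff_id hy (c := x)
    (mem_extChartAt_source x) (hτ x)
  have h2 := fderivWithin_writtenInCharts (I := I) (I' := I) (f := id) hy mdifferentiableAt_id
    (c := x) (mem_extChartAt_source x)
  rw [pullback_id, h2] at h1
  rw [h1]
  ext v
  rw [mfderiv_id]
  rfl

end DiffForm

end FormsInCharts

/-! ### Smooth dependence of the pullback of an alternating form on the linear map. -/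

section AlternatingCalculus

variable {V W X : Type*} [NormedAddCommGroup V] [NormedSpace ℝ V] [NormedAddCommGroup W]
  [NormedSpace ℝ W] [NormedAddCommGroup X] [NormedSpace ℝ X]

/-- Alternating forms form a direct factor of the space of multilinear forms. -/
theorem exists_leftInverse_toContinuousMultilinearMap [FiniteDimensional ℝ V] (p : ℕ) :
    ∃ R : ContinuousMultilinearMap ℝ (fun _ : Fin p => V) ℝ →L[ℝ] V [⋀^Fin p]→L[ℝ] ℝ,
      ∀ f : V [⋀^Fin p]→L[ℝ] ℝ, R f.toContinuousMultilinearMap = f := by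
  have : FiniteDimensional ℝ (ContinuousMultilinearMap ℝ (fun _ : Fin p => V) ℝ) :=
    FiniteDimensional.of_injective
      (ContinuousMultilinearMap.toMultilinearMapLinear :
        ContinuousMultilinearMap ℝ (fun _ : Fin p => V) ℝ →ₗ[ℝ] _)
      ContinuousMultilinearMap.toMultilinearMap_injective
  have hinj : Function.Injective (ContinuousAlternatingMap.toContinuousMultilinearMapCLM ℝ :
      (V [⋀^Fin p]→L[ℝ] ℝ) →L[ℝ] _) :=
    ContinuousAlternatingMap.toContinuousMultilinearMap_injective
  obtain ⟨R, hR⟩ := LinearMap.exists_leftInverse_of_injective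
    (ContinuousAlternatingMap.toContinuousMultilinearMapCLM ℝ :
      (V [⋀^Fin p]→L[ℝ] ℝ) →L[ℝ] _).toLinearMap (LinearMap.ker_eq_bot.2 hinj)
  exact ⟨LinearMap.toContinuousLinearMap R, fun f => LinearMap.congr_fun hR f⟩

/-- For multilinear forms, composition is itself continuous multilinear in the linear maps, hence
smooth. The retraction `R` brings the result back to alternating forms. -/
theorem ContDiffWithinAt.alternating_compContinuousLinearMap [FiniteDimensional ℝ V] {p : ℕ}
    {r : ℕ∞ω} {f : X → W [⋀^Fin p]→L[ℝ] ℝ} {g : X → V →L[ℝ] W} {s : Set X} {x : X}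
    (hf : ContDiffWithinAt ℝ r f s x) (hg : ContDiffWithinAt ℝ r g s x) :
    ContDiffWithinAt ℝ r (fun x => (f x).compContinuousLinearMap (g x)) s x := by
  obtain ⟨R, hR⟩ := exists_leftInverse_toContinuousMultilinearMap (V := V) p
  have h1 : ContDiffWithinAt ℝ r (fun x =>
      ContinuousMultilinearMap.compContinuousLinearMapContinuousMultilinear ℝ
        (fun _ : Fin p => V) (fun _ : Fin p => W) ℝ (fun _ => g x)) s x :=
    (ContinuousMultilinearMap.contDiff _).contDiffAt.comp_contDiffWithinAt x
      (contDiffWithinAt_pi.2 fun _ => hg)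
  have h2 : ContDiffWithinAt ℝ r (fun x => (f x).toContinuousMultilinearMap) s x :=
    (ContinuousAlternatingMap.toContinuousMultilinearMapCLM ℝ :
      (W [⋀^Fin p]→L[ℝ] ℝ) →L[ℝ] _).contDiff.contDiffAt.comp_contDiffWithinAt x hf
  refine (R.contDiff.contDiffAt.comp_contDiffWithinAt x (h1.clm_apply h2)).congr_of_eventuallyEq
    (Eventually.of_forall fun z => ?_) ?_
  all_goals exact (hR _).symm

end AlternatingCalculus

/-! ### Stokes' theorem on the half space. -/

section HalfSpace

variable {m : ℕ}

theorem uniqueDiffOn_halfSpace : UniqueDiffOn ℝ {x : Euc (m + 1) | 0 ≤ x 0} := by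
  rw [← range_modelWithCornersEuclideanHalfSpace]
  exact (𝓡∂ (m + 1)).uniqueDiffOn

theorem isClosed_halfSpace : IsClosed {x : Euc (m + 1) | 0 ≤ x 0} :=
  isClosed_le continuous_const (by fun_prop)

theorem extDerivWithin_eq_zero_of_compact_support {E : Type*} [NormedAddCommGroup E]
    [NormedSpace ℝ E] {S K : Set E} (hK : IsClosed K) {p : ℕ}
    {τ : E → E [⋀^Fin p]→L[ℝ] ℝ} (h0 : ∀ x ∈ S, x ∉ K → τ x = 0)
    {x : E} (hx : x ∈ S) (hxK : x ∉ K) : extDerivWithin τ S x = 0 := by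
  have h : τ =ᶠ[𝓝[S] x] fun _ => 0 := by
    filter_upwards [self_mem_nhdsWithin, nhdsWithin_le_nhds (hK.isOpen_compl.mem_nhds hxK)]
      with y hy hy' using h0 y hy hy'
  rw [h.extDerivWithin_eq_of_mem hx]
  rw [extDerivWithin, fderivWithin_fun_const]
  exact map_zero (ContinuousAlternatingMap.alternatizeUncurryFinCLM ℝ E ℝ)

/-- Stokes' theorem for a form with compact support on the half space. -/
theorem integral_extDerivWithin_halfSpace {τ : Euc (m + 1) → Euc (m + 1) [⋀^Fin m]→L[ℝ] ℝ}
    (hτ : ContDiffOn ℝ 1 τ {x | 0 ≤ x 0}) {K : Set (Euc (m + 1))} (hK : IsCompact K)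
    (h0 : ∀ x : Euc (m + 1), 0 ≤ x 0 → x ∉ K → τ x = 0) :
    ∫ y in {x : Euc (m + 1) | 0 ≤ x 0}, extDerivWithin τ {x | 0 ≤ x 0} y
        (fun i => EuclideanSpace.single i (1 : ℝ)) =
      -∫ z : Euc m, τ (halfSpaceBoundary z)
        (Fin.tail fun i => EuclideanSpace.single i (1 : ℝ)) := by
  set S : Set (Euc (m + 1)) := {x | 0 ≤ x 0} with hS
  set e : Fin (m + 1) → Euc (m + 1) := fun i => EuclideanSpace.single i (1 : ℝ) with he
  obtain ⟨R, hR0, hR⟩ : ∃ R : ℝ, 0 < R ∧ ∀ x ∈ K, ∀ i, |x i| < R := by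
    obtain ⟨R, hR⟩ := hK.isBounded.exists_norm_le
    refine ⟨|R| + 1, by positivity, fun x hx i => ?_⟩
    have h1 : |x i| ≤ ‖x‖ := PiLp.norm_apply_le x i
    linarith [hR x hx, le_abs_self R]
  let L : (Fin (m + 1) → ℝ) ≃L[ℝ] Euc (m + 1) :=
    (PiLp.continuousLinearEquiv 2 ℝ (fun _ : Fin (m + 1) => ℝ)).symm
  have hL : ∀ x, L x = WithLp.toLp 2 x := fun _ => rfl
  -- The box [0, R] × [-R, R]^m contains the part of `K` in the half space. Among its faces, only
  -- the one in {x₀ = 0} can meet `K`.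
  let a : Fin (m + 1) → ℝ := Fin.cons 0 (fun _ => -R)
  let b : Fin (m + 1) → ℝ := fun _ => R
  let g : Fin (m + 1) → Euc (m + 1) → ℝ := fun i x => τ x (i.removeNth e)
  have hgd : ∀ i, ContDiffOn ℝ 1 (g i) S := fun i =>
    (ContinuousAlternatingMap.apply ℝ (Euc (m + 1)) ℝ (i.removeNth e)).contDiff.comp_contDiffOn hτ
  let f : Fin (m + 1) → (Fin (m + 1) → ℝ) → ℝ := fun i x => (-1) ^ (i : ℕ) * g i (L x)
  let f' : Fin (m + 1) → (Fin (m + 1) → ℝ) → (Fin (m + 1) → ℝ) →L[ℝ] ℝ := fun i x =>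
    ((-1 : ℝ) ^ (i : ℕ)) • (fderivWithin ℝ (g i) S (L x)).comp (L : _ →L[ℝ] Euc (m + 1))
  have ha0 : ∀ i, a i ≤ 0 := by
    intro i
    refine Fin.cases ?_ (fun j => ?_) i <;> simp [a, hR0.le]
  have hle : a ≤ b := fun i => (ha0 i).trans hR0.le
  have hmaps : MapsTo L (Icc a b) S := fun x hx => by
    exact hx.1 0
  -- The alternating sum defining dτ(e₀, …, e_m) is the divergence of the field with components
  -- (-1)^i τ(…, omit e_i, …).
  have hDF : ∀ x, L x ∈ S → ∑ i, f' i x (Pi.single i 1) = extDerivWithin τ S (L x) e := by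
    intro x hx
    rw [extDerivWithin_apply ((hτ.differentiableOn one_ne_zero) _ hx)
      (uniqueDiffOn_halfSpace _ hx)]
    refine Finset.sum_congr rfl fun i _ => ?_
    have : L (Pi.single i 1) = e i := by
      rw [hL]; simp [he]
    simp [f', this, g]
  have hcd : ContinuousOn (fun y => extDerivWithin τ S y e) S := by
    have h1 := hτ.continuousOn_fderivWithin uniqueDiffOn_halfSpace le_rfl
    exact ((ContinuousAlternatingMap.apply ℝ (Euc (m + 1)) ℝ e).comp
      (ContinuousAlternatingMap.alternatizeUncurryFinCLM ℝ (Euc (m + 1)) ℝ)).continuous.comp_continuousOn h1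
  have hdiv := integral_divergence_of_hasFDerivAt_off_countable' a b hle f f' ∅ countable_empty
    (fun i => (((hgd i).continuousOn.comp L.continuous.continuousOn hmaps).const_smul
      ((-1 : ℝ) ^ (i : ℕ))))
    (by
      rintro x ⟨hx, -⟩ i
      -- In the open box the point is interior to the half space, where derivatives within the half
      -- space are genuine derivatives.
      have hx0 : 0 < (L x) 0 := by
        exact (hx 0 trivial).1
      have hmem : S ∈ 𝓝 (L x) := by
        have : IsOpen {x : Euc (m + 1) | 0 < x 0} := isOpen_lt continuous_const (by fun_prop)
        exact mem_of_superset (this.mem_nhds hx0) fun y (hy : 0 < y 0) => hy.le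
      have h1 : HasFDerivAt (g i) (fderivWithin ℝ (g i) S (L x)) (L x) :=
        (((hgd i).differentiableOn one_ne_zero) _ hx0.le).hasFDerivWithinAt.hasFDerivAt hmem
      exact (h1.comp x L.hasFDerivAt).const_smul ((-1 : ℝ) ^ (i : ℕ)))
    (by
      refine ContinuousOn.integrableOn_compact isCompact_Icc ?_
      exact (hcd.comp L.continuous.continuousOn hmaps).congr fun x hx => hDF x (hmaps hx))
  have hlhs : ∫ y in S, extDerivWithin τ S y e = ∫ x in Icc a b, ∑ i, f' i x (Pi.single i 1) := by
    have h1 := (PiLp.volume_preserving_toLp (Fin (m + 1))).setIntegral_preimage_emb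
      (MeasurableEquiv.toLp 2 (Fin (m + 1) → ℝ)).measurableEmbedding
      (fun y => extDerivWithin τ S y e) S
    rw [← h1]
    have hsub : Icc a b ⊆ L ⁻¹' S := hmaps
    have hmeas : MeasurableSet (L ⁻¹' S) :=
      (isClosed_halfSpace.preimage L.continuous).measurableSet
    change ∫ x in L ⁻¹' S, extDerivWithin τ S (L x) e = _
    rw [setIntegral_eq_of_subset_of_forall_sdiff_eq_zero hmeas hsub]
    · exact setIntegral_congr_fun measurableSet_Icc fun x hx => (hDF x (hmaps hx)).symm
    · rintro x ⟨hx, hx'⟩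
      have hxK : L x ∉ K := by
        intro hxK
        refine hx' ⟨fun i => ?_, fun i => (le_abs_self _).trans (hR _ hxK i).le⟩
        refine Fin.cases ?_ (fun j => ?_) i
        · exact hx
        · exact (abs_lt.1 (hR _ hxK j.succ)).1.le
      rw [extDerivWithin_eq_zero_of_compact_support (S := S) hK.isClosed h0 hx hxK]
      rfl
  rw [hlhs, hdiv, Fin.sum_univ_succ]
  have hz : ∀ (i : Fin (m + 1)) (x : Fin (m + 1) → ℝ), 0 ≤ x 0 → (∃ j, R ≤ |x j|) →
      f i x = 0 := by
    rintro i x hx ⟨j, hj⟩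
    have : τ (L x) = 0 := h0 _ hx fun h => absurd (hR _ h j) (not_lt.2 hj)
    simp [f, g, this]
  -- On these faces a coordinate other than the zeroth has absolute value `R`, which excludes `K`.
  -- The zeroth coordinate of the point is still nonnegative, as required by `h0`, because it
  -- survives as the first coordinate of the face.
  have hside : ∀ i : Fin m, ∀ t : ℝ, |t| = R → ∀ x ∈ Icc (a ∘ i.succ.succAbove)
      (b ∘ i.succ.succAbove), f i.succ (i.succ.insertNth t x) = 0 := by
    intro i t ht x hx
    refine hz _ _ ?_ ⟨i.succ, by simp [ht]⟩
    have hm : 0 < m := i.pos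
    obtain ⟨m', rfl⟩ : ∃ m', m = m' + 1 := ⟨m - 1, by omega⟩
    have h1 : (0 : Fin (m' + 2)) = i.succ.succAbove 0 := by simp
    have h2 := hx.1 0
    rw [Function.comp_apply, ← h1] at h2
    rw [h1, Fin.insertNth_apply_succAbove]
    simpa [a] using h2
  have hsum : ∑ i : Fin m, ((∫ x in Icc (a ∘ i.succ.succAbove) (b ∘ i.succ.succAbove),
        f i.succ (i.succ.insertNth (b i.succ) x)) -
      ∫ x in Icc (a ∘ i.succ.succAbove) (b ∘ i.succ.succAbove),
        f i.succ (i.succ.insertNth (a i.succ) x)) = 0 := by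
    refine Finset.sum_eq_zero fun i _ => ?_
    rw [setIntegral_eq_zero_of_forall_eq_zero (hside i _ (by simp [b, abs_of_pos hR0])),
      setIntegral_eq_zero_of_forall_eq_zero (hside i _ (by simp [a, abs_of_pos hR0])), sub_zero]
  rw [hsum, add_zero]
  have htop : ∫ x in Icc (a ∘ (0 : Fin (m + 1)).succAbove) (b ∘ (0 : Fin (m + 1)).succAbove),
      f 0 ((0 : Fin (m + 1)).insertNth (b 0) x) = 0 := by
    refine setIntegral_eq_zero_of_forall_eq_zero fun x _ => ?_
    exact hz _ _ (by simp [b, hR0.le]) ⟨0, by simp [b, le_abs_self]⟩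
  -- The remaining face x₀ = 0 is a lower face, whence the minus sign; its integral extends to the
  -- whole boundary, as τ vanishes there outside the box.
  rw [htop, zero_sub, setIntegral_eq_integral_of_forall_compl_eq_zero]
  · have h1 := (PiLp.volume_preserving_toLp (Fin m)).integral_comp
      (MeasurableEquiv.toLp 2 (Fin m → ℝ)).measurableEmbedding
      (fun z : Euc m => τ (halfSpaceBoundary z) (Fin.tail e))
    rw [← h1]
    congr 1
    refine integral_congr_ae (Eventually.of_forall fun x => ?_)
    have h2 : L ((0 : Fin (m + 1)).insertNth (a 0) x) = halfSpaceBoundary (WithLp.toLp 2 x) := by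
      rw [hL, halfSpaceBoundary, Fin.insertNth_zero]
      rfl
    simp only [f, g, h2]
    simp only [Fin.val_zero, pow_zero, one_mul]
    congr 1
  · intro x hx
    refine hz _ _ (by simp [a]) ?_
    by_contra! hcon
    refine hx ⟨fun i => ?_, fun i => ?_⟩
    · have := (abs_lt.1 (hcon i.succ)).1
      simpa [a] using this.le
    · have := (abs_lt.1 (hcon i.succ)).2
      simpa [b] using this.le

end HalfSpace

/-! ### Stokes' theorem on the image of a chart, with an orientation sign. -/

section ChartStokes

variable {m : ℕ}

theorem continuous_halfSpaceBoundary : Continuous (halfSpaceBoundary : Euc m → Euc (m + 1)) := by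
  unfold halfSpaceBoundary
  refine (PiLp.continuous_toLp 2 _).comp (continuous_pi fun i => ?_)
  refine Fin.cases ?_ (fun j => ?_) i
  · simpa using continuous_const
  · simp only [Fin.cons_succ]
    fun_prop

/-- Stokes' theorem for a form with compact support on a relatively open subset of the half
space, weighted by a locally constant sign. -/
theorem integral_sign_mul_extDerivWithin
    {τ : Euc (m + 1) → Euc (m + 1) [⋀^Fin m]→L[ℝ] ℝ} {O : Set (Euc (m + 1))} (hO : IsOpen O)
    (hτ : ContDiffOn ℝ 1 τ (O ∩ {x | 0 ≤ x 0})) {K : Set (Euc (m + 1))} (hK : IsCompact K)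
    (hKO : K ⊆ O) (h0 : ∀ x ∈ O ∩ {x | 0 ≤ x 0}, x ∉ K → τ x = 0)
    {s : Euc (m + 1) → SignType} (hs : ContinuousOn s (O ∩ {x | 0 ≤ x 0})) :
    ∫ y in O ∩ {x | 0 ≤ x 0}, (s y : ℝ) * extDerivWithin τ {x | 0 ≤ x 0} y
        (fun i => EuclideanSpace.single i (1 : ℝ)) =
      -∫ z in {z : Euc m | halfSpaceBoundary z ∈ O ∩ {x | 0 ≤ x 0}},
        (s (halfSpaceBoundary z) : ℝ) * τ (halfSpaceBoundary z)
          (Fin.tail fun i => EuclideanSpace.single i (1 : ℝ)) := by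
  classical
  set S : Set (Euc (m + 1)) := {x | 0 ≤ x 0} with hS
  set e : Fin (m + 1) → Euc (m + 1) := fun i => EuclideanSpace.single i (1 : ℝ) with he
  -- The signed form is extended by zero to the whole half space. It stays C¹: on `O` the sign is
  -- locally constant, and off the compact set `K ⊆ O` everything vanishes.
  let η : Euc (m + 1) → Euc (m + 1) [⋀^Fin m]→L[ℝ] ℝ :=
    (O ∩ S).indicator fun y => (s y : ℝ) • τ y
  have hη0 : ∀ x, x ∈ S → x ∉ K → η x = 0 := by
    intro x hx hxK
    by_cases hxO : x ∈ O ∩ S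
    · simp only [η, indicator_of_mem hxO, h0 x hxO hxK, smul_zero]
    · simp only [η, indicator_of_notMem hxO]
  have hmem : ∀ x ∈ O ∩ S, O ∩ S ∈ 𝓝[S] x := fun x hx =>
    inter_mem (nhdsWithin_le_nhds (hO.mem_nhds hx.1)) self_mem_nhdsWithin
  have hloc : ∀ x ∈ O ∩ S, η =ᶠ[𝓝[S] x] fun y => (s x : ℝ) • τ y := by
    intro x hx
    have h1 : ∀ᶠ y in 𝓝[O ∩ S] x, s y = s x :=
      (hs x hx).eventually_mem ((isOpen_discrete {s x}).mem_nhds rfl)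
    have h2 : ∀ᶠ y in 𝓝[S] x, s y = s x := by
      rw [show 𝓝[O ∩ S] x = 𝓝[S] x from ?_] at h1
      · exact h1
      · exact le_antisymm (nhdsWithin_mono _ inter_subset_right) (nhdsWithin_le_iff.2 (hmem x hx))
    filter_upwards [h2, hmem x hx] with y hy hy'
    simp only [η, indicator_of_mem hy', hy]
  have hτS : ∀ x ∈ O ∩ S, ContDiffWithinAt ℝ 1 τ S x := fun x hx =>
    (hτ x hx).mono_of_mem_nhdsWithin (hmem x hx)
  have hηd : ContDiffOn ℝ 1 η S := by
    intro x hx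
    by_cases hxO : x ∈ O ∩ S
    · exact ((hτS x hxO).const_smul (s x : ℝ)).congr_of_eventuallyEq_of_mem (hloc x hxO) hx
    · have hxK : x ∉ K := fun h => hxO ⟨hKO h, hx⟩
      have h1 : η =ᶠ[𝓝[S] x] fun _ => 0 := by
        filter_upwards [self_mem_nhdsWithin,
          nhdsWithin_le_nhds (hK.isClosed.isOpen_compl.mem_nhds hxK)] with y hy hy' using
          hη0 y hy hy'
      exact contDiffWithinAt_const.congr_of_eventuallyEq_of_mem h1 hx
  have key := integral_extDerivWithin_halfSpace hηd hK hη0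
  have hlhs : ∫ y in S, extDerivWithin η S y e =
      ∫ y in O ∩ S, (s y : ℝ) * extDerivWithin τ S y e := by
    rw [setIntegral_eq_of_subset_of_forall_sdiff_eq_zero isClosed_halfSpace.measurableSet
      (inter_subset_right : O ∩ S ⊆ S)]
    · refine setIntegral_congr_fun (hO.measurableSet.inter isClosed_halfSpace.measurableSet)
        fun y hy => ?_
      have h1 := (hloc y hy).extDerivWithin_eq_of_mem hy.2
      have h2 := extDerivWithin_fun_smul (s y : ℝ) τ (uniqueDiffOn_halfSpace (m := m) y hy.2)
      simp only [h1]
      rw [h2]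
      rfl
    · rintro y ⟨hy, hy'⟩
      have hyK : y ∉ K := fun h => hy' ⟨hKO h, hy⟩
      rw [extDerivWithin_eq_zero_of_compact_support (S := S) hK.isClosed hη0 hy hyK]
      rfl
  rw [← hlhs, key]
  congr 1
  rw [← setIntegral_eq_integral_of_forall_compl_eq_zero
    (s := {z : Euc m | halfSpaceBoundary z ∈ O ∩ S})]
  · refine setIntegral_congr_fun ?_ fun z hz => ?_
    · exact ((hO.measurableSet.inter isClosed_halfSpace.measurableSet).preimage
        continuous_halfSpaceBoundary.measurable)
    · have hz' : halfSpaceBoundary z ∈ O ∩ S := hz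
      simp only [η, indicator_of_mem hz']
      rfl
  · intro z hz
    have hz' : halfSpaceBoundary z ∉ O ∩ S := hz
    simp only [η, indicator_of_notMem hz']
    rfl

end ChartStokes

/-! ### Integrals over chart domains and their independence of the chart. -/

section ChartIntegral

/-- Effect of a linear map on a form of top degree. -/
theorem AlternatingMap.apply_comp_basis {V ι : Type*} [AddCommGroup V] [Module ℝ V] [Fintype ι]
    [DecidableEq ι] (b : Module.Basis ι ℝ V) (f : V [⋀^ι]→ₗ[ℝ] ℝ) (L : V →ₗ[ℝ] V) :
    f (fun i => L (b i)) = LinearMap.det L * f b := by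
  have h := AlternatingMap.eq_smul_basis_det b f
  have h1 : b.det (fun i => L (b i)) = LinearMap.det L := by
    have := b.det_comp L b
    rwa [b.det_self, mul_one] at this
  rw [h]
  simp only [AlternatingMap.smul_apply, h1, b.det_self, smul_eq_mul, mul_one]
  ring

variable {d : ℕ} {H : Type*} [TopologicalSpace H] {I : ModelWithCorners ℝ (Euc d) H}
  {N : Type*} [TopologicalSpace N] [ChartedSpace H N]

/-- Coordinate frames of two charts at the same point, evaluated by a form of top degree. -/
theorem apply_coordFrame_eq_det_mul [IsManifold I ∞ N]
    (Θ : ∀ q : N, TangentSpace I q [⋀^Fin d]→ₗ[ℝ] ℝ) {c c' : N} {y : Euc d}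
    (hy : y ∈ (extChartAt I c).target)
    (hc : (extChartAt I c).symm y ∈ (extChartAt I c').source) :
    Θ ((extChartAt I c).symm y) (coordFrame I c y) =
      (fderivWithin ℝ (fun z => extChartAt I c' ((extChartAt I c).symm z)) (range I) y).det *
        Θ ((extChartAt I c').symm (extChartAt I c' ((extChartAt I c).symm y)))
          (coordFrame I c' (extChartAt I c' ((extChartAt I c).symm y))) := by
  have : IsManifold I 1 N := IsManifold.of_le (n := ∞) (by exact_mod_cast le_top)
  set ψ := fun z => extChartAt I c' ((extChartAt I c).symm z) with hψ
  have h2 : fderivWithin ℝ ψ (range I) y = _ :=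
    fderivWithin_writtenInCharts (I := I) (I' := I) (f := id) hy mdifferentiableAt_id hc
  rw [mfderiv_id] at h2
  have hinv := mfderivWithin_extChartAt_symm_comp_mfderiv_extChartAt' hc
  have hq : (extChartAt I c').symm (ψ y) = (extChartAt I c).symm y :=
    (extChartAt I c').left_inv hc
  let L : Euc d →L[ℝ] Euc d := mfderivWithin 𝓘(ℝ, Euc d) I (extChartAt I c').symm (range I) (ψ y)
  have hΘ : (Θ ((extChartAt I c').symm (ψ y)) : Euc d [⋀^Fin d]→ₗ[ℝ] ℝ) =
      Θ ((extChartAt I c).symm y) :=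
    congrArg (β := Euc d [⋀^Fin d]→ₗ[ℝ] ℝ) (fun x => Θ x) hq
  -- `g` is `Θ` read in the chart around `c'`. The frame of `c` is the image, under the derivative
  -- of the change of charts, of the standard basis there, so a top-degree form only picks up the
  -- determinant.
  let g : Euc d [⋀^Fin d]→ₗ[ℝ] ℝ :=
    (Θ ((extChartAt I c').symm (ψ y)) : Euc d [⋀^Fin d]→ₗ[ℝ] ℝ).compLinearMap L.toLinearMap
  have h3 := AlternatingMap.apply_comp_basis (EuclideanSpace.basisFun (Fin d) ℝ).toBasis g
    (fderivWithin ℝ ψ (range I) y).toLinearMap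
  have h4 : g (EuclideanSpace.basisFun (Fin d) ℝ).toBasis =
      Θ ((extChartAt I c').symm (ψ y)) (coordFrame I c' (ψ y)) := by
    change Θ ((extChartAt I c').symm (ψ y)) _ = _
    congr 1
    funext i
    simp only [OrthonormalBasis.coe_toBasis, EuclideanSpace.basisFun_apply]
    rfl
  have h5 : g (fun i => (fderivWithin ℝ ψ (range I) y).toLinearMap
      ((EuclideanSpace.basisFun (Fin d) ℝ).toBasis i)) =
      Θ ((extChartAt I c).symm y) (coordFrame I c y) := by
    rw [← hΘ]
    change (Θ ((extChartAt I c').symm (ψ y)) : Euc d [⋀^Fin d]→ₗ[ℝ] ℝ) _ = _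
    congr 1
    funext i
    simp only [OrthonormalBasis.coe_toBasis, EuclideanSpace.basisFun_apply]
    have h6 : fderivWithin ℝ ψ (range I) y (EuclideanSpace.single i 1) =
      (mfderiv I 𝓘(ℝ, Euc d) (extChartAt I c') ((extChartAt I c).symm y) : Euc d →L[ℝ] Euc d)
        (coordFrame I c y i) := congrArg (fun L : Euc d →L[ℝ] Euc d =>
          L (EuclideanSpace.single i 1)) h2
    change L (fderivWithin ℝ ψ (range I) y (EuclideanSpace.single i 1)) = _
    rw [h6]
    exact congrArg (fun L : Euc d →L[ℝ] Euc d => L (coordFrame I c y i)) hinv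
  rw [← h5, h3, h4]

namespace ManifoldOrientation

/-- The sign of the coordinate frame of the preferred chart around `c`. -/
def chartSign (o : ManifoldOrientation I N) (c : N) (y : Euc d) : SignType :=
  frameSign (o.orient ((extChartAt I c).symm y)) (coordFrame I c y)

/-- The integral over the domain of the preferred chart around `c`. -/
def chartIntegral (o : ManifoldOrientation I N) (c : N) (τ : DiffForm I N d) : ℝ :=
  ∫ y in (extChartAt I c).target, (o.chartSign c y : ℝ) *
    τ.inChart c y (fun i => EuclideanSpace.single i (1 : ℝ))

theorem measurableSet_extChartAt_target (c : N) : MeasurableSet (extChartAt I c).target := by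
  rw [extChartAt_target]
  exact (((chartAt H c).open_target.preimage I.continuous_symm).measurableSet).inter
    I.isClosed_range.measurableSet

theorem measurableSet_extChartAt_overlap (c c' : N) :
    MeasurableSet ((extChartAt I c).target ∩
      (extChartAt I c).symm ⁻¹' (extChartAt I c').source) := by
  have h : (extChartAt I c).target ∩ (extChartAt I c).symm ⁻¹' (extChartAt I c').source =
      I.symm ⁻¹' ((chartAt H c).symm ≫ₕ (chartAt H c')).source ∩ range I := by
    rw [extChartAt_target, extChartAt_source]
    ext y
    simp only [extChartAt_coe_symm, mem_inter_iff, mem_preimage, Function.comp_apply,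
      OpenPartialHomeomorph.trans_source, OpenPartialHomeomorph.symm_source]
    tauto
  rw [h]
  exact ((((chartAt H c).symm ≫ₕ (chartAt H c')).open_source.preimage
    I.continuous_symm).measurableSet).inter I.isClosed_range.measurableSet

/-- The integral of a form which vanishes outside the domains of two charts may be computed in
either of them. -/
theorem chartIntegral_eq_of_support [IsManifold I ∞ N] (o : ManifoldOrientation I N)
    {c c' : N} {τ : DiffForm I N d} (h : ∀ q, q ∉ (extChartAt I c).source → τ q = 0)
    (h' : ∀ q, q ∉ (extChartAt I c').source → τ q = 0) :
    o.chartIntegral c τ = o.chartIntegral c' τ := by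
  have hin : ∀ b (y : Euc d), τ ((extChartAt I b).symm y) = 0 → τ.inChart b y = 0 := by
    intro b y hb
    rw [DiffForm.inChart, hb]
    rfl
  have red : ∀ b b' : N, (∀ q, q ∉ (extChartAt I b').source → τ q = 0) →
      o.chartIntegral b τ = ∫ y in (extChartAt I b).target ∩
        (extChartAt I b).symm ⁻¹' (extChartAt I b').source, (o.chartSign b y : ℝ) *
        τ.inChart b y (fun i => EuclideanSpace.single i (1 : ℝ)) := by
    intro b b' hb
    refine setIntegral_eq_of_subset_of_forall_sdiff_eq_zero (measurableSet_extChartAt_target b)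
      inter_subset_left fun y hy => ?_
    rw [hin b y (hb _ fun hq => hy.2 ⟨hy.1, hq⟩)]
    simp
  rw [red c c' h', red c' c h]
  set A := (extChartAt I c).target ∩ (extChartAt I c).symm ⁻¹' (extChartAt I c').source
  set ψ : Euc d → Euc d := fun z => extChartAt I c' ((extChartAt I c).symm z) with hψ
  have himg : (extChartAt I c').target ∩ (extChartAt I c').symm ⁻¹' (extChartAt I c).source =
      ψ '' A := by
    ext z
    constructor
    · rintro ⟨hz, hz'⟩
      refine ⟨extChartAt I c ((extChartAt I c').symm z), ⟨(extChartAt I c).map_source hz', ?_⟩, ?_⟩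
      · rw [mem_preimage, (extChartAt I c).left_inv hz']
        exact (extChartAt I c').map_target hz
      · simp only [hψ]
        rw [(extChartAt I c).left_inv hz', (extChartAt I c').right_inv hz]
    · rintro ⟨y, ⟨hy, hy'⟩, rfl⟩
      refine ⟨(extChartAt I c').map_source hy', ?_⟩
      rw [mem_preimage, (extChartAt I c').left_inv hy']
      exact (extChartAt I c).map_target hy
  have hinj : InjOn ψ A := by
    rintro y ⟨hy, hy'⟩ z ⟨hz, hz'⟩ hyz
    exact (extChartAt I c).symm.injOn hy hz ((extChartAt I c').injOn hy' hz' hyz)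
  have hder : ∀ y ∈ A, HasFDerivWithinAt ψ (fderivWithin ℝ ψ (range I) y) A y := by
    rintro y ⟨hy, hy'⟩
    have := (contDiffWithinAt_writtenInCharts (I := I) (I' := I) (f := id) contMDiff_id hy
      hy').differentiableWithinAt (by simp)
    exact this.hasFDerivWithinAt.mono fun z hz => extChartAt_target_subset_range c hz.1
  rw [himg, integral_image_eq_integral_abs_det_fderiv_smul volume
    (measurableSet_extChartAt_overlap c c') hder hinj]
  refine setIntegral_congr_fun (measurableSet_extChartAt_overlap c c') ?_
  rintro y ⟨hy, hy'⟩
  have h1 := apply_coordFrame_eq_det_mul (fun q => (τ q).toAlternatingMap) hy hy'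
  -- The form representing the orientation transforms with the same determinant. Hence the sign of
  -- the frame contributes sign(det), and sign(det) · det = |det| is the factor in the change of
  -- variables.
  have h2 := apply_coordFrame_eq_det_mul (fun q => (o.orient q).someVector) hy hy'
  have h3 : o.chartSign c y =
      SignType.sign (fderivWithin ℝ ψ (range I) y).det * o.chartSign c' (ψ y) := by
    simp only [chartSign, frameSign]
    rw [h2, sign_mul]
  have h4 : τ.inChart c y (fun i => EuclideanSpace.single i (1 : ℝ)) =
      (fderivWithin ℝ ψ (range I) y).det *
        τ.inChart c' (ψ y) (fun i => EuclideanSpace.single i (1 : ℝ)) := h1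
  simp only [h3, h4, SignType.coe_mul, smul_eq_mul, ← sign_mul_self]
  ring

/-- Forms with continuous coordinate expression and compact support are integrable. -/
theorem integrableOn_chartSign_mul [T2Space N] (o : ManifoldOrientation I N) {c : N}
    {τ : DiffForm I N d} (hτ : ContinuousOn (τ.inChart c) (extChartAt I c).target) {Q : Set N}
    (hQ : IsCompact Q) (hQc : Q ⊆ (extChartAt I c).source) (h0 : ∀ q, q ∉ Q → τ q = 0) :
    IntegrableOn (fun y => (o.chartSign c y : ℝ) *
      τ.inChart c y (fun i => EuclideanSpace.single i (1 : ℝ))) (extChartAt I c).target := by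
  have hK : IsCompact (extChartAt I c '' Q) :=
    hQ.image_of_continuousOn ((continuousOn_extChartAt c).mono hQc)
  have hKt : extChartAt I c '' Q ⊆ (extChartAt I c).target := by
    rintro _ ⟨q, hq, rfl⟩
    exact (extChartAt I c).map_source (hQc hq)
  -- Only continuity on the compact image of `Q` is needed; the orientation sign is continuous on
  -- the chart target because it is locally constant there.
  refine IntegrableOn.of_forall_sdiff_eq_zero (s := extChartAt I c '' Q) ?_
    (measurableSet_extChartAt_target c) ?_
  · refine ContinuousOn.integrableOn_compact hK (ContinuousOn.mono ?_ hKt)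
    refine ContinuousOn.mul ?_ ?_
    · exact (continuous_of_discreteTopology (f := fun s : SignType => (s : ℝ))).comp_continuousOn
        (o.continuousOn_sign c)
    · exact (ContinuousAlternatingMap.apply ℝ (Euc d) ℝ
        (fun i => EuclideanSpace.single i (1 : ℝ))).continuous.comp_continuousOn hτ
  · rintro y ⟨hy, hy'⟩
    have : τ ((extChartAt I c).symm y) = 0 := h0 _ fun hq =>
      hy' ⟨_, hq, (extChartAt I c).right_inv hy⟩
    rw [DiffForm.inChart, this]
    exact mul_zero _

end ManifoldOrientation

end ChartIntegral

/-! ### Vanishing, regularity and multiples by functions, in charts. -/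

section FunctionMultiples

variable {E H : Type*} [NormedAddCommGroup E] [NormedSpace ℝ E] [TopologicalSpace H]
  {I : ModelWithCorners ℝ E H} {X : Type*} [TopologicalSpace X] [ChartedSpace H X] {p : ℕ}

namespace DiffForm

/-- The product of a function and a form. -/
def funSmul (f : X → ℝ) (τ : DiffForm I X p) : DiffForm I X p := fun q => f q • τ q

theorem inChart_funSmul (f : X → ℝ) (τ : DiffForm I X p) (c : X) (y : E) :
    (funSmul f τ).inChart c y = f ((extChartAt I c).symm y) • τ.inChart c y := rfl

theorem inChart_eq_zero {τ : DiffForm I X p} {c : X} {y : E}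
    (h : τ ((extChartAt I c).symm y) = 0) : τ.inChart c y = 0 := by
  rw [inChart, h]
  rfl

/-- A form is zero at a point if its coordinate expression is. -/
theorem eq_zero_of_inChart_eq_zero [IsManifold I ∞ X] {τ : DiffForm I X p} {q : X}
    (h : τ.inChart q (extChartAt I q q) = 0) : τ q = 0 := by
  have : IsManifold I 1 X := IsManifold.of_le (n := ∞) (by exact_mod_cast le_top)
  have hinv := mfderivWithin_extChartAt_symm_comp_mfderiv_extChartAt' (I := I)
    (mem_extChartAt_source (I := I) q)
  have hτ : (τ ((extChartAt I q).symm (extChartAt I q q)) : E [⋀^Fin p]→L[ℝ] ℝ) = τ q :=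
    congrArg (β := E [⋀^Fin p]→L[ℝ] ℝ) (fun x => τ x) (extChartAt_to_inv q)
  refine ContinuousAlternatingMap.ext fun v => ?_
  have h1 := congrArg (fun f : E [⋀^Fin p]→L[ℝ] ℝ => f fun i =>
    (mfderiv I 𝓘(ℝ, E) (extChartAt I q) q : E →L[ℝ] E) (v i)) h
  change (τ ((extChartAt I q).symm (extChartAt I q q)) : E [⋀^Fin p]→L[ℝ] ℝ) (fun i =>
    (mfderivWithin 𝓘(ℝ, E) I (extChartAt I q).symm (range I) (extChartAt I q q) : E →L[ℝ] E)
      ((mfderiv I 𝓘(ℝ, E) (extChartAt I q) q : E →L[ℝ] E) (v i))) = 0 at h1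
  rw [hτ] at h1
  change (τ q : E [⋀^Fin p]→L[ℝ] ℝ) v = 0
  rw [← h1]
  congr 1
  funext i
  exact (congrArg (fun L : E →L[ℝ] E => L (v i)) hinv).symm

/-- If `τ` is, near `y`, zero in the chart around `c`, so is its exterior derivative. -/
theorem extDerivWithin_inChart_eq_zero {τ : DiffForm I X p} {Q : Set X} (hQ : IsClosed Q)
    (h0 : ∀ q, q ∉ Q → τ q = 0) {c : X} {y : E} (hy : y ∈ (extChartAt I c).target)
    (hyQ : (extChartAt I c).symm y ∉ Q) :
    extDerivWithin (τ.inChart c) (range I) y = 0 := by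
  have h1 := extChartAt_target_mem_nhdsWithin_of_mem hy
  have h2 : ContinuousWithinAt (extChartAt I c).symm (range I) y :=
    ((continuousOn_extChartAt_symm c).continuousWithinAt hy).mono_of_mem_nhdsWithin h1
  have h : τ.inChart c =ᶠ[𝓝[range I] y] fun _ => 0 := by
    filter_upwards [h2.eventually_mem (hQ.isOpen_compl.mem_nhds hyQ)] with z hz
    exact inChart_eq_zero (h0 _ hz)
  rw [h.extDerivWithin_eq_of_mem (extChartAt_target_subset_range c hy), extDerivWithin,
    fderivWithin_fun_const]
  exact map_zero (ContinuousAlternatingMap.alternatizeUncurryFinCLM ℝ E ℝ)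

theorem differentiableWithinAt_inChart {τ : DiffForm I X p} {c : X} {y : E}
    (hτ : ContDiffOn ℝ 1 (τ.inChart c) (extChartAt I c).target)
    (hy : y ∈ (extChartAt I c).target) :
    DifferentiableWithinAt ℝ (τ.inChart c) (range I) y :=
  (((hτ y hy).mono_of_mem_nhdsWithin (extChartAt_target_mem_nhdsWithin_of_mem hy))).differentiableWithinAt one_ne_zero

/-- C¹ is the regularity available for fibre averages; it suffices for a continuous exterior
derivative, hence for integrability on compact sets. Derivatives within the chart target and within
the range of the model agree, the former set being a neighbourhood in the latter. -/
theorem continuousOn_extDerivWithin_inChart {τ : DiffForm I X p} {c : X}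
    (hτ : ContDiffOn ℝ 1 (τ.inChart c) (extChartAt I c).target) :
    ContinuousOn (extDerivWithin (τ.inChart c) (range I)) (extChartAt I c).target := by
  have h1 := hτ.continuousOn_fderivWithin (uniqueDiffOn_extChartAt_target c) le_rfl
  refine ((ContinuousAlternatingMap.alternatizeUncurryFinCLM ℝ E ℝ).continuous.comp_continuousOn
    h1).congr fun y hy => ?_
  have h2 : fderivWithin ℝ (τ.inChart c) (range I) y =
      fderivWithin ℝ (τ.inChart c) (extChartAt I c).target y :=
    (((hτ.differentiableOn one_ne_zero) y hy).hasFDerivWithinAt.mono_of_mem_nhdsWithin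
      (extChartAt_target_mem_nhdsWithin_of_mem hy)).fderivWithin
      (I.uniqueDiffOn y (extChartAt_target_subset_range c hy))
  rw [extDerivWithin, h2]
  rfl

theorem contDiffOn_inChart_funSmul [IsManifold I ∞ X] {f : X → ℝ} (hf : ContMDiff I 𝓘(ℝ, ℝ) ∞ f)
    {τ : DiffForm I X p} {c : X} (hτ : ContDiffOn ℝ 1 (τ.inChart c) (extChartAt I c).target) :
    ContDiffOn ℝ 1 ((funSmul f τ).inChart c) (extChartAt I c).target := by
  have h1 : ContDiffOn ℝ ∞ (fun y => f ((extChartAt I c).symm y)) (extChartAt I c).target :=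
    (hf.comp_contMDiffOn (contMDiffOn_extChartAt_symm c)).contDiffOn
  exact (h1.of_le (WithTop.coe_le_coe.2 le_top)).smul hτ

end DiffForm

end FunctionMultiples

/-! ### Stokes' theorem on a manifold with boundary. -/

section Stokes

variable {m : ℕ} {N : Type*} [TopologicalSpace N]
  [ChartedSpace (EuclideanHalfSpace (m + 1)) N] [IsManifold (𝓡∂ (m + 1)) ∞ N]

theorem tsupport_chartPartition_subset [T2Space N] [SigmaCompactSpace N] (c : N) :
    tsupport (chartPartition (𝓡∂ (m + 1)) N c) ⊆ (extChartAt (𝓡∂ (m + 1)) c).source := by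
  rw [extChartAt_source]
  exact (SmoothPartitionOfUnity.exists_isSubordinate_chartAt_source (𝓡∂ (m + 1)) N).choose_spec c

namespace ManifoldOrientation

/-- Replacing ∂₀ by the outward vector -∂₀ reverses the sign. This compensates the minus sign in
Stokes' theorem on the half space. -/
theorem frameSign_cons_neg {d : ℕ} {V : Type*} [AddCommGroup V] [Module ℝ V]
    (o : Orientation ℝ V (Fin (d + 1))) (v : Fin (d + 1) → V) :
    frameSign o (Fin.cons (-v 0) (Fin.tail v)) = -frameSign o v := by
  have h : (Fin.cons (-v 0) (Fin.tail v) : Fin (d + 1) → V) = Function.update v 0 (-v 0) := by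
    funext i
    refine Fin.cases ?_ (fun j => ?_) i
    · simp
    · simp [Fin.tail]
  rw [frameSign, h, AlternatingMap.map_update_neg, Function.update_eq_self, Left.sign_neg]
  rfl

/-- Stokes' theorem for a form with compact support inside the domain of one chart. -/
theorem chartIntegral_extD (o : ManifoldOrientation (𝓡∂ (m + 1)) N)
    {σ : DiffForm (𝓡∂ (m + 1)) N m}
    (hσ : ∀ c, ContDiffOn ℝ 1 (σ.inChart c) (extChartAt (𝓡∂ (m + 1)) c).target)
    {c : N} {Q : Set N} (hQ : IsCompact Q) (hQc : Q ⊆ (extChartAt (𝓡∂ (m + 1)) c).source)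
    (h0 : ∀ q, q ∉ Q → σ q = 0) :
    o.chartIntegral c σ.extD =
      -∫ z in {z : Euc m | halfSpaceBoundary z ∈ (extChartAt (𝓡∂ (m + 1)) c).target},
        (o.chartSign c (halfSpaceBoundary z) : ℝ) * σ.inChart c (halfSpaceBoundary z)
          (Fin.tail fun i => EuclideanSpace.single i (1 : ℝ)) := by
  have hr : range (𝓡∂ (m + 1)) = {x : Euc (m + 1) | 0 ≤ x 0} :=
    range_modelWithCornersEuclideanHalfSpace (m + 1)
  let O : Set (Euc (m + 1)) := (𝓡∂ (m + 1)).symm ⁻¹' (chartAt (EuclideanHalfSpace (m + 1)) c).target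
  have hO : IsOpen O := (chartAt _ c).open_target.preimage (𝓡∂ (m + 1)).continuous_symm
  have ht : (extChartAt (𝓡∂ (m + 1)) c).target = O ∩ {x : Euc (m + 1) | 0 ≤ x 0} := by
    rw [extChartAt_target, ← hr]
  have hK : IsCompact (extChartAt (𝓡∂ (m + 1)) c '' Q) :=
    hQ.image_of_continuousOn ((continuousOn_extChartAt c).mono hQc)
  have hKt : extChartAt (𝓡∂ (m + 1)) c '' Q ⊆ (extChartAt (𝓡∂ (m + 1)) c).target := by
    rintro _ ⟨q, hq, rfl⟩
    exact (extChartAt (𝓡∂ (m + 1)) c).map_source (hQc hq)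
  have key := integral_sign_mul_extDerivWithin (τ := σ.inChart c) hO (ht ▸ hσ c) hK
    (fun y hy => ((ht ▸ hKt) hy).1)
    (fun y hy hyK => DiffForm.inChart_eq_zero (h0 _ fun hq => hyK
      ⟨_, hq, (extChartAt (𝓡∂ (m + 1)) c).right_inv (ht ▸ hy)⟩))
    (s := o.chartSign c) (ht ▸ o.continuousOn_sign c)
  rw [← ht] at key
  rw [← key]
  refine setIntegral_congr_fun (measurableSet_extChartAt_target c) fun y hy => ?_
  have h1 : σ.extD.inChart c y = extDerivWithin (σ.inChart c) (range (𝓡∂ (m + 1))) y :=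
    DiffForm.inChart_extD σ hy fun c' =>
      DiffForm.differentiableWithinAt_inChart (hσ c') (mem_extChartAt_target c')
  simp only [h1, hr]

/-- Stokes' theorem for forms with compact support on a manifold with boundary. -/
theorem integral_eq_boundaryIntegral [T2Space N] [SigmaCompactSpace N]
    (o : ManifoldOrientation (𝓡∂ (m + 1)) N)
    {σ : DiffForm (𝓡∂ (m + 1)) N m} {τ : DiffForm (𝓡∂ (m + 1)) N (m + 1)}
    (hσ : ∀ c, ContDiffOn ℝ 1 (σ.inChart c) (extChartAt (𝓡∂ (m + 1)) c).target)
    (hτ : ∀ c, ∀ y ∈ (extChartAt (𝓡∂ (m + 1)) c).target,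
      τ.inChart c y = extDerivWithin (σ.inChart c) (range (𝓡∂ (m + 1))) y)
    {K : Set N} (hK : IsCompact K) (h0 : ∀ q, q ∉ K → σ q = 0) :
    o.integral τ = o.boundaryIntegral σ := by
  classical
  set ρ := chartPartition (𝓡∂ (m + 1)) N with hρ
  have hτ0 : ∀ q, q ∉ K → τ q = 0 := fun q hq => by
    refine DiffForm.eq_zero_of_inChart_eq_zero ?_
    rw [hτ q _ (mem_extChartAt_target q)]
    exact DiffForm.extDerivWithin_inChart_eq_zero hK.isClosed h0 (mem_extChartAt_target q)
      (by rwa [extChartAt_to_inv])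
  -- Only finitely many functions of the partition meet `K`. They sum to 1 on `K`, which is enough
  -- because all forms involved vanish outside `K`.
  have hfin : {c | (Function.support (ρ c) ∩ K).Nonempty}.Finite :=
    ρ.locallyFinite.finite_nonempty_inter_compact hK
  set T : Finset N := hfin.toFinset with hT
  have hρ0 : ∀ c ∉ T, ∀ q ∈ K, ρ c q = 0 := by
    intro c hc q hq
    by_contra hne
    exact hc (hfin.mem_toFinset.2 ⟨q, hne, hq⟩)
  have hsum : ∀ q ∈ K, ∑ c ∈ T, ρ c q = 1 := by
    intro q hq
    rw [← ρ.sum_eq_one (mem_univ q)]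
    refine (finsum_eq_sum_of_support_subset _ fun c hc => ?_).symm
    by_contra hcT
    exact hc (hρ0 c hcT q hq)
  -- Each piece ρ_c σ has compact support inside the domain of the chart around `c`, where Stokes'
  -- theorem is available.
  let σ' : N → DiffForm (𝓡∂ (m + 1)) N m := fun c => DiffForm.funSmul (ρ c) σ
  have hσ' : ∀ c b, ContDiffOn ℝ 1 ((σ' c).inChart b) (extChartAt (𝓡∂ (m + 1)) b).target := fun c b =>
    DiffForm.contDiffOn_inChart_funSmul (ρ c).contMDiff (hσ b)
  have hσ'0 : ∀ c q, q ∉ tsupport (ρ c) ∩ K → σ' c q = 0 := by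
    intro c q hq
    by_cases hqK : q ∈ K
    · have : ρ c q = 0 := image_eq_zero_of_notMem_tsupport fun h => hq ⟨h, hqK⟩
      simp only [σ', DiffForm.funSmul, this, zero_smul]
    · simp only [σ', DiffForm.funSmul, h0 q hqK, smul_zero]
  have hcl : ∀ c, IsCompact (tsupport (ρ c) ∩ K) := fun c =>
    hK.inter_left (isClosed_tsupport _)
  have hsub : ∀ c, tsupport (ρ c) ⊆ (extChartAt (𝓡∂ (m + 1)) c).source := tsupport_chartPartition_subset
  have hin : ∀ c b, ∀ y ∈ (extChartAt (𝓡∂ (m + 1)) b).target, (σ' c).extD.inChart b y =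
      extDerivWithin ((σ' c).inChart b) (range (𝓡∂ (m + 1))) y := fun c b y hy =>
    DiffForm.inChart_extD _ hy fun c' =>
      DiffForm.differentiableWithinAt_inChart (hσ' c c') (mem_extChartAt_target c')
  have hdσ'0 : ∀ c q, q ∉ tsupport (ρ c) ∩ K → (σ' c).extD q = 0 := by
    intro c q hq
    refine DiffForm.eq_zero_of_inChart_eq_zero ?_
    rw [hin c q _ (mem_extChartAt_target q)]
    exact DiffForm.extDerivWithin_inChart_eq_zero (hcl c).isClosed (hσ'0 c)
      (mem_extChartAt_target q) (by rwa [extChartAt_to_inv])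
  have hcont : ∀ c b, ContinuousOn ((σ' c).extD.inChart b) (extChartAt (𝓡∂ (m + 1)) b).target :=
    fun c b => (DiffForm.continuousOn_extDerivWithin_inChart (hσ' c b)).congr (hin c b)
  have hcont' : ∀ c' c b, ContinuousOn ((DiffForm.funSmul (ρ c') (σ' c).extD).inChart b)
      (extChartAt (𝓡∂ (m + 1)) b).target := fun c' c b => by
    have h1 : ContinuousOn (fun y => ρ c' ((extChartAt (𝓡∂ (m + 1)) b).symm y)) (extChartAt (𝓡∂ (m + 1)) b).target :=
      (ρ c').contMDiff.continuous.comp_continuousOn (continuousOn_extChartAt_symm b)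
    exact h1.smul (hcont c b)
  have hzero : ∀ c' c q, q ∉ tsupport (ρ c) ∩ K →
      DiffForm.funSmul (ρ c') (σ' c).extD q = 0 := fun c' c q hq => by
    simp only [DiffForm.funSmul, hdσ'0 c q hq, smul_zero]
  have hzero' : ∀ c' c q, q ∉ tsupport (ρ c') ∩ K →
      DiffForm.funSmul (ρ c') (σ' c).extD q = 0 := fun c' c q hq => by
    by_cases hqK : q ∈ K
    · have : ρ c' q = 0 := image_eq_zero_of_notMem_tsupport fun h => hq ⟨h, hqK⟩
      simp only [DiffForm.funSmul, this, zero_smul]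
    · exact hzero c' c q fun h => hqK h.2
  set e : Fin (m + 1) → Euc (m + 1) := fun i => EuclideanSpace.single i (1 : ℝ) with he
  have hleft : o.integral τ = ∑ c ∈ T, o.chartIntegral c (DiffForm.funSmul (ρ c) τ) := by
    have hterm : ∀ c : N, (∫ y in (extChartAt (𝓡∂ (m + 1)) c).target,
        ρ c ((extChartAt (𝓡∂ (m + 1)) c).symm y) *
          (frameSign (o.orient ((extChartAt (𝓡∂ (m + 1)) c).symm y)) (coordFrame (𝓡∂ (m + 1)) c y) : ℝ) *
          τ ((extChartAt (𝓡∂ (m + 1)) c).symm y) (coordFrame (𝓡∂ (m + 1)) c y)) =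
        o.chartIntegral c (DiffForm.funSmul (ρ c) τ) := by
      intro c
      refine integral_congr_ae (Eventually.of_forall fun y => ?_)
      change ρ c ((extChartAt (𝓡∂ (m + 1)) c).symm y) * (o.chartSign c y : ℝ) * τ.inChart c y e =
        (o.chartSign c y : ℝ) * (ρ c ((extChartAt (𝓡∂ (m + 1)) c).symm y) * τ.inChart c y e)
      ring
    rw [ManifoldOrientation.integral, finsum_congr hterm]
    refine finsum_eq_sum_of_support_subset _ fun c hc => ?_
    by_contra hcT
    refine hc ?_
    have : DiffForm.funSmul (ρ c) τ = fun _ => 0 := by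
      funext q
      by_cases hqK : q ∈ K
      · simp only [DiffForm.funSmul, hρ0 c hcT q hqK, zero_smul]
      · simp only [DiffForm.funSmul, hτ0 q hqK, smul_zero]
    refine integral_eq_zero_of_ae (Eventually.of_forall fun y => ?_)
    have h1 : (DiffForm.funSmul (ρ c) τ).inChart c y = 0 :=
      DiffForm.inChart_eq_zero (by rw [this])
    simp [h1]
  -- Stokes' theorem in each chart: the boundary integral of ρ_c σ equals the integral of d(ρ_c σ),
  -- the two minus signs cancelling.
  have hright : o.boundaryIntegral σ = ∑ c ∈ T, o.chartIntegral c (σ' c).extD := by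
    have hterm : ∀ c : N, (∫ z in {z : Euc m | halfSpaceBoundary z ∈ (extChartAt (𝓡∂ (m + 1)) c).target},
        ρ c ((extChartAt (𝓡∂ (m + 1)) c).symm (halfSpaceBoundary z)) *
          (frameSign (o.orient ((extChartAt (𝓡∂ (m + 1)) c).symm (halfSpaceBoundary z)))
            (Fin.cons (-coordFrame (𝓡∂ (m + 1)) c (halfSpaceBoundary z) 0)
              (Fin.tail (coordFrame (𝓡∂ (m + 1)) c (halfSpaceBoundary z)))) : ℝ) *
          σ ((extChartAt (𝓡∂ (m + 1)) c).symm (halfSpaceBoundary z))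
            (Fin.tail (coordFrame (𝓡∂ (m + 1)) c (halfSpaceBoundary z)))) =
        o.chartIntegral c (σ' c).extD := by
      intro c
      rw [chartIntegral_extD o (hσ' c) (hcl c) (inter_subset_left.trans (hsub c)) (hσ'0 c),
        ← integral_neg]
      refine integral_congr_ae (Eventually.of_forall fun z => ?_)
      simp only [frameSign_cons_neg, SignType.coe_neg]
      change ρ c ((extChartAt (𝓡∂ (m + 1)) c).symm (halfSpaceBoundary z)) *
          (-(o.chartSign c (halfSpaceBoundary z) : ℝ)) *
          σ.inChart c (halfSpaceBoundary z) (Fin.tail e) =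
        -((o.chartSign c (halfSpaceBoundary z) : ℝ) *
          (ρ c ((extChartAt (𝓡∂ (m + 1)) c).symm (halfSpaceBoundary z)) *
            σ.inChart c (halfSpaceBoundary z) (Fin.tail e)))
      ring
    rw [ManifoldOrientation.boundaryIntegral, finsum_congr hterm]
    refine finsum_eq_sum_of_support_subset _ fun c hc => ?_
    by_contra hcT
    refine hc ?_
    have hz : ∀ q, σ' c q = 0 := by
      intro q
      by_cases hqK : q ∈ K
      · simp only [σ', DiffForm.funSmul, hρ0 c hcT q hqK, zero_smul]
      · simp only [σ', DiffForm.funSmul, h0 q hqK, smul_zero]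
    refine setIntegral_eq_zero_of_forall_eq_zero fun y hy => ?_
    rw [hin c c y hy, DiffForm.extDerivWithin_inChart_eq_zero isClosed_empty (fun q _ => hz q) hy
      (notMem_empty _)]
    simp
  -- The integral of d(ρ_c σ) is taken in the chart `c`, whereas in `o.integral` the weight ρ_{c'}
  -- goes with the chart `c'`. Inserting ∑ ρ_{c'} = 1 produces pieces supported in both charts,
  -- which may then be moved from `c` to `c'`.
  have hsplit : ∀ c ∈ T, o.chartIntegral c (σ' c).extD =
      ∑ c' ∈ T, o.chartIntegral c (DiffForm.funSmul (ρ c') (σ' c).extD) := by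
    intro c _
    simp only [chartIntegral]
    rw [← integral_finsetSum]
    · refine integral_congr_ae (Eventually.of_forall fun y => ?_)
      simp only [DiffForm.inChart_funSmul, ContinuousAlternatingMap.smul_apply, smul_eq_mul]
      rw [← Finset.mul_sum, ← Finset.sum_mul]
      by_cases hqK : (extChartAt (𝓡∂ (m + 1)) c).symm y ∈ K
      · rw [hsum _ hqK, one_mul]
      · rw [DiffForm.inChart_eq_zero (hdσ'0 c _ fun h => hqK h.2)]
        simp
    · intro c' _
      exact o.integrableOn_chartSign_mul (hcont' c' c c) (hcl c)
        (inter_subset_left.trans (hsub c)) (hzero c' c)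
  have hmove : ∀ c ∈ T, ∀ c' ∈ T, o.chartIntegral c (DiffForm.funSmul (ρ c') (σ' c).extD) =
      o.chartIntegral c' (DiffForm.funSmul (ρ c') (σ' c).extD) := fun c _ c' _ =>
    o.chartIntegral_eq_of_support (fun q hq => hzero c' c q fun h => hq (hsub c h.1))
      (fun q hq => hzero' c' c q fun h => hq (hsub c' h.1))
  rw [hleft, hright, Finset.sum_congr rfl hsplit,
    Finset.sum_congr rfl fun c hc => Finset.sum_congr rfl (hmove c hc), Finset.sum_comm]
  refine Finset.sum_congr rfl fun c' _ => ?_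
  simp only [chartIntegral]
  rw [← integral_finsetSum]
  · refine setIntegral_congr_fun (measurableSet_extChartAt_target c') fun y hy => ?_
    simp only [DiffForm.inChart_funSmul, ContinuousAlternatingMap.smul_apply, smul_eq_mul]
    rw [← Finset.mul_sum, ← Finset.mul_sum]
    congr 2
    -- In a fixed chart `c'` the sum over `c` restores dσ. The terms containing dρ_c need no
    -- separate treatment, because the pieces add up to σ before differentiation.
    have hs : σ.inChart c' = fun y => ∑ c ∈ T, (σ' c).inChart c' y := by
      funext z
      simp only [σ', DiffForm.inChart_funSmul]
      rw [← Finset.sum_smul]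
      by_cases hqK : (extChartAt (𝓡∂ (m + 1)) c').symm z ∈ K
      · rw [hsum _ hqK, one_smul]
      · rw [DiffForm.inChart_eq_zero (h0 _ hqK), smul_zero]
    rw [hτ c' y hy, hs, extDerivWithin, fderivWithin_fun_sum]
    · have h1 := map_sum (ContinuousAlternatingMap.alternatizeUncurryFinCLM ℝ (Euc (m + 1)) ℝ)
        (fun c => fderivWithin ℝ ((σ' c).inChart c') (range (𝓡∂ (m + 1))) y) T
      simp only [ContinuousAlternatingMap.alternatizeUncurryFinCLM_apply] at h1
      rw [h1, ContinuousAlternatingMap.sum_apply]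
      refine Finset.sum_congr rfl fun c _ => ?_
      rw [hin c c' y hy]
      rfl
    · exact (𝓡∂ (m + 1)).uniqueDiffOn y (extChartAt_target_subset_range c' hy)
    · exact fun c _ => DiffForm.differentiableWithinAt_inChart (hσ' c c') hy
  · intro c _
    exact o.integrableOn_chartSign_mul (hcont' c' c c') (hcl c')
      (inter_subset_left.trans (hsub c')) (hzero' c' c)

end ManifoldOrientation

end Stokes

/-! ### Generalized forms and horizontal lifts in natural coordinates. -/

section JetCharts

variable {n k : ℕ} {M : Type*} [TopologicalSpace M] [ChartedSpace (Euc n) M]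
  [IsManifold (𝓡 n) ∞ M]

namespace CurveJet

theorem extChartAt_target_eq (u : CurveJet n k M) :
    (extChartAt 𝓘(ℝ, JetModel n k) u).target = (extChartAt (𝓡 n) u.proj).target ×ˢ univ := by
  have h1 : (extChartAt 𝓘(ℝ, JetModel n k) u).target =
      (chartAt (Euc n) u.proj).target ×ˢ univ := by
    simp only [mfld_simps]
    rfl
  rw [h1]
  simp only [mfld_simps]

theorem extChartAt_source_eq (u : CurveJet n k M) :
    (extChartAt 𝓘(ℝ, JetModel n k) u).source = proj ⁻¹' (extChartAt (𝓡 n) u.proj).source := by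
  rw [extChartAt_source, extChartAt_source]
  rfl

theorem extChartAt_fst (u v : CurveJet n k M) :
    (extChartAt 𝓘(ℝ, JetModel n k) u v).1 = extChartAt (𝓡 n) u.proj v.proj := rfl

theorem proj_extChartAt_symm (u : CurveJet n k M) (w : JetModel n k) :
    ((extChartAt 𝓘(ℝ, JetModel n k) u).symm w).proj = (extChartAt (𝓡 n) u.proj).symm w.1 :=
  proj_ofCoords _ _ _

theorem isOpen_extChartAt_target (u : CurveJet n k M) :
    IsOpen (extChartAt 𝓘(ℝ, JetModel n k) u).target :=
  _root_.isOpen_extChartAt_target u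

/-- The derivative of the bundle projection, in natural coordinates, is `(x, y) ↦ x`. -/
theorem mfderiv_proj_comp_extChartAt_symm (u : CurveJet n k M) {w : JetModel n k}
    (hw : w ∈ (extChartAt 𝓘(ℝ, JetModel n k) u).target) (ξ : JetModel n k) :
    (mfderiv 𝓘(ℝ, JetModel n k) (𝓡 n) (proj : CurveJet n k M → M)
        ((extChartAt 𝓘(ℝ, JetModel n k) u).symm w) : JetModel n k →L[ℝ] Euc n)
      ((mfderivWithin 𝓘(ℝ, JetModel n k) 𝓘(ℝ, JetModel n k)
        (extChartAt 𝓘(ℝ, JetModel n k) u).symm (range 𝓘(ℝ, JetModel n k)) w :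
          JetModel n k →L[ℝ] JetModel n k) ξ) =
      (mfderivWithin 𝓘(ℝ, Euc n) (𝓡 n) (extChartAt (𝓡 n) u.proj).symm (range (𝓡 n)) w.1 :
        Euc n →L[ℝ] Euc n) ξ.1 := by
  have : IsManifold 𝓘(ℝ, JetModel n k) 1 (CurveJet n k M) :=
    IsManifold.of_le (n := ∞) (by exact_mod_cast le_top)
  have : IsManifold (𝓡 n) 1 M := IsManifold.of_le (n := ∞) (by exact_mod_cast le_top)
  have hw1 : w.1 ∈ (extChartAt (𝓡 n) u.proj).target := by
    rw [extChartAt_target_eq] at hw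
    exact hw.1
  have h1 := (mdifferentiableWithinAt_extChartAt_symm hw).hasMFDerivWithinAt
  have h2 := HasMFDerivAt.comp_hasMFDerivWithinAt w
    (hasMFDerivAt_proj ((extChartAt 𝓘(ℝ, JetModel n k) u).symm w)).mdifferentiableAt.hasMFDerivAt h1
  have h3 := (mdifferentiableWithinAt_extChartAt_symm hw1).hasMFDerivWithinAt
  have h4 : HasMFDerivWithinAt 𝓘(ℝ, JetModel n k) 𝓘(ℝ, Euc n) (Prod.fst : JetModel n k → Euc n)
      (range 𝓘(ℝ, JetModel n k)) w (ContinuousLinearMap.fst ℝ (Euc n) (Fin k → Euc n)) :=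
    hasFDerivWithinAt_fst.hasMFDerivWithinAt
  have h5 := HasMFDerivWithinAt.comp w h3 h4 (fun x _ => by simp)
  -- In natural charts the projection is the first coordinate; differentiating the two sides of this
  -- identity gives the claim by uniqueness of derivatives.
  have hfun : (proj ∘ (extChartAt 𝓘(ℝ, JetModel n k) u).symm : JetModel n k → M) =
      (extChartAt (𝓡 n) u.proj).symm ∘ Prod.fst := funext fun w => proj_extChartAt_symm u w
  have huniq : UniqueMDiffWithinAt 𝓘(ℝ, JetModel n k) (range 𝓘(ℝ, JetModel n k)) w := by
    rw [ModelWithCorners.range_eq_univ]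
    exact uniqueMDiffWithinAt_univ _
  rw [hfun] at h2
  have h6 := UniqueMDiffWithinAt.eq huniq h2 h5
  exact congrArg (fun L : JetModel n k →L[ℝ] Euc n => L ξ) h6

end CurveJet

namespace GenForm

variable {p : ℕ}

/-- The coordinate expression of a generalized form, in the natural chart around `u`. -/
def inNatChart (α : GenForm n k M p) (u : CurveJet n k M) (w : JetModel n k) :
    Euc n [⋀^Fin p]→L[ℝ] ℝ :=
  (α ((extChartAt 𝓘(ℝ, JetModel n k) u).symm w) : Euc n [⋀^Fin p]→L[ℝ] ℝ).compContinuousLinearMap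
    (mfderivWithin 𝓘(ℝ, Euc n) (𝓡 n) (extChartAt (𝓡 n) u.proj).symm (range (𝓡 n)) w.1 :
      Euc n →L[ℝ] Euc n)

theorem inChart_zeta (α : GenForm n k M p) (u : CurveJet n k M) {w : JetModel n k}
    (hw : w ∈ (extChartAt 𝓘(ℝ, JetModel n k) u).target) :
    α.zeta.inChart u w = (α.inNatChart u w).compContinuousLinearMap
      (ContinuousLinearMap.fst ℝ (Euc n) (Fin k → Euc n)) := by
  ext v
  change (α ((extChartAt 𝓘(ℝ, JetModel n k) u).symm w) : Euc n [⋀^Fin p]→L[ℝ] ℝ) (fun i => _) =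
    (α ((extChartAt 𝓘(ℝ, JetModel n k) u).symm w) : Euc n [⋀^Fin p]→L[ℝ] ℝ) (fun i => _)
  congr 1
  funext i
  exact CurveJet.mfderiv_proj_comp_extChartAt_symm u hw (v i)

/-- The base coefficients are recovered from `α.zeta` by inserting vectors (X, 0); smoothness of the
horizontal form therefore passes to them. -/
theorem inNatChart_eq (α : GenForm n k M p) (u : CurveJet n k M) {w : JetModel n k}
    (hw : w ∈ (extChartAt 𝓘(ℝ, JetModel n k) u).target) :
    α.inNatChart u w = (α.zeta.inChart u w).compContinuousLinearMap
      (ContinuousLinearMap.inl ℝ (Euc n) (Fin k → Euc n)) := by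
  rw [inChart_zeta α u hw]
  ext v
  simp [Function.comp_def]

theorem contDiffOn_inNatChart {α : GenForm n k M p} (hα : α.IsSmooth) (u : CurveJet n k M) :
    ContDiffOn ℝ ∞ (α.inNatChart u) (extChartAt 𝓘(ℝ, JetModel n k) u).target := by
  intro w hw
  exact (ContDiffWithinAt.alternating_compContinuousLinearMap (hα u w hw)
    contDiffWithinAt_const).congr (fun w' hw' => inNatChart_eq α u hw') (inNatChart_eq α u hw)

end GenForm

namespace JetConnection

variable {p : ℕ}

/-- A horizontal lift projects back to the vector lifted, so its coordinate expression has first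
component X. `A` is only needed pointwise, with no regularity in `w`: it is eliminated later in
favour of the smooth functions `mixedCoeff`. -/
theorem exists_hlift_eq (H : JetConnection n k M) (u : CurveJet n k M) {w : JetModel n k}
    (hw : w ∈ (extChartAt 𝓘(ℝ, JetModel n k) u).target) :
    ∃ A : Euc n →L[ℝ] (Fin k → Euc n), ∀ X : Euc n,
      (H.hlift ((extChartAt 𝓘(ℝ, JetModel n k) u).symm w) : Euc n →L[ℝ] JetModel n k)
        ((mfderivWithin 𝓘(ℝ, Euc n) (𝓡 n) (extChartAt (𝓡 n) u.proj).symm (range (𝓡 n)) w.1 :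
          Euc n →L[ℝ] Euc n) X) =
      (mfderivWithin 𝓘(ℝ, JetModel n k) 𝓘(ℝ, JetModel n k)
        (extChartAt 𝓘(ℝ, JetModel n k) u).symm (range 𝓘(ℝ, JetModel n k)) w :
          JetModel n k →L[ℝ] JetModel n k) (X, A X) := by
  have : IsManifold 𝓘(ℝ, JetModel n k) 1 (CurveJet n k M) :=
    IsManifold.of_le (n := ∞) (by exact_mod_cast le_top)
  have : IsManifold (𝓡 n) 1 M := IsManifold.of_le (n := ∞) (by exact_mod_cast le_top)
  have hw1 : w.1 ∈ (extChartAt (𝓡 n) u.proj).target := by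
    rw [CurveJet.extChartAt_target_eq] at hw
    exact hw.1
  set q := (extChartAt 𝓘(ℝ, JetModel n k) u).symm w
  let S : JetModel n k →L[ℝ] JetModel n k := mfderivWithin 𝓘(ℝ, JetModel n k) 𝓘(ℝ, JetModel n k)
        (extChartAt 𝓘(ℝ, JetModel n k) u).symm (range 𝓘(ℝ, JetModel n k)) w
  let D : JetModel n k →L[ℝ] JetModel n k := mfderiv 𝓘(ℝ, JetModel n k) 𝓘(ℝ, JetModel n k)
        (extChartAt 𝓘(ℝ, JetModel n k) u) q
  let s : Euc n →L[ℝ] Euc n :=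
    mfderivWithin 𝓘(ℝ, Euc n) (𝓡 n) (extChartAt (𝓡 n) u.proj).symm (range (𝓡 n)) w.1
  let h : Euc n →L[ℝ] JetModel n k := H.hlift q
  have hSD : ∀ ξ, S (D ξ) = ξ := fun ξ => congrArg (fun L : JetModel n k →L[ℝ] JetModel n k => L ξ)
    (mfderivWithin_extChartAt_symm_comp_mfderiv_extChartAt hw)
  have hinj : Function.Injective s := by
    have h1 := mfderiv_extChartAt_comp_mfderivWithin_extChartAt_symm hw1
    intro X X' hX
    have h2 : ∀ X : Euc n, (mfderiv (𝓡 n) 𝓘(ℝ, Euc n) (extChartAt (𝓡 n) u.proj)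
      ((extChartAt (𝓡 n) u.proj).symm w.1) : Euc n →L[ℝ] Euc n) (s X) = X := fun X =>
        congrArg (fun L : Euc n →L[ℝ] Euc n => L X) h1
    rw [← h2 X, ← h2 X', hX]
  refine ⟨(ContinuousLinearMap.snd ℝ (Euc n) (Fin k → Euc n)).comp (D.comp (h.comp s)),
    fun X => ?_⟩
  change h (s X) = S (X, (D (h (s X))).2)
  have h1 : (D (h (s X))).1 = X := by
    refine hinj ?_
    have h2 := CurveJet.mfderiv_proj_comp_extChartAt_symm u hw (D (h (s X)))
    have h3 : (mfderiv 𝓘(ℝ, JetModel n k) (𝓡 n) (CurveJet.proj : CurveJet n k M → M) q :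
      JetModel n k →L[ℝ] Euc n) (S (D (h (s X)))) = s (D (h (s X))).1 := h2
    rw [← h3, hSD]
    exact H.mfderiv_proj_hlift q (s X)
  conv_lhs => rw [← hSD (h (s X))]
  congr 1
  exact Prod.ext h1 rfl

theorem hproj_hlift (H : JetConnection n k M) (u : CurveJet n k M)
    (X : TangentSpace (𝓡 n) u.proj) : H.hproj u (H.hlift u X) = H.hlift u X := by
  have h : H.hproj u (H.hlift u X) = H.hlift u X - H.Φ u (H.hlift u X) := rfl
  rw [h, H.Φ_hlift, sub_zero]

/-- The exterior derivative of generalized forms, in natural coordinates. -/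
theorem inNatChart_d4 (H : JetConnection n k M) {α : GenForm n k M p} (hα : α.IsSmooth)
    (u : CurveJet n k M) {w : JetModel n k}
    (hw : w ∈ (extChartAt 𝓘(ℝ, JetModel n k) u).target)
    {A : Euc n →L[ℝ] (Fin k → Euc n)} (hA : ∀ X : Euc n,
      (H.hlift ((extChartAt 𝓘(ℝ, JetModel n k) u).symm w) : Euc n →L[ℝ] JetModel n k)
        ((mfderivWithin 𝓘(ℝ, Euc n) (𝓡 n) (extChartAt (𝓡 n) u.proj).symm (range (𝓡 n)) w.1 :
          Euc n →L[ℝ] Euc n) X) =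
      (mfderivWithin 𝓘(ℝ, JetModel n k) 𝓘(ℝ, JetModel n k)
        (extChartAt 𝓘(ℝ, JetModel n k) u).symm (range 𝓘(ℝ, JetModel n k)) w :
          JetModel n k →L[ℝ] JetModel n k) (X, A X)) :
    (H.d4 α).inNatChart u w = ContinuousAlternatingMap.alternatizeUncurryFin
      ((fderiv ℝ (α.inNatChart u) w).comp ((ContinuousLinearMap.id ℝ (Euc n)).prod A)) := by
  have hO := CurveJet.isOpen_extChartAt_target u
  have hd : ∀ c, DifferentiableWithinAt ℝ (α.zeta.inChart c) (range 𝓘(ℝ, JetModel n k))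
      (extChartAt 𝓘(ℝ, JetModel n k) c c) := fun c =>
    DiffForm.differentiableWithinAt_inChart ((hα c).of_le (WithTop.coe_le_coe.2 le_top))
      (mem_extChartAt_target c)
  have h1 := DiffForm.inChart_extD α.zeta hw hd
  have hda : DifferentiableAt ℝ (α.inNatChart u) w :=
    ((GenForm.contDiffOn_inNatChart hα u).contDiffAt (hO.mem_nhds hw)).differentiableAt (by simp)
  have h2 : α.zeta.inChart u =ᶠ[𝓝 w] fun w => ContinuousAlternatingMap.compContinuousLinearMapCLM
      (ContinuousLinearMap.fst ℝ (Euc n) (Fin k → Euc n)) (α.inNatChart u w) :=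
    Filter.mem_of_superset (hO.mem_nhds hw) fun w' hw' => α.inChart_zeta u hw'
  have h3 : fderiv ℝ (α.zeta.inChart u) w = (ContinuousAlternatingMap.compContinuousLinearMapCLM
      (ContinuousLinearMap.fst ℝ (Euc n) (Fin k → Euc n))).comp
        (fderiv ℝ (α.inNatChart u) w) := by
    rw [h2.fderiv_eq]
    exact (ContinuousLinearMap.hasFDerivAt _).comp w hda.hasFDerivAt |>.fderiv
  rw [ModelWithCorners.range_eq_univ, extDerivWithin_univ, extDeriv, h3] at h1
  ext v
  set q := (extChartAt 𝓘(ℝ, JetModel n k) u).symm w with hq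
  let S : JetModel n k →L[ℝ] JetModel n k := mfderivWithin 𝓘(ℝ, JetModel n k) 𝓘(ℝ, JetModel n k)
        (extChartAt 𝓘(ℝ, JetModel n k) u).symm (range 𝓘(ℝ, JetModel n k)) w
  let s : Euc n →L[ℝ] Euc n :=
    mfderivWithin 𝓘(ℝ, Euc n) (𝓡 n) (extChartAt (𝓡 n) u.proj).symm (range (𝓡 n)) w.1
  have h4 : (H.d4 α).inNatChart u w v =
      (α.zeta.extD q : JetModel n k [⋀^Fin (p + 1)]→L[ℝ] ℝ) (fun i => S (v i, A (v i))) := by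
    change (α.zeta.extD q : JetModel n k [⋀^Fin (p + 1)]→L[ℝ] ℝ)
      (fun i => (H.hproj q : JetModel n k →L[ℝ] JetModel n k)
        ((H.hlift q : Euc n →L[ℝ] JetModel n k) (s (v i)))) = _
    congr 1
    funext i
    -- Horizontal lifts are fixed by h, so the projection inside `d4` has no effect.
    exact (H.hproj_hlift q (s (v i))).trans (hA (v i))
  have h5 : (α.zeta.extD q : JetModel n k [⋀^Fin (p + 1)]→L[ℝ] ℝ)
      (fun i => S (v i, A (v i))) = α.zeta.extD.inChart u w (fun i => (v i, A (v i))) := rfl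
  rw [h4, h5, h1]
  simp only [ContinuousAlternatingMap.alternatizeUncurryFin_apply]
  refine Finset.sum_congr rfl fun i _ => ?_
  rfl

end JetConnection

end JetCharts

/-! ### Closedness evaluated on constant vector fields. -/

section ClosedForms

/-- Moving `x` from the front into the vacant place `j` passes `j` vectors. -/
theorem ContinuousAlternatingMap.apply_removeNth_succ_cons {E : Type*} [NormedAddCommGroup E]
    [NormedSpace ℝ E] : ∀ {N : ℕ} (f : E [⋀^Fin N]→L[ℝ] ℝ) (x : E) (e : Fin N → E) (j : Fin N),
    f (j.succ.removeNth (Fin.cons x e : Fin (N + 1) → E)) = (-1) ^ (j : ℕ) * f (Function.update e j x)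
  | 0, _, _, _, j => j.elim0
  | N + 1, f, x, e, j => by
    have h1 : (j.succ.removeNth (Fin.cons x e : Fin (N + 2) → E) : Fin (N + 1) → E) =
        Fin.cons x (j.removeNth e) := by
      funext i
      refine Fin.cases ?_ (fun i => ?_) i
      · simp [Fin.removeNth]
      · simp [Fin.removeNth]
    have h2 : Function.update e j x = j.insertNth x (j.removeNth e) := by
      simp
    have h3 := f.map_insertNth j x (j.removeNth e)
    have h4 : f (Matrix.vecCons x (j.removeNth e)) = f (Fin.cons x (j.removeNth e)) := rfl
    rw [h1, h2, h3, h4]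
    rcases Nat.even_or_odd (j : ℕ) with hj | hj <;> simp [hj.neg_one_pow]

/-- Closedness of a form, evaluated on constant vector fields. -/
theorem fderiv_eq_sum_of_extDeriv_eq_zero {E : Type*} [NormedAddCommGroup E] [NormedSpace ℝ E]
    {N : ℕ} {τ : E → E [⋀^Fin N]→L[ℝ] ℝ} {w : E} (hτ : DifferentiableAt ℝ τ w)
    (h : extDeriv τ w = 0) (x : E) (e : Fin N → E) :
    fderiv ℝ (fun w => τ w e) w x =
      ∑ j, fderiv ℝ (fun w => τ w (Function.update e j x)) w (e j) := by
  have h1 := extDeriv_apply hτ (Fin.cons x e)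
  rw [h, Fin.sum_univ_succ] at h1
  -- The sign (-1)^(j+1) of the exterior derivative and the sign (-1)^j of the permutation combine
  -- to -1 for every `j`.
  have h2 : ∀ j : Fin N, (-1) ^ (j.succ : ℕ) • fderiv ℝ
      (fun w => τ w (j.succ.removeNth (Fin.cons x e : Fin (N + 1) → E))) w
      ((Fin.cons x e : Fin (N + 1) → E) j.succ) =
      -fderiv ℝ (fun w => τ w (Function.update e j x)) w (e j) := by
    intro j
    simp only [ContinuousAlternatingMap.apply_removeNth_succ_cons, Fin.cons_succ, Fin.val_succ]
    have h3 : DifferentiableAt ℝ (fun w => τ w (Function.update e j x)) w :=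
      ((ContinuousAlternatingMap.apply ℝ E ℝ (Function.update e j x)).differentiableAt).comp w hτ
    rw [fderiv_const_mul h3, pow_succ]
    rcases Nat.even_or_odd (j : ℕ) with hj | hj <;> simp [hj.neg_one_pow]
  rw [Finset.sum_congr rfl fun j _ => h2 j] at h1
  have h4 : (Fin.removeNth (0 : Fin (N + 1)) (Fin.cons x e : Fin (N + 1) → E)) = e := by
    funext i
    simp [Fin.removeNth]
  simp only [h4, Fin.val_zero, pow_zero, one_smul, Fin.cons_zero, Finset.sum_neg_distrib] at h1
  have h5 : (0 : E [⋀^Fin (N + 1)]→L[ℝ] ℝ) (Fin.cons x e) = 0 := rfl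
  rw [h5] at h1
  linarith

end ClosedForms

/-! ### Coefficients of the vertical volume form. -/

section VerticalVolume

/-- The standard basis of the space of fibre coordinates, as a basis. -/
def fibreBasisBasis (n k : ℕ) : Module.Basis (Fin (k * n)) ℝ (Fin k → Euc n) :=
  (Pi.basis fun _ : Fin k => (EuclideanSpace.basisFun (Fin n) ℝ).toBasis).reindex
    ((Equiv.sigmaEquivProd (Fin k) (Fin n)).trans finProdFinEquiv)

theorem coe_fibreBasisBasis (n k : ℕ) : ⇑(fibreBasisBasis n k) = fibreBasis n k := by
  funext A
  simp [fibreBasisBasis, fibreBasis, Pi.basis_apply]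

/-- The coordinate fields in the direction of the fibre. -/
def verticalFrame (n k : ℕ) (A : Fin (k * n)) : JetModel n k := (0, fibreBasis n k A)

variable {n k : ℕ} {M : Type*} [TopologicalSpace M] [ChartedSpace (Euc n) M]
  [IsManifold (𝓡 n) ∞ M]

namespace VerticalVolumeForm

variable {H : JetConnection n k M}

/-- The coefficient of the vertical volume form, in the natural chart around `u`. -/
def coeff (vol : VerticalVolumeForm H) (u : CurveJet n k M) (w : JetModel n k) : ℝ :=
  vol.form.inChart u w (verticalFrame n k)

/-- The values of the vertical volume form when one vertical coordinate field is replaced by a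
vector of the base. -/
def mixedCoeff (vol : VerticalVolumeForm H) (u : CurveJet n k M) (j : Fin (k * n))
    (w : JetModel n k) : Euc n →L[ℝ] ℝ :=
  ((vol.form.inChart u w).toContinuousMultilinearMap.toContinuousLinearMap (verticalFrame n k)
    j).comp (ContinuousLinearMap.inl ℝ (Euc n) (Fin k → Euc n))

theorem contDiffOn_coeff (vol : VerticalVolumeForm H) (u : CurveJet n k M) :
    ContDiffOn ℝ ∞ (vol.coeff u) (extChartAt 𝓘(ℝ, JetModel n k) u).target :=
  (ContinuousAlternatingMap.apply ℝ (JetModel n k) ℝ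
    (verticalFrame n k)).contDiff.comp_contDiffOn (vol.smooth u)

theorem contDiffOn_mixedCoeff (vol : VerticalVolumeForm H) (u : CurveJet n k M)
    (j : Fin (k * n)) :
    ContDiffOn ℝ ∞ (vol.mixedCoeff u j) (extChartAt 𝓘(ℝ, JetModel n k) u).target := by
  refine contDiffOn_clm_apply.2 fun X => ?_
  exact (ContinuousAlternatingMap.apply ℝ (JetModel n k) ℝ
    (Function.update (verticalFrame n k) j (X, 0))).contDiff.comp_contDiffOn (vol.smooth u)

/-- Closedness of the vertical volume form, in natural coordinates. -/
theorem fderiv_coeff_eq_sum (vol : VerticalVolumeForm H) (hvol : vol.form.extD = 0)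
    (u : CurveJet n k M) {w : JetModel n k}
    (hw : w ∈ (extChartAt 𝓘(ℝ, JetModel n k) u).target) (X : Euc n) :
    fderiv ℝ (vol.coeff u) w (X, 0) =
      ∑ j, fderiv ℝ (fun w => vol.mixedCoeff u j w X) w (verticalFrame n k j) := by
  have hd : ∀ c, DifferentiableWithinAt ℝ (vol.form.inChart c) (range 𝓘(ℝ, JetModel n k))
      (extChartAt 𝓘(ℝ, JetModel n k) c c) := fun c =>
    DiffForm.differentiableWithinAt_inChart ((vol.smooth c).of_le (WithTop.coe_le_coe.2 le_top))
      (mem_extChartAt_target c)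
  have h1 := DiffForm.inChart_extD vol.form hw hd
  rw [ModelWithCorners.range_eq_univ, extDerivWithin_univ,
    DiffForm.inChart_eq_zero (by rw [hvol]; rfl)] at h1
  have h2 : DifferentiableAt ℝ (vol.form.inChart u) w :=
    ((vol.smooth u).contDiffAt
      ((CurveJet.isOpen_extChartAt_target u).mem_nhds hw)).differentiableAt (by simp)
  exact fderiv_eq_sum_of_extDeriv_eq_zero h2 h1.symm (X, 0) (verticalFrame n k)

section Horizontal

variable {u : CurveJet n k M} {w : JetModel n k} {A : Euc n →L[ℝ] (Fin k → Euc n)}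

theorem inChart_eq_zero_of_horizontal (vol : VerticalVolumeForm H)
    (hA : ∀ X : Euc n,
      (H.hlift ((extChartAt 𝓘(ℝ, JetModel n k) u).symm w) : Euc n →L[ℝ] JetModel n k)
        ((mfderivWithin 𝓘(ℝ, Euc n) (𝓡 n) (extChartAt (𝓡 n) u.proj).symm (range (𝓡 n)) w.1 :
          Euc n →L[ℝ] Euc n) X) =
      (mfderivWithin 𝓘(ℝ, JetModel n k) 𝓘(ℝ, JetModel n k)
        (extChartAt 𝓘(ℝ, JetModel n k) u).symm (range 𝓘(ℝ, JetModel n k)) w :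
          JetModel n k →L[ℝ] JetModel n k) (X, A X))
    {v : Fin (k * n) → JetModel n k} {i : Fin (k * n)} {X : Euc n} (hi : v i = (X, A X)) :
    vol.form.inChart u w v = 0 := by
  refine vol.vertical _ _ i ?_
  change H.Φ _ ((mfderivWithin 𝓘(ℝ, JetModel n k) 𝓘(ℝ, JetModel n k)
        (extChartAt 𝓘(ℝ, JetModel n k) u).symm (range 𝓘(ℝ, JetModel n k)) w :
          JetModel n k →L[ℝ] JetModel n k) (v i)) = 0
  rw [hi, ← hA]
  exact H.Φ_hlift _ _

/-- The mixed coefficients are determined by the horizontal lift. -/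
theorem mixedCoeff_eq (vol : VerticalVolumeForm H)
    (hA : ∀ X : Euc n,
      (H.hlift ((extChartAt 𝓘(ℝ, JetModel n k) u).symm w) : Euc n →L[ℝ] JetModel n k)
        ((mfderivWithin 𝓘(ℝ, Euc n) (𝓡 n) (extChartAt (𝓡 n) u.proj).symm (range (𝓡 n)) w.1 :
          Euc n →L[ℝ] Euc n) X) =
      (mfderivWithin 𝓘(ℝ, JetModel n k) 𝓘(ℝ, JetModel n k)
        (extChartAt 𝓘(ℝ, JetModel n k) u).symm (range 𝓘(ℝ, JetModel n k)) w :
          JetModel n k →L[ℝ] JetModel n k) (X, A X))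
    (j : Fin (k * n)) (X : Euc n) :
    vol.mixedCoeff u j w X = -((fibreBasisBasis n k).repr (A X) j * vol.coeff u w) := by
  set f := vol.form.inChart u w with hf
  -- With the horizontal vector (X, AX) in slot `j` the form vanishes. When AX is expanded in the
  -- vertical frame, every term with l ≠ j repeats a frame vector, so only the j-th component of AX
  -- remains.
  have h0 : f (Function.update (verticalFrame n k) j (X, A X)) = 0 :=
    vol.inChart_eq_zero_of_horizontal hA (i := j) (X := X) (by simp)
  have h1 : ((X, A X) : JetModel n k) = (X, 0) +
      ∑ l, (fibreBasisBasis n k).repr (A X) l • verticalFrame n k l := by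
    have h2 : ∑ l, (fibreBasisBasis n k).repr (A X) l • verticalFrame n k l =
        ContinuousLinearMap.inr ℝ (Euc n) (Fin k → Euc n) (A X) := by
      conv_rhs => rw [← (fibreBasisBasis n k).sum_repr (A X)]
      rw [map_sum]
      refine Finset.sum_congr rfl fun l _ => ?_
      rw [map_smul, coe_fibreBasisBasis]
      rfl
    rw [h2]
    simp
  let L : JetModel n k →L[ℝ] ℝ :=
    f.toContinuousMultilinearMap.toContinuousLinearMap (verticalFrame n k) j
  have hL : ∀ v, L v = f (Function.update (verticalFrame n k) j v) := fun _ => rfl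
  rw [← hL, h1, map_add, map_sum, Finset.sum_eq_single j] at h0
  · rw [map_smul, hL (verticalFrame n k j), Function.update_eq_self] at h0
    exact eq_neg_of_add_eq_zero_left h0
  · intro l _ hl
    rw [map_smul, hL, f.map_eq_zero_of_eq _ (i := j) (j := l) (by simp [hl]) hl.symm, smul_zero]
  · simp

end Horizontal

/-- Every vector is vertical plus horizontal, and horizontal parts do not contribute. The form is
thus determined by its restriction to the fibre, a form of top degree there, hence by one number; if
this were zero the form would vanish at a point. -/
theorem coeff_ne_zero (vol : VerticalVolumeForm H) (u : CurveJet n k M) {w : JetModel n k}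
    (hw : w ∈ (extChartAt 𝓘(ℝ, JetModel n k) u).target) : vol.coeff u w ≠ 0 := by
  have : IsManifold 𝓘(ℝ, JetModel n k) 1 (CurveJet n k M) :=
    IsManifold.of_le (n := ∞) (by exact_mod_cast le_top)
  obtain ⟨A, hA⟩ := H.exists_hlift_eq u hw
  intro h0
  set f := vol.form.inChart u w with hf
  let P : JetModel n k →L[ℝ] JetModel n k := (ContinuousLinearMap.inr ℝ (Euc n) (Fin k → Euc n)).comp
    (ContinuousLinearMap.snd ℝ (Euc n) (Fin k → Euc n) -
      A.comp (ContinuousLinearMap.fst ℝ (Euc n) (Fin k → Euc n)))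
  have hP : ∀ v : JetModel n k, v = P v + (v.1, A v.1) := fun v => by
    ext1 <;> simp [P]
  -- Arguments are replaced by their vertical parts one slot at a time, by induction on the set of
  -- slots already treated.
  have hfP : ∀ (s : Finset (Fin (k * n))) (v : Fin (k * n) → JetModel n k),
      f v = f (fun i => if i ∈ s then P (v i) else v i) := by
    classical
    intro s v
    induction s using Finset.induction_on with
    | empty => simp
    | insert i s hi ih =>
      rw [ih]
      set v' := fun i => if i ∈ s then P (v i) else v i with hv'
      have h1 : v' = Function.update v' i (P (v i) + ((v i).1, A (v i).1)) := by
        rw [← hP (v i)]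
        have : v' i = v i := by simp [hv', hi]
        rw [← this, Function.update_eq_self]
      have h2 : f (Function.update v' i ((v i).1, A (v i).1)) = 0 :=
        vol.inChart_eq_zero_of_horizontal hA (i := i) (X := (v i).1) (by simp)
      rw [h1, ContinuousAlternatingMap.map_update_add, h2, add_zero]
      congr 1
      funext l
      by_cases hl : l = i
      · subst hl
        simp
      · simp [hv', hl]
  let g : (Fin k → Euc n) [⋀^Fin (k * n)]→ₗ[ℝ] ℝ := f.toAlternatingMap.compLinearMap
    (ContinuousLinearMap.inr ℝ (Euc n) (Fin k → Euc n)).toLinearMap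
  have hg : g = 0 := by
    rw [AlternatingMap.eq_smul_basis_det (fibreBasisBasis n k) g]
    have : g (fibreBasisBasis n k) = 0 := by
      rw [coe_fibreBasisBasis]
      exact h0
    rw [this, zero_smul]
  have hf0 : f = 0 := by
    ext v
    rw [hfP Finset.univ v]
    simp only [Finset.mem_univ, if_true]
    exact congrArg (fun g : (Fin k → Euc n) [⋀^Fin (k * n)]→ₗ[ℝ] ℝ => g fun i =>
      (v i).2 - A (v i).1) hg
  refine vol.ne_zero ((extChartAt 𝓘(ℝ, JetModel n k) u).symm w) ?_
  refine ContinuousAlternatingMap.ext fun v => ?_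
  -- The differential of the chart is invertible, so a form with zero coordinate expression at `w`
  -- is zero at that point of the jet bundle.
  have hinv := mfderivWithin_extChartAt_symm_comp_mfderiv_extChartAt hw
  have h1 := congrArg (fun f : JetModel n k [⋀^Fin (k * n)]→L[ℝ] ℝ => f fun i =>
    (mfderiv 𝓘(ℝ, JetModel n k) 𝓘(ℝ, JetModel n k) (extChartAt 𝓘(ℝ, JetModel n k) u)
      ((extChartAt 𝓘(ℝ, JetModel n k) u).symm w) : JetModel n k →L[ℝ] JetModel n k) (v i)) hf0
  refine Eq.trans ?_ h1
  change (vol.form ((extChartAt 𝓘(ℝ, JetModel n k) u).symm w) :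
    JetModel n k [⋀^Fin (k * n)]→L[ℝ] ℝ) v =
    (vol.form ((extChartAt 𝓘(ℝ, JetModel n k) u).symm w) :
    JetModel n k [⋀^Fin (k * n)]→L[ℝ] ℝ) (fun i => _)
  congr 1
  funext i
  exact (congrArg (fun L : JetModel n k →L[ℝ] JetModel n k => L (v i)) hinv).symm

end VerticalVolumeForm

end VerticalVolume

/-! ### Differentiation under the fibre integral and integration by parts. -/

section FibreIntegral

theorem ContinuousOn.continuous_section {V Y W : Type*} [TopologicalSpace V] [TopologicalSpace Y]
    [TopologicalSpace W] {O : Set V} {φ : V × Y → W} {z : V} (hz : z ∈ O)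
    (hφ : ContinuousOn φ (O ×ˢ univ)) : Continuous fun y => φ (z, y) :=
  hφ.comp_continuous (f := fun y => (z, y)) (by fun_prop) fun y => ⟨hz, mem_univ y⟩

theorem fderiv_eq_zero_off_fibre_support {V Y G : Type*} [NormedAddCommGroup V] [NormedSpace ℝ V]
    [NormedAddCommGroup Y] [NormedSpace ℝ Y] [NormedAddCommGroup G] [NormedSpace ℝ G]
    {O : Set V} (hO : IsOpen O) {C : Set Y} (hC : IsCompact C) {g : V × Y → G}
    (h0 : ∀ z ∈ O, ∀ y ∉ C, g (z, y) = 0) {z : V} (hz : z ∈ O) {y : Y} (hy : y ∉ C) :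
    fderiv ℝ g (z, y) = 0 := by
  have : g =ᶠ[𝓝 (z, y)] fun _ => 0 := by
    filter_upwards [(hO.prod hC.isClosed.isOpen_compl).mem_nhds
      (show (z, y) ∈ O ×ˢ Cᶜ from ⟨hz, hy⟩)] with w hw
    exact h0 w.1 hw.1 w.2 hw.2
  rw [this.fderiv_eq, fderiv_fun_const]
  rfl

variable {V Y G : Type*} [NormedAddCommGroup V] [NormedSpace ℝ V]
  [NormedAddCommGroup Y] [NormedSpace ℝ Y] [MeasurableSpace Y]
  [BorelSpace Y] {μ : Measure Y} [μ.IsAddHaarMeasure]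
  [NormedAddCommGroup G] [NormedSpace ℝ G]

/-- Differentiation of an integral over the fibre, for an integrand with compact support along the
fibre. -/
theorem hasFDerivAt_integral_fibre [FiniteDimensional ℝ V] [FiniteDimensional ℝ Y]
    {O : Set V} (hO : IsOpen O) {C : Set Y} (hC : IsCompact C)
    {g : V × Y → G} (hg : ContDiffOn ℝ 1 g (O ×ˢ univ))
    (h0 : ∀ z ∈ O, ∀ y ∉ C, g (z, y) = 0) {z : V} (hz : z ∈ O) :
    HasFDerivAt (fun z => ∫ y, g (z, y) ∂μ)
      (∫ y, (fderiv ℝ g (z, y)).comp (ContinuousLinearMap.inl ℝ V Y) ∂μ) z := by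
  have hOY : IsOpen (O ×ˢ (univ : Set Y)) := hO.prod isOpen_univ
  have hder : ∀ z ∈ O, ∀ y, HasFDerivAt (fun z => g (z, y))
      ((fderiv ℝ g (z, y)).comp (ContinuousLinearMap.inl ℝ V Y)) z := by
    intro z hz y
    have h1 : HasFDerivAt g (fderiv ℝ g (z, y)) (z, y) :=
      ((hg.contDiffAt (hOY.mem_nhds ⟨hz, mem_univ y⟩)).differentiableAt one_ne_zero).hasFDerivAt
    exact h1.comp z (hasFDerivAt_prodMk_left z y)
  have hcont : ContinuousOn (fun w => (fderiv ℝ g w).comp (ContinuousLinearMap.inl ℝ V Y))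
      (O ×ˢ univ) := (hg.continuousOn_fderiv_of_isOpen hOY le_rfl).clm_comp continuousOn_const
  have hsec : ∀ z ∈ O, Continuous fun y => g (z, y) := fun z hz =>
    hg.continuousOn.comp_continuous (by fun_prop) fun y => ⟨hz, mem_univ y⟩
  have hsec' : ∀ z ∈ O, Continuous fun y =>
      (fderiv ℝ g (z, y)).comp (ContinuousLinearMap.inl ℝ V Y) := fun z hz =>
    hcont.comp_continuous (f := fun y => (z, y)) (by fun_prop) fun y => ⟨hz, mem_univ y⟩
  have h0' : ∀ z ∈ O, ∀ y ∉ C, fderiv ℝ g (z, y) = 0 := fun z hz y hy =>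
    fderiv_eq_zero_off_fibre_support hO hC h0 hz hy
  -- On a closed ball times `C`, a compact set, the derivative is bounded by some `B`; the constant
  -- `B` on `C`, extended by zero, is the dominating function.
  obtain ⟨r, hr, hrO⟩ := Metric.nhds_basis_closedBall.mem_iff.1 (hO.mem_nhds hz)
  obtain ⟨B, hB⟩ := ((isCompact_closedBall z r).prod hC).exists_bound_of_continuousOn
    (hcont.mono (prod_mono hrO (subset_univ C)))
  refine hasFDerivAt_integral_of_dominated_of_fderiv_le (𝕜 := ℝ)
    (F' := fun z y => (fderiv ℝ g (z, y)).comp (ContinuousLinearMap.inl ℝ V Y))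
    (bound := C.indicator fun _ => B) (Metric.closedBall_mem_nhds z hr) ?_ ?_ ?_ ?_ ?_ ?_
  · filter_upwards [hO.mem_nhds hz] with z hz
    exact (hsec z hz).aestronglyMeasurable
  · exact (hsec z hz).integrable_of_hasCompactSupport (HasCompactSupport.intro hC (h0 z hz))
  · exact (hsec' z hz).aestronglyMeasurable
  · refine Eventually.of_forall fun y z' hz' => ?_
    by_cases hy : y ∈ C
    · rw [indicator_of_mem hy]
      exact hB (z', y) ⟨hz', hy⟩
    · rw [h0' z' (hrO hz') y hy, indicator_of_notMem hy]
      simp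
  · exact (integrable_indicator_iff hC.measurableSet).2
      (integrableOn_const hC.measure_lt_top.ne)
  · exact Eventually.of_forall fun y x hx => hder x (hrO hx) y

/-- The integrand of the derivative of a fibre integral, after integration by parts. -/
def fibreDerivIntegrand {ι : Type*} [Fintype ι] (f : V × Y → ℝ) (a : V × Y → G)
    (b : ι → V × Y → V →L[ℝ] ℝ) (e : ι → Y) (w : V × Y) : V →L[ℝ] G :=
  f w • (fderiv ℝ a w).comp (ContinuousLinearMap.inl ℝ V Y) -
    ∑ j, (b j w).smulRight (fderiv ℝ a w (0, e j))

section IntegrationByParts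

variable {ι : Type*} [Fintype ι] {O : Set V} {C : Set Y} {f : V × Y → ℝ} {a : V × Y → G}
  {b : ι → V × Y → V →L[ℝ] ℝ} {e : ι → Y}

theorem integrable_fibreDerivIntegrand (hO : IsOpen O) (hC : IsCompact C)
    (hf : ContDiffOn ℝ 1 f (O ×ˢ univ)) (ha : ContDiffOn ℝ 1 a (O ×ˢ univ))
    (hb : ∀ j, ContDiffOn ℝ 1 (b j) (O ×ˢ univ))
    (h0 : ∀ z ∈ O, ∀ y ∉ C, a (z, y) = 0) {z : V} (hz : z ∈ O) :
    Integrable (fun y => fibreDerivIntegrand f a b e (z, y)) μ := by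
  have hOY : IsOpen (O ×ˢ (univ : Set Y)) := hO.prod isOpen_univ
  have hda := ha.continuousOn_fderiv_of_isOpen hOY le_rfl
  have h0' : ∀ y ∉ C, fderiv ℝ a (z, y) = 0 := fun y hy =>
    fderiv_eq_zero_off_fibre_support hO hC h0 hz hy
  have hc : ContinuousOn (fibreDerivIntegrand f a b e) (O ×ˢ univ) := by
    refine (hf.continuousOn.smul (hda.clm_comp continuousOn_const)).sub
      (continuousOn_finsetSum _ fun j _ => ?_)
    have h1 : ContinuousOn (fun w => fderiv ℝ a w (0, e j)) (O ×ˢ univ) :=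
      hda.clm_apply continuousOn_const
    have h2 := ((ContinuousLinearMap.smulRightL ℝ V G).continuous.comp_continuousOn
      (hb j).continuousOn).clm_apply h1
    exact h2
  have hc' : Continuous fun y => fibreDerivIntegrand f a b e (z, y) :=
    hc.comp_continuous (f := fun y => (z, y)) (by fun_prop) fun y => ⟨hz, mem_univ y⟩
  refine hc'.integrable_of_hasCompactSupport (HasCompactSupport.intro hC fun y hy => ?_)
  simp [fibreDerivIntegrand, h0' y hy]

/-- By the product rule, ∂_X(f a) = f ∂_X a + (∂_X f) a. The hypothesis `hcl` writes ∂_X f as a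
divergence along the fibre, whose derivatives are then moved onto `a` by parts. -/
theorem integral_fderiv_smul_eq [CompleteSpace G] [FiniteDimensional ℝ V] [FiniteDimensional ℝ Y]
    (hO : IsOpen O) (hC : IsCompact C)
    (hf : ContDiffOn ℝ 1 f (O ×ˢ univ)) (ha : ContDiffOn ℝ 1 a (O ×ˢ univ))
    (hb : ∀ j, ContDiffOn ℝ 1 (b j) (O ×ˢ univ))
    (h0 : ∀ z ∈ O, ∀ y ∉ C, a (z, y) = 0)
    (hcl : ∀ w ∈ O ×ˢ (univ : Set Y), ∀ X : V, fderiv ℝ f w (X, 0) =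
      ∑ j, fderiv ℝ (fun w => b j w X) w (0, e j)) {z : V} (hz : z ∈ O) :
    ∫ y, (fderiv ℝ (fun w => f w • a w) (z, y)).comp (ContinuousLinearMap.inl ℝ V Y) ∂μ =
      ∫ y, fibreDerivIntegrand f a b e (z, y) ∂μ := by
  have hOY : IsOpen (O ×ˢ (univ : Set Y)) := hO.prod isOpen_univ
  have hmem : ∀ y : Y, (z, y) ∈ O ×ˢ (univ : Set Y) := fun y => ⟨hz, mem_univ y⟩
  have h0' : ∀ y ∉ C, fderiv ℝ a (z, y) = 0 := fun y hy =>
    fderiv_eq_zero_off_fibre_support hO hC h0 hz hy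
  have hda := ha.continuousOn_fderiv_of_isOpen hOY le_rfl
  have hdf := hf.continuousOn_fderiv_of_isOpen hOY le_rfl
  have hfd : ∀ y, DifferentiableAt ℝ f (z, y) := fun y =>
    (hf.contDiffAt (hOY.mem_nhds (hmem y))).differentiableAt one_ne_zero
  have had : ∀ y, DifferentiableAt ℝ a (z, y) := fun y =>
    (ha.contDiffAt (hOY.mem_nhds (hmem y))).differentiableAt one_ne_zero
  have hbX : ∀ j X, ContDiffOn ℝ 1 (fun w => b j w X) (O ×ˢ univ) := fun j X =>
    (hb j).clm_apply contDiffOn_const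
  have hbd : ∀ j X y, DifferentiableAt ℝ (fun w => b j w X) (z, y) := fun j X y =>
    ((hbX j X).contDiffAt (hOY.mem_nhds (hmem y))).differentiableAt one_ne_zero
  have hprod : ∀ y, fderiv ℝ (fun w => f w • a w) (z, y) =
      f (z, y) • fderiv ℝ a (z, y) + (fderiv ℝ f (z, y)).smulRight (a (z, y)) := fun y =>
    fderiv_fun_smul (hfd y) (had y)
  have hint1 : Integrable (fun y => (fderiv ℝ (fun w => f w • a w) (z, y)).comp
      (ContinuousLinearMap.inl ℝ V Y)) μ := by
    have hc := (hf.smul ha).continuousOn_fderiv_of_isOpen hOY le_rfl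
    refine (ContinuousOn.continuous_section hz (hc.clm_comp continuousOn_const)).integrable_of_hasCompactSupport
      (HasCompactSupport.intro hC fun y hy => ?_)
    change (fderiv ℝ (fun w => f w • a w) (z, y)).comp _ = 0
    rw [hprod, h0' y hy, h0 z hz y hy]
    ext
    simp
  have hint2 := integrable_fibreDerivIntegrand (μ := μ) (e := e) hO hC hf ha hb h0 hz
  refine ContinuousLinearMap.ext fun X => ?_
  rw [ContinuousLinearMap.integral_apply hint1, ContinuousLinearMap.integral_apply hint2]
  have hparts : ∀ j, ∫ y, b j (z, y) X • fderiv ℝ a (z, y) (0, e j) ∂μ =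
      -∫ y, fderiv ℝ (fun w => b j w X) (z, y) (0, e j) • a (z, y) ∂μ := by
    intro j
    have e1 : ∀ y, HasFDerivAt (fun y => b j (z, y) X)
        ((fderiv ℝ (fun w => b j w X) (z, y)).comp (ContinuousLinearMap.inr ℝ V Y)) y := fun y =>
      (hbd j X y).hasFDerivAt.comp y (hasFDerivAt_prodMk_right z y)
    have e2 : ∀ y, HasFDerivAt (fun y => a (z, y))
        ((fderiv ℝ a (z, y)).comp (ContinuousLinearMap.inr ℝ V Y)) y := fun y =>
      (had y).hasFDerivAt.comp y (hasFDerivAt_prodMk_right z y)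
    have hdb := (hbX j X).continuousOn_fderiv_of_isOpen hOY le_rfl
    -- No boundary term appears. The functions `b j` need not have compact support; all three
    -- integrability conditions come from that of `a`.
    have := integral_bilinear_hasFDerivAt_right_eq_neg_left_of_integrable (μ := μ)
      (B := ContinuousLinearMap.lsmul ℝ ℝ) (v := e j) (f := fun y => b j (z, y) X)
      (g := fun y => a (z, y))
      (f' := fun y => (fderiv ℝ (fun w => b j w X) (z, y)).comp (ContinuousLinearMap.inr ℝ V Y))
      (g' := fun y => (fderiv ℝ a (z, y)).comp (ContinuousLinearMap.inr ℝ V Y))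
      ?_ ?_ ?_ (fun y _ => e1 y) (fun y _ => e2 y)
    · simpa using this
    · refine Continuous.integrable_of_hasCompactSupport
        (ContinuousOn.continuous_section hz ((hdb.clm_comp continuousOn_const).clm_apply continuousOn_const |>.smul
          ha.continuousOn)) (HasCompactSupport.intro hC fun y hy => ?_)
      simp [h0 z hz y hy]
    · refine Continuous.integrable_of_hasCompactSupport
        (ContinuousOn.continuous_section hz ((hbX j X).continuousOn.smul
          ((hda.clm_comp continuousOn_const).clm_apply continuousOn_const)))
        (HasCompactSupport.intro hC fun y hy => ?_)
      simp [h0' y hy]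
    · refine Continuous.integrable_of_hasCompactSupport
        (ContinuousOn.continuous_section hz ((hbX j X).continuousOn.smul ha.continuousOn))
        (HasCompactSupport.intro hC fun y hy => ?_)
      simp [h0 z hz y hy]
  have hI1 : Integrable (fun y => f (z, y) • fderiv ℝ a (z, y) (X, 0)) μ := by
    refine Continuous.integrable_of_hasCompactSupport
      (ContinuousOn.continuous_section hz (hf.continuousOn.smul (hda.clm_apply continuousOn_const)))
      (HasCompactSupport.intro hC fun y hy => ?_)
    simp [h0' y hy]
  have hI2 : ∀ j, Integrable (fun y => b j (z, y) X • fderiv ℝ a (z, y) (0, e j)) μ := by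
    intro j
    refine Continuous.integrable_of_hasCompactSupport
      (ContinuousOn.continuous_section hz ((hbX j X).continuousOn.smul (hda.clm_apply continuousOn_const)))
      (HasCompactSupport.intro hC fun y hy => ?_)
    simp [h0' y hy]
  have hI3 : ∀ j, Integrable (fun y => fderiv ℝ (fun w => b j w X) (z, y) (0, e j) • a (z, y)) μ := by
    intro j
    have hdb := (hbX j X).continuousOn_fderiv_of_isOpen hOY le_rfl
    refine Continuous.integrable_of_hasCompactSupport
      (ContinuousOn.continuous_section hz ((hdb.clm_apply continuousOn_const).smul ha.continuousOn))
      (HasCompactSupport.intro hC fun y hy => ?_)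
    simp [h0 z hz y hy]
  have hL : ∀ y, (fderiv ℝ (fun w => f w • a w) (z, y)).comp (ContinuousLinearMap.inl ℝ V Y) X =
      f (z, y) • fderiv ℝ a (z, y) (X, 0) +
        ∑ j, fderiv ℝ (fun w => b j w X) (z, y) (0, e j) • a (z, y) := by
    intro y
    rw [hprod, ← Finset.sum_smul, ← hcl _ (hmem y)]
    simp
  have hR : ∀ y, fibreDerivIntegrand f a b e (z, y) X = f (z, y) • fderiv ℝ a (z, y) (X, 0) -
      ∑ j, b j (z, y) X • fderiv ℝ a (z, y) (0, e j) := by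
    intro y
    simp [fibreDerivIntegrand]
  simp only [hL, hR]
  rw [integral_add hI1 (integrable_finsetSum _ fun j _ => hI3 j),
    integral_sub hI1 (integrable_finsetSum _ fun j _ => hI2 j),
    integral_finsetSum _ fun j _ => hI3 j, integral_finsetSum _ fun j _ => hI2 j, sub_eq_add_neg,
    ← Finset.sum_neg_distrib]
  congr 1
  refine Finset.sum_congr rfl fun j _ => ?_
  rw [hparts j, neg_neg]

/-- The derivative is again a fibre integral with the same compact support, so it depends
continuously on the parameter. -/
theorem contDiffOn_integral_fibre [FiniteDimensional ℝ V] [FiniteDimensional ℝ Y]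
    (hO : IsOpen O) (hC : IsCompact C)
    {g : V × Y → G} (hg : ContDiffOn ℝ 1 g (O ×ˢ univ))
    (h0 : ∀ z ∈ O, ∀ y ∉ C, g (z, y) = 0) :
    ContDiffOn ℝ 1 (fun z => ∫ y, g (z, y) ∂μ) O := by
  have hOY : IsOpen (O ×ˢ (univ : Set Y)) := hO.prod isOpen_univ
  have hF : ∀ z ∈ O, fderiv ℝ (fun z => ∫ y, g (z, y) ∂μ) z =
      ∫ y, (fderiv ℝ g (z, y)).comp (ContinuousLinearMap.inl ℝ V Y) ∂μ := fun z hz =>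
    (hasFDerivAt_integral_fibre hO hC hg h0 hz).fderiv
  have h1 := (contDiffOn_succ_iff_fderiv_of_isOpen (𝕜 := ℝ) (n := 0)
    (f := fun z => ∫ y, g (z, y) ∂μ) hO).2
  rw [zero_add] at h1
  refine h1 ⟨fun z hz => (hasFDerivAt_integral_fibre hO hC hg h0
    hz).differentiableAt.differentiableWithinAt, by simp, ?_⟩
  rw [contDiffOn_zero]
  refine ContinuousOn.congr ?_ hF
  refine continuousOn_integral_of_compact_support hC ?_ ?_
  · exact (hg.continuousOn_fderiv_of_isOpen hOY le_rfl).clm_comp continuousOn_const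
  · intro z y hz hy
    rw [fderiv_eq_zero_off_fibre_support hO hC h0 hz hy, ContinuousLinearMap.zero_comp]

end IntegrationByParts

end FibreIntegral

/-! ### Fibre averages are independent of the natural chart. -/

section FibreCoordinates

variable {n k : ℕ} {M : Type*} [TopologicalSpace M] [ChartedSpace (Euc n) M]
  [IsManifold (𝓡 n) ∞ M]

namespace CurveJet

/-- The change of fibre coordinates, over the point with coordinates `z`, between the natural
charts around `u` and `u'`. -/
def fibreTransition (u u' : CurveJet n k M) (z : Euc n) (y : Fin k → Euc n) : Fin k → Euc n :=
  (extChartAt 𝓘(ℝ, JetModel n k) u' ((extChartAt 𝓘(ℝ, JetModel n k) u).symm (z, y))).2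

variable {u u' : CurveJet n k M} {z : Euc n}

theorem mk_mem_target (hz : z ∈ (extChartAt (𝓡 n) u.proj).target) (y : Fin k → Euc n) :
    (z, y) ∈ (extChartAt 𝓘(ℝ, JetModel n k) u).target := by
  rw [extChartAt_target_eq]
  exact ⟨hz, mem_univ y⟩

theorem extChartAt_extChartAt_symm (y : Fin k → Euc n) :
    extChartAt 𝓘(ℝ, JetModel n k) u' ((extChartAt 𝓘(ℝ, JetModel n k) u).symm (z, y)) =
      (extChartAt (𝓡 n) u'.proj ((extChartAt (𝓡 n) u.proj).symm z),
        fibreTransition u u' z y) := by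
  refine Prod.ext ?_ rfl
  rw [extChartAt_fst, proj_extChartAt_symm]

theorem extChartAt_symm_mem_source
    (hz' : (extChartAt (𝓡 n) u.proj).symm z ∈ (extChartAt (𝓡 n) u'.proj).source)
    (y : Fin k → Euc n) : (extChartAt 𝓘(ℝ, JetModel n k) u).symm (z, y) ∈
      (extChartAt 𝓘(ℝ, JetModel n k) u').source := by
  rw [extChartAt_source_eq, mem_preimage, proj_extChartAt_symm]
  exact hz'

theorem extChartAt_symm_fibreTransition
    (hz' : (extChartAt (𝓡 n) u.proj).symm z ∈ (extChartAt (𝓡 n) u'.proj).source)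
    (y : Fin k → Euc n) :
    (extChartAt 𝓘(ℝ, JetModel n k) u').symm
      (extChartAt (𝓡 n) u'.proj ((extChartAt (𝓡 n) u.proj).symm z), fibreTransition u u' z y) =
      (extChartAt 𝓘(ℝ, JetModel n k) u).symm (z, y) := by
  rw [← extChartAt_extChartAt_symm]
  exact (extChartAt 𝓘(ℝ, JetModel n k) u').left_inv (extChartAt_symm_mem_source hz' y)

theorem fibreTransition_fibreTransition (hz : z ∈ (extChartAt (𝓡 n) u.proj).target)
    (hz' : (extChartAt (𝓡 n) u.proj).symm z ∈ (extChartAt (𝓡 n) u'.proj).source)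
    (y : Fin k → Euc n) :
    fibreTransition u' u (extChartAt (𝓡 n) u'.proj ((extChartAt (𝓡 n) u.proj).symm z))
      (fibreTransition u u' z y) = y := by
  change (extChartAt 𝓘(ℝ, JetModel n k) u ((extChartAt 𝓘(ℝ, JetModel n k) u').symm _)).2 = y
  rw [extChartAt_symm_fibreTransition hz',
    (extChartAt 𝓘(ℝ, JetModel n k) u).right_inv (mk_mem_target hz y)]

theorem bijective_fibreTransition (hz : z ∈ (extChartAt (𝓡 n) u.proj).target)
    (hz' : (extChartAt (𝓡 n) u.proj).symm z ∈ (extChartAt (𝓡 n) u'.proj).source) :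
    Function.Bijective (fibreTransition (k := k) u u' z) := by
  refine Function.bijective_iff_has_inverse.2 ⟨_, fibreTransition_fibreTransition hz hz', ?_⟩
  intro y
  set z' := extChartAt (𝓡 n) u'.proj ((extChartAt (𝓡 n) u.proj).symm z) with hz1
  have h1 : (extChartAt (𝓡 n) u'.proj).symm z' = (extChartAt (𝓡 n) u.proj).symm z :=
    (extChartAt (𝓡 n) u'.proj).left_inv hz'
  have h2 : extChartAt (𝓡 n) u.proj ((extChartAt (𝓡 n) u'.proj).symm z') = z := by
    rw [h1, (extChartAt (𝓡 n) u.proj).right_inv hz]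
  have h3 := fibreTransition_fibreTransition (u := u') (u' := u) (z := z')
    ((extChartAt (𝓡 n) u'.proj).map_source hz')
    (by rw [h1]; exact (extChartAt (𝓡 n) u.proj).map_target hz) y
  rwa [h2] at h3

theorem hasFDerivAt_transition (hz : z ∈ (extChartAt (𝓡 n) u.proj).target)
    (hz' : (extChartAt (𝓡 n) u.proj).symm z ∈ (extChartAt (𝓡 n) u'.proj).source)
    (y : Fin k → Euc n) :
    HasFDerivAt (fun w => extChartAt 𝓘(ℝ, JetModel n k) u'
        ((extChartAt 𝓘(ℝ, JetModel n k) u).symm w))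
      (fderivWithin ℝ (fun w => extChartAt 𝓘(ℝ, JetModel n k) u'
        (id ((extChartAt 𝓘(ℝ, JetModel n k) u).symm w))) (range 𝓘(ℝ, JetModel n k)) (z, y))
      (z, y) := by
  have h := contDiffWithinAt_writtenInCharts (I := 𝓘(ℝ, JetModel n k)) (I' := 𝓘(ℝ, JetModel n k))
    (f := id) contMDiff_id (mk_mem_target hz y) (c := u') (extChartAt_symm_mem_source hz' y)
  have h1 := (h.differentiableWithinAt (by simp)).hasFDerivWithinAt
  rw [ModelWithCorners.range_eq_univ] at h1 ⊢
  exact hasFDerivWithinAt_univ.1 h1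

theorem hasFDerivAt_fibreTransition (hz : z ∈ (extChartAt (𝓡 n) u.proj).target)
    (hz' : (extChartAt (𝓡 n) u.proj).symm z ∈ (extChartAt (𝓡 n) u'.proj).source)
    (y : Fin k → Euc n) :
    HasFDerivAt (fibreTransition u u' z) (fderiv ℝ (fibreTransition u u' z) y) y :=
  ((hasFDerivAt_transition hz hz' y).comp y
    (hasFDerivAt_prodMk_right z y)).snd.differentiableAt.hasFDerivAt

/-- The change of natural coordinates maps vertical vectors to vertical vectors. -/
theorem fderivWithin_transition_vertical (hz : z ∈ (extChartAt (𝓡 n) u.proj).target)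
    (hz' : (extChartAt (𝓡 n) u.proj).symm z ∈ (extChartAt (𝓡 n) u'.proj).source)
    (y v : Fin k → Euc n) :
    fderivWithin ℝ (fun w => extChartAt 𝓘(ℝ, JetModel n k) u'
        (id ((extChartAt 𝓘(ℝ, JetModel n k) u).symm w))) (range 𝓘(ℝ, JetModel n k)) (z, y)
        (0, v) = (0, fderiv ℝ (fibreTransition u u' z) y v) := by
  have h1 := (hasFDerivAt_transition hz hz' y).comp y (hasFDerivAt_prodMk_right z y)
  have h2 := (hasFDerivAt_const (extChartAt (𝓡 n) u'.proj ((extChartAt (𝓡 n) u.proj).symm z))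
    y).prodMk (hasFDerivAt_fibreTransition hz hz' y)
  have h3 : ((fun w => extChartAt 𝓘(ℝ, JetModel n k) u'
        ((extChartAt 𝓘(ℝ, JetModel n k) u).symm w)) ∘ fun y => (z, y)) = fun y =>
      (extChartAt (𝓡 n) u'.proj ((extChartAt (𝓡 n) u.proj).symm z),
        fibreTransition u u' z y) := funext fun y => extChartAt_extChartAt_symm y
  rw [h3] at h1
  exact congrArg (fun L : (Fin k → Euc n) →L[ℝ] JetModel n k => L v) (h1.unique h2)

end CurveJet

/-- The value of a generalized form at a jet, as a form on the model space. -/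
def GenForm.value {p : ℕ} (α : GenForm n k M p) (u : CurveJet n k M) : Euc n [⋀^Fin p]→L[ℝ] ℝ :=
  α u

namespace VerticalVolumeForm

variable {H : JetConnection n k M} {p : ℕ}

/-- A change of natural coordinates preserves vertical vectors, so on the vertical frame only its
fibre part acts, and top degree along the fibre turns it into a determinant. -/
theorem coeff_eq_det_mul (vol : VerticalVolumeForm H) {u u' : CurveJet n k M} {z : Euc n}
    (hz : z ∈ (extChartAt (𝓡 n) u.proj).target)
    (hz' : (extChartAt (𝓡 n) u.proj).symm z ∈ (extChartAt (𝓡 n) u'.proj).source)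
    (y : Fin k → Euc n) :
    vol.coeff u (z, y) = (fderiv ℝ (CurveJet.fibreTransition u u' z) y).det *
      vol.coeff u' (extChartAt (𝓡 n) u'.proj ((extChartAt (𝓡 n) u.proj).symm z),
        CurveJet.fibreTransition u u' z y) := by
  have h1 := DiffForm.inChart_pullback (I := 𝓘(ℝ, JetModel n k)) (I' := 𝓘(ℝ, JetModel n k))
    vol.form (f := id) (CurveJet.mk_mem_target hz y) mdifferentiableAt_id (c := u')
    (CurveJet.extChartAt_symm_mem_source hz' y)
  rw [DiffForm.pullback_id] at h1
  set f := vol.form.inChart u' (extChartAt (𝓡 n) u'.proj ((extChartAt (𝓡 n) u.proj).symm z),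
        CurveJet.fibreTransition u u' z y) with hf
  have h2 : vol.coeff u (z, y) = f fun A => (0, fderiv ℝ (CurveJet.fibreTransition u u' z) y
      (fibreBasis n k A)) := by
    rw [coeff, h1, hf, ← CurveJet.extChartAt_extChartAt_symm]
    change (vol.form.inChart u' _) (fun A => _) = _
    congr 1
    funext A
    exact CurveJet.fderivWithin_transition_vertical hz hz' y (fibreBasis n k A)
  have h3 := AlternatingMap.apply_comp_basis (fibreBasisBasis n k)
    (f.toAlternatingMap.compLinearMap
      (ContinuousLinearMap.inr ℝ (Euc n) (Fin k → Euc n)).toLinearMap)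
    (fderiv ℝ (CurveJet.fibreTransition u u' z) y).toLinearMap
  rw [coe_fibreBasisBasis] at h3
  exact h2.trans h3

theorem density_eq (vol : VerticalVolumeForm H) (u : CurveJet n k M) (y : Fin k → Euc n) :
    vol.density u.proj y = |vol.coeff u (extChartAt (𝓡 n) u.proj u.proj, y)| := by
  have : IsManifold 𝓘(ℝ, JetModel n k) 1 (CurveJet n k M) :=
    IsManifold.of_le (n := ∞) (by exact_mod_cast le_top)
  have hw := CurveJet.mk_mem_target (mem_extChartAt_target (I := 𝓡 n) u.proj) y
  have h1 := (mdifferentiableWithinAt_extChartAt_symm hw).hasMFDerivWithinAt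
  have h2 : HasMFDerivWithinAt 𝓘(ℝ, Fin k → Euc n) 𝓘(ℝ, JetModel n k)
      (fun y : Fin k → Euc n => ((extChartAt (𝓡 n) u.proj u.proj, y) : JetModel n k)) univ y
      (ContinuousLinearMap.inr ℝ (Euc n) (Fin k → Euc n)) :=
    (hasFDerivAt_prodMk_right _ y).hasFDerivWithinAt.hasMFDerivWithinAt
  have h3 := HasMFDerivWithinAt.comp y h1 h2 (fun x _ => by simp)
  have h4 := (hasMFDerivWithinAt_univ.1 h3).mfderiv
  unfold density coeff
  congr 1
  change (vol.form (fibrePoint u.proj y) : JetModel n k [⋀^Fin (k * n)]→L[ℝ] ℝ) (fun A => _) =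
    (vol.form (fibrePoint u.proj y) : JetModel n k [⋀^Fin (k * n)]→L[ℝ] ℝ) (fun A => _)
  congr 1
  funext A
  exact congrArg (fun L : (Fin k → Euc n) →L[ℝ] JetModel n k => L (fibreBasis n k A)) h4

/-- The fibre average, computed in the fibre coordinates of any natural chart. -/
theorem average_eq_integral (vol : VerticalVolumeForm H) (α : GenForm n k M p)
    (u : CurveJet n k M) {z : Euc n} (hz : z ∈ (extChartAt (𝓡 n) u.proj).target) :
    @Eq (Euc n [⋀^Fin p]→L[ℝ] ℝ) (vol.average α ((extChartAt (𝓡 n) u.proj).symm z))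
      (∫ y : Fin k → Euc n, |vol.coeff u (z, y)| •
        α.value ((extChartAt 𝓘(ℝ, JetModel n k) u).symm (z, y))) := by
  -- The average at a point is defined through the preferred chart at that very point. `u'` is an
  -- arbitrary jet over it, here with fibre coordinates 0; its natural chart is induced by that
  -- preferred chart.
  set u' := (extChartAt 𝓘(ℝ, JetModel n k) u).symm (z, 0) with hu'
  have hp : (extChartAt (𝓡 n) u.proj).symm z = u'.proj :=
    (CurveJet.proj_extChartAt_symm u (z, 0)).symm
  have hz' : (extChartAt (𝓡 n) u.proj).symm z ∈ (extChartAt (𝓡 n) u'.proj).source := by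
    rw [hp]
    exact mem_extChartAt_source _
  have h1 : @Eq (Euc n [⋀^Fin p]→L[ℝ] ℝ) (vol.average α ((extChartAt (𝓡 n) u.proj).symm z))
      (vol.average α u'.proj) :=
    congrArg (β := Euc n [⋀^Fin p]→L[ℝ] ℝ) (fun x => vol.average α x) hp
  set z' := extChartAt (𝓡 n) u'.proj ((extChartAt (𝓡 n) u.proj).symm z) with hz1
  have hz2 : extChartAt (𝓡 n) u'.proj u'.proj = z' := by rw [hz1, hp]
  have h2 : @Eq (Euc n [⋀^Fin p]→L[ℝ] ℝ) (vol.average α u'.proj)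
      (∫ y : Fin k → Euc n, |vol.coeff u' (z', y)| •
        α.value ((extChartAt 𝓘(ℝ, JetModel n k) u').symm (z', y))) := by
    rw [← hz2]
    change (∫ y : Fin k → Euc n, vol.density u'.proj y • α.value (fibrePoint u'.proj y)) = _
    simp only [density_eq]
    rfl
  -- The fibre transition maps the whole coordinate space onto itself, and its Jacobian is absorbed
  -- by the change of the volume coefficient.
  have h3 := integral_image_eq_integral_abs_det_fderiv_smul (volume : Measure (Fin k → Euc n))
    MeasurableSet.univ
    (fun y _ => (CurveJet.hasFDerivAt_fibreTransition hz hz' y).hasFDerivWithinAt)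
    (CurveJet.bijective_fibreTransition hz hz').injective.injOn
    (fun y => |vol.coeff u' (z', y)| •
        α.value ((extChartAt 𝓘(ℝ, JetModel n k) u').symm (z', y)))
  rw [image_univ, (CurveJet.bijective_fibreTransition hz hz').surjective.range_eq,
    Measure.restrict_univ] at h3
  refine h1.trans (h2.trans (h3.trans (integral_congr_ae (Eventually.of_forall fun y => ?_))))
  change |_| • |_| • α.value ((extChartAt 𝓘(ℝ, JetModel n k) u').symm (z', _)) = |_| • _
  rw [smul_smul, ← abs_mul, ← vol.coeff_eq_det_mul hz hz' y,
    CurveJet.extChartAt_symm_fibreTransition hz' y]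

theorem inChart_average (vol : VerticalVolumeForm H) (α : GenForm n k M p) (u : CurveJet n k M)
    {z : Euc n} (hz : z ∈ (extChartAt (𝓡 n) u.proj).target) :
    (vol.average α).inChart u.proj z =
      ∫ y : Fin k → Euc n, |vol.coeff u (z, y)| • α.inNatChart u (z, y) := by
  have : IsManifold (𝓡 n) 1 M := IsManifold.of_le (n := ∞) (by exact_mod_cast le_top)
  let s : Euc n →L[ℝ] Euc n :=
    mfderivWithin 𝓘(ℝ, Euc n) (𝓡 n) (extChartAt (𝓡 n) u.proj).symm (range (𝓡 n)) z
  let D : Euc n →L[ℝ] Euc n := mfderiv (𝓡 n) 𝓘(ℝ, Euc n) (extChartAt (𝓡 n) u.proj)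
      ((extChartAt (𝓡 n) u.proj).symm z)
  have h1 : ∀ X, D (s X) = X := fun X => congrArg (fun L : Euc n →L[ℝ] Euc n => L X)
    (mfderiv_extChartAt_comp_mfderivWithin_extChartAt_symm hz)
  have h2 : ∀ X, s (D X) = X := fun X => congrArg (fun L : Euc n →L[ℝ] Euc n => L X)
    (mfderivWithin_extChartAt_symm_comp_mfderiv_extChartAt hz)
  let e : (Euc n [⋀^Fin p]→L[ℝ] ℝ) ≃L[ℝ] (Euc n [⋀^Fin p]→L[ℝ] ℝ) :=
    (ContinuousLinearEquiv.equivOfInverse D s h2 h1).continuousAlternatingMapCongrLeft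
  have h3 : (vol.average α).inChart u.proj z = e (∫ y : Fin k → Euc n, |vol.coeff u (z, y)| •
        α.value ((extChartAt 𝓘(ℝ, JetModel n k) u).symm (z, y))) :=
    congrArg e (vol.average_eq_integral α u hz)
  -- An invertible linear map commutes with the integral even if the integrand is not integrable, so
  -- no condition on `α` is needed.
  rw [h3, ← e.integral_comp_comm]
  refine integral_congr_ae (Eventually.of_forall fun y => ?_)
  change e (|_| • _) = |_| • _
  rw [map_smul]
  rfl

end VerticalVolumeForm

end FibreCoordinates

/-! ### Averaging commutes with the exterior derivative. -/

section Average

variable {n k : ℕ} {M : Type*} [TopologicalSpace M] [ChartedSpace (Euc n) M]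
  [IsManifold (𝓡 n) ∞ M] {p : ℕ}

/-- In natural coordinates, compact vertical support is locally uniform in the base point. -/
theorem GenForm.HasCompactVerticalSupport.exists_isCompact {α : GenForm n k M p}
    (hα : α.HasCompactVerticalSupport) (u : CurveJet n k M) {z : Euc n}
    (hz : z ∈ (extChartAt (𝓡 n) u.proj).target) :
    ∃ r > 0, Metric.ball z r ⊆ (extChartAt (𝓡 n) u.proj).target ∧
      ∃ C : Set (Fin k → Euc n), IsCompact C ∧
        ∀ z' ∈ Metric.ball z r, ∀ y ∉ C, α.inNatChart u (z', y) = 0 := by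
  obtain ⟨r, hr, hrT⟩ := Metric.nhds_basis_closedBall.mem_iff.1
    ((isOpen_extChartAt_target u.proj).mem_nhds hz)
  -- The support over the image of a closed ball is compact; its projection to the fibre coordinates
  -- is a set `C` valid for all base points of the ball at once.
  set K := (extChartAt (𝓡 n) u.proj).symm '' Metric.closedBall z r with hK
  have hKc : IsCompact K := (isCompact_closedBall z r).image_of_continuousOn
    ((continuousOn_extChartAt_symm u.proj).mono hrT)
  have hS := hα K hKc
  set S := CurveJet.proj ⁻¹' K ∩ closure {u | α u ≠ 0} with hSdef
  have hSs : S ⊆ (extChartAt 𝓘(ℝ, JetModel n k) u).source := by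
    rintro v ⟨⟨x, hx, hxv⟩, -⟩
    rw [CurveJet.extChartAt_source_eq, mem_preimage, ← hxv]
    exact (extChartAt (𝓡 n) u.proj).map_target (hrT hx)
  refine ⟨r, hr, Metric.ball_subset_closedBall.trans hrT,
    Prod.snd '' (extChartAt 𝓘(ℝ, JetModel n k) u '' S),
    (hS.image_of_continuousOn ((continuousOn_extChartAt u).mono hSs)).image continuous_snd, ?_⟩
  intro z' hz' y hy
  by_contra hne
  refine hy ⟨(z', y), ⟨(extChartAt 𝓘(ℝ, JetModel n k) u).symm (z', y), ⟨?_, subset_closure ?_⟩,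
    (extChartAt 𝓘(ℝ, JetModel n k) u).right_inv (CurveJet.mk_mem_target
      (hrT (Metric.ball_subset_closedBall hz')) y)⟩, rfl⟩
  · rw [mem_preimage, CurveJet.proj_extChartAt_symm]
    exact mem_image_of_mem _ (Metric.ball_subset_closedBall hz')
  · intro h0
    refine hne (ContinuousAlternatingMap.ext fun v => ?_)
    exact congrArg (fun f : Euc n [⋀^Fin p]→L[ℝ] ℝ => f fun i => (mfderivWithin 𝓘(ℝ, Euc n) (𝓡 n)
      (extChartAt (𝓡 n) u.proj).symm (range (𝓡 n)) z' : Euc n →L[ℝ] Euc n) (v i)) h0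

namespace VerticalVolumeForm

variable {H : JetConnection n k M}

/-- The coefficient is continuous and has no zeros on the connected set `O` times the fibre, so its
sign is constant and `s` is 1 or -1. This allows |f| to be differentiated like f. -/
theorem exists_abs_coeff_eq (vol : VerticalVolumeForm H) (u : CurveJet n k M) {O : Set (Euc n)}
    (hO : IsPreconnected O) (hOT : O ⊆ (extChartAt (𝓡 n) u.proj).target) :
    ∃ s : ℝ, ∀ z ∈ O, ∀ y : Fin k → Euc n, |vol.coeff u (z, y)| = s * vol.coeff u (z, y) := by
  have hsub : O ×ˢ (univ : Set (Fin k → Euc n)) ⊆ (extChartAt 𝓘(ℝ, JetModel n k) u).target :=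
    fun w hw => CurveJet.mk_mem_target (hOT hw.1) w.2
  have hc := (vol.contDiffOn_coeff u).continuousOn.mono hsub
  rcases IsPreconnected.eq_or_eq_neg_of_sq_eq (hO.prod isPreconnected_univ) hc.abs hc
    (fun w _ => sq_abs _) (fun {w} hw => vol.coeff_ne_zero u (hsub hw)) with h | h
  · exact ⟨1, fun z hz y => by rw [one_mul]; exact h ⟨hz, mem_univ y⟩⟩
  · exact ⟨-1, fun z hz y => by rw [neg_one_mul]; exact h ⟨hz, mem_univ y⟩⟩

/-- The exterior derivative of generalized forms, multiplied by the coefficient of the volume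
form. -/
theorem coeff_smul_inNatChart_d4 (vol : VerticalVolumeForm H) {α : GenForm n k M p}
    (hα : α.IsSmooth) (u : CurveJet n k M) {w : JetModel n k}
    (hw : w ∈ (extChartAt 𝓘(ℝ, JetModel n k) u).target) :
    vol.coeff u w • (H.d4 α).inNatChart u w = ContinuousAlternatingMap.alternatizeUncurryFinCLM ℝ
      (Euc n) ℝ (fibreDerivIntegrand (vol.coeff u) (α.inNatChart u) (vol.mixedCoeff u)
        (fibreBasis n k) w) := by
  obtain ⟨A, hA⟩ := H.exists_hlift_eq u hw
  rw [H.inNatChart_d4 hα u hw hA]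
  change vol.coeff u w • ContinuousAlternatingMap.alternatizeUncurryFinCLM ℝ (Euc n) ℝ _ = _
  rw [← map_smul]
  congr 1
  refine ContinuousLinearMap.ext fun X => ?_
  set D := fderiv ℝ (α.inNatChart u) w with hD
  have h1 : D (X, A X) = D (X, 0) +
      ∑ j, (fibreBasisBasis n k).repr (A X) j • D (0, fibreBasis n k j) := by
    have h2 : ((X, A X) : JetModel n k) =
        (X, 0) + ContinuousLinearMap.inr ℝ (Euc n) (Fin k → Euc n) (A X) := by simp
    rw [h2, map_add]
    congr 1
    conv_lhs => rw [← (fibreBasisBasis n k).sum_repr (A X)]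
    rw [map_sum, map_sum]
    refine Finset.sum_congr rfl fun j _ => ?_
    rw [map_smul, map_smul, coe_fibreBasisBasis]
    rfl
  have h3 : fibreDerivIntegrand (vol.coeff u) (α.inNatChart u) (vol.mixedCoeff u)
      (fibreBasis n k) w X = vol.coeff u w • D (X, 0) -
        ∑ j, vol.mixedCoeff u j w X • D (0, fibreBasis n k j) := by
    simp [fibreDerivIntegrand, hD]
  rw [h3]
  change vol.coeff u w • D (X, A X) = _
  rw [h1, smul_add, Finset.smul_sum, sub_eq_add_neg, ← Finset.sum_neg_distrib]
  congr 1
  refine Finset.sum_congr rfl fun j _ => ?_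
  -- Here verticality removes `A`: f times the j-th component of AX is minus the mixed coefficient.
  rw [vol.mixedCoeff_eq hA, smul_smul, mul_comm]
  have h4 : ∀ (c : ℝ) (x : Euc n [⋀^Fin p]→L[ℝ] ℝ), c • x = -(-c • x) := fun c x =>
    ContinuousAlternatingMap.ext fun v => by simp
  exact h4 _ _

/-- Fibre averages are of class `C^1`, and averaging commutes with exterior derivatives. -/
theorem average_extDeriv (vol : VerticalVolumeForm H) (hvol : vol.form.extD = 0)
    {α : GenForm n k M p} (hα : α.IsSmooth) (hαv : α.HasCompactVerticalSupport)
    (u : CurveJet n k M) {z : Euc n} (hz : z ∈ (extChartAt (𝓡 n) u.proj).target) :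
    ContDiffAt ℝ 1 ((vol.average α).inChart u.proj) z ∧
      (vol.average (H.d4 α)).inChart u.proj z = extDeriv ((vol.average α).inChart u.proj) z := by
  obtain ⟨r, hr, hrT, C, hC, h0⟩ := hαv.exists_isCompact u hz
  obtain ⟨s, hs⟩ := vol.exists_abs_coeff_eq u (convex_ball z r).isPreconnected hrT
  set O := Metric.ball z r with hOdef
  have hO : IsOpen O := Metric.isOpen_ball
  have hzO : z ∈ O := Metric.mem_ball_self hr
  have hsub : O ×ˢ (univ : Set (Fin k → Euc n)) ⊆ (extChartAt 𝓘(ℝ, JetModel n k) u).target :=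
    fun w hw => CurveJet.mk_mem_target (hrT hw.1) w.2
  have h1 : (1 : ℕ∞ω) ≤ ∞ := WithTop.coe_le_coe.2 le_top
  have hf := ((vol.contDiffOn_coeff u).of_le h1).mono hsub
  have ha := ((GenForm.contDiffOn_inNatChart hα u).of_le h1).mono hsub
  have hb := fun j => ((vol.contDiffOn_mixedCoeff u j).of_le h1).mono hsub
  have hg := hf.smul ha
  have hg0 : ∀ z ∈ O, ∀ y ∉ C, vol.coeff u (z, y) • α.inNatChart u (z, y) = 0 :=
    fun z hz y hy => by rw [h0 z hz y hy, smul_zero]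
  -- The same sign `s` serves for `α` and for `H.d4 α`; the formula is stated for all degrees to
  -- cover both.
  have havg : ∀ {q : ℕ} (β : GenForm n k M q), ∀ z ∈ O, (vol.average β).inChart u.proj z =
      s • ∫ y, vol.coeff u (z, y) • β.inNatChart u (z, y) := by
    intro q β z hz
    rw [vol.inChart_average β u (hrT hz), ← integral_smul]
    refine integral_congr_ae (Eventually.of_forall fun y => ?_)
    change |_| • _ = s • _ • _
    rw [hs z hz y, mul_smul]
  have hev : (vol.average α).inChart u.proj =ᶠ[𝓝 z] fun z =>
      s • ∫ y, vol.coeff u (z, y) • α.inNatChart u (z, y) :=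
    Filter.mem_of_superset (hO.mem_nhds hzO) (havg α)
  have hcd : ContDiffAt ℝ 1
      (fun z => ∫ y, vol.coeff u (z, y) • α.inNatChart u (z, y)) z :=
    (contDiffOn_integral_fibre hO hC hg hg0).contDiffAt (hO.mem_nhds hzO)
  refine ⟨(hcd.const_smul s).congr_of_eventuallyEq hev, ?_⟩
  have hder := hasFDerivAt_integral_fibre (μ := volume) hO hC hg hg0 hzO
  -- This is where closedness of the volume form enters.
  have hparts := integral_fderiv_smul_eq (μ := volume) hO hC hf ha hb h0
    (fun w hw X => vol.fderiv_coeff_eq_sum hvol u (hsub hw) X) hzO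
  have hder' : fderiv ℝ ((vol.average α).inChart u.proj) z = s • ∫ y, fibreDerivIntegrand
      (vol.coeff u) (α.inNatChart u) (vol.mixedCoeff u) (fibreBasis n k) (z, y) := by
    rw [hev.fderiv_eq, ← hparts]
    exact (hder.const_smul s).fderiv
  have hint := integrable_fibreDerivIntegrand (μ := volume) (e := fibreBasis n k) hO hC hf ha hb
    h0 hzO
  rw [havg (H.d4 α) z hzO, extDeriv, hder']
  change _ = ContinuousAlternatingMap.alternatizeUncurryFinCLM ℝ (Euc n) ℝ _
  rw [map_smul, ← ContinuousLinearMap.integral_comp_comm _ hint]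
  congr 1
  refine integral_congr_ae (Eventually.of_forall fun y => ?_)
  exact vol.coeff_smul_inNatChart_d4 hα u (hsub ⟨hzO, mem_univ y⟩)

/-- Every preferred chart of `M` underlies a natural chart: any jet over `c`, such as `fibrePoint c
0`, provides one. -/
theorem contDiffOn_inChart_average (vol : VerticalVolumeForm H) (hvol : vol.form.extD = 0)
    {α : GenForm n k M p} (hα : α.IsSmooth) (hαv : α.HasCompactVerticalSupport) (c : M) :
    ContDiffOn ℝ 1 ((vol.average α).inChart c) (extChartAt (𝓡 n) c).target := by
  obtain ⟨u, rfl⟩ : ∃ u : CurveJet n k M, u.proj = c := ⟨fibrePoint c 0, proj_fibrePoint c 0⟩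
  exact fun z hz => (vol.average_extDeriv hvol hα hαv u hz).1.contDiffWithinAt

theorem inChart_average_d4 (vol : VerticalVolumeForm H) (hvol : vol.form.extD = 0)
    {α : GenForm n k M p} (hα : α.IsSmooth) (hαv : α.HasCompactVerticalSupport) (c : M)
    {z : Euc n} (hz : z ∈ (extChartAt (𝓡 n) c).target) :
    (vol.average (H.d4 α)).inChart c z = extDeriv ((vol.average α).inChart c) z := by
  obtain ⟨u, rfl⟩ : ∃ u : CurveJet n k M, u.proj = c := ⟨fibrePoint c 0, proj_fibrePoint c 0⟩
  exact (vol.average_extDeriv hvol hα hαv u hz).2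

end VerticalVolumeForm

end Average

/-! ### Pullback to the manifold with boundary, and the theorem. -/

theorem DiffForm.contDiffOn_inChart_pullback {E E' H H' : Type*} [NormedAddCommGroup E]
    [NormedSpace ℝ E] [FiniteDimensional ℝ E] [NormedAddCommGroup E'] [NormedSpace ℝ E']
    [FiniteDimensional ℝ E'] [TopologicalSpace H] [TopologicalSpace H']
    {I : ModelWithCorners ℝ E H} {I' : ModelWithCorners ℝ E' H'} [I.Boundaryless]
    {X Y : Type*} [TopologicalSpace X] [ChartedSpace H X] [IsManifold I ∞ X]
    [TopologicalSpace Y] [ChartedSpace H' Y] [IsManifold I' ∞ Y] {p : ℕ} {τ : DiffForm I X p}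
    (hτ : ∀ c, ContDiffOn ℝ 1 (τ.inChart c) (extChartAt I c).target) {f : Y → X}
    (hf : ContMDiff I' I ∞ f) (b : Y) :
    ContDiffOn ℝ 1 ((τ.pullback (I' := I') f).inChart b) (extChartAt I' b).target := by
  intro y hy
  set x := f ((extChartAt I' b).symm y) with hx
  have hc : f ((extChartAt I' b).symm y) ∈ (extChartAt I x).source := mem_extChartAt_source x
  have h1 := DiffForm.inChart_pullback_eventuallyEq (I' := I') τ hf hy hc
  have h2 := contDiffWithinAt_writtenInCharts hf hy hc
  -- Since `X` has no boundary, the chart target is open and τ is C¹ on a full neighbourhood; no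
  -- condition on where `f` sends nearby points is needed.
  have h3 : ContDiffWithinAt ℝ 1 (fun z => τ.inChart x (extChartAt I x
      (f ((extChartAt I' b).symm z)))) (range I') y :=
    ((hτ x).contDiffAt ((isOpen_extChartAt_target x).mem_nhds
      (mem_extChartAt_target x))).comp_contDiffWithinAt y
        (h2.of_le (WithTop.coe_le_coe.2 le_top))
  have h4 := h2.fderivWithin_right (m := 1) I'.uniqueDiffOn
    (WithTop.coe_le_coe.2 (le_top : (1 + 1 : ℕ∞) ≤ ⊤)) (extChartAt_target_subset_range b hy)
  have h5 := (ContDiffWithinAt.alternating_compContinuousLinearMap h3 h4).congr_of_eventuallyEq h1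
    (h1.self_of_nhdsWithin (extChartAt_target_subset_range b hy))
  exact h5.mono (extChartAt_target_subset_range b)

end

theorem mainTheorem5 {n k m : ℕ}
    {M : Type*} [TopologicalSpace M] [T2Space M] [ChartedSpace (Euc n) M] [IsManifold (𝓡 n) ∞ M]
    (H : JetConnection n k M) (vol : VerticalVolumeForm H) (hvol : vol.form.extD = 0)
    {N : Type*} [TopologicalSpace N] [T2Space N] [SigmaCompactSpace N]
    [ChartedSpace (EuclideanHalfSpace (m + 1)) N] [IsManifold (𝓡∂ (m + 1)) ∞ N]
    (o : ManifoldOrientation (𝓡∂ (m + 1)) N)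
    (ι : N → M) (hι : ContMDiff (𝓡∂ (m + 1)) (𝓡 n) ∞ ι)
    (α : GenForm n k M m) (hα : α.IsSmooth) (hαv : α.HasCompactVerticalSupport)
    (hαN : ∃ K : Set N, IsCompact K ∧ ∀ q ∉ K, ∀ u : CurveJet n k M, u.proj = ι q → α u = 0) :
    o.integral ((vol.average (H.d4 α)).pullback ι) =
      o.boundaryIntegral ((vol.average α).pullback ι) := by
  obtain ⟨K, hK, hK0⟩ := hαN
  refine o.integral_eq_boundaryIntegral (DiffForm.contDiffOn_inChart_pullback
    (vol.contDiffOn_inChart_average hvol hα hαv) hι) ?_ hK ?_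
  -- Both sides are read in a chart of `M` around the image point: the pullback commutes with d, and
  -- d of the average is the average of `H.d4 α`.
  · intro c y hy
    set x := ι ((extChartAt (𝓡∂ (m + 1)) c).symm y) with hx
    have hc : ι ((extChartAt (𝓡∂ (m + 1)) c).symm y) ∈ (extChartAt (𝓡 n) x).source :=
      mem_extChartAt_source x
    have hxt : extChartAt (𝓡 n) x (ι ((extChartAt (𝓡∂ (m + 1)) c).symm y)) ∈
      (extChartAt (𝓡 n) x).target := mem_extChartAt_target x
    rw [DiffForm.inChart_pullback _ hy (hι.mdifferentiableAt (by simp)) hc,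
      DiffForm.extDerivWithin_inChart_pullback _ hι hy hc
        (DiffForm.differentiableWithinAt_inChart (vol.contDiffOn_inChart_average hvol hα hαv x)
          hxt), vol.inChart_average_d4 hvol hα hαv x hxt, ModelWithCorners.range_eq_univ (𝓡 n),
      extDerivWithin_univ]
  -- Off `K`, `α` vanishes on the entire fibre over `ι q`, hence so does its average at `ι q`.
  · intro q hq
    have h0 : @Eq (Euc n [⋀^Fin m]→L[ℝ] ℝ) (vol.average α (ι q)) 0 := by
      change (∫ y : Fin k → Euc n, vol.density (ι q) y • α.value (fibrePoint (ι q) y)) = 0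
      have : ∀ y : Fin k → Euc n, α.value (fibrePoint (ι q) y) = 0 := fun y =>
        hK0 q hq _ (proj_fibrePoint (ι q) y)
      simp [this]
    refine ContinuousAlternatingMap.ext fun v => ?_
    exact congrArg (fun f : Euc n [⋀^Fin m]→L[ℝ] ℝ => f _) h0
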